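/- **Setting.** Let $N\ge 1$, let $a,b,\delta\in\mathbb C$ with $a,b\ne0$, $a^2\neq b^2$, and let $(p_k,P_k)\in\mathbb C^2$ $(k=1,\dots,N)$ satisfy $P_k^2=(p_k^2-a^2)(p_k^2-b^2)$, $p_k^2\neq a^2,b^2$. Let $e_k$ be the unit vectors of $\mathbb Z^N$. The equation Q3$_\delta$ on an elementary quadrilateral in directions $k,l$ is $$P_k(u\,u_l+u_k\,u_{kl})-P_l(u\,u_k+u_l\,u_{kl})-(p_k^2-p_l^2)\Bigl(u_ku_l+u\,u_{kl}+\frac{\delta^2}{4P_kP_l}\Bigr)=0,$$ where $u=u(n)$, $u_k=u(n+e_k)$, $u_l=u(n+e_l)$, $u_{kl}=u(n+e_k+e_l)$. Put $\mathscr H_k(u,v)=P_k(u^2+v^2)-(2p_k^2-a^2-b^2)uv+\frac{\delta^2}{4P_k}$. Let $\Gamma:\mathbb Z\to\mathbb Z^N$ be a staircase, $\Gamma(i+1)=\Gamma(i)+e_{d(i)}$, $\Gamma(i_o)=0$, let ${\rm I}=\{d(i)\}$ be its set of directions, write $(q_i,Q_i):=(p_{d(i)},P_{d(i)})$ for the parameters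 of the step $i\to i+1$, and assume $q_i\ne0$ for all $i$. Let $K$ be larger than $\bigl|\frac{p_r+a}{p_r-a}\bigr|,\bigl|\frac{p_r-a}{p_r+a}\bigr|,\bigl|\frac{p_r+b}{p_r-b}\bigr|,\bigl|\frac{p_r-b}{p_r+b}\bigr|$ for all $r\in{\rm I}$, and let $$\mathscr P=\bigcup_{r\in{\rm I}}\Bigl\{\zeta:\Bigl|\frac{p_r-\zeta}{p_r+\zeta}\Bigr|>K\Bigr\},\qquad \mathscr P^*=-\mathscr P .$$ *Direct scattering.* Let $\upsilon:\mathbb Z\to\mathbb C$ (a potential on $\Gamma$, depending symmetrically on $a,b$) satisfy $\sum_i|\upsilon_i|K^{|i|}(1+|i|)<\infty$. For $\zeta\notin\mathscr P$ let $\Lambda(i;\zeta)$, $\Upsilon(i;\zeta)$ be the sums of the Neumann series of $$\Lambda(i)=1+\sum_{l<i}\frac1{2\zeta}\Bigl[1-\prod_{r=l}^{i-1}\frac{q_r-\zeta}{q_r+\zeta}\Bigr]\upsilon_l\Lambda(l),\qquad \Upsilon(i)=1+\sum_{l>i}\frac1{2\zeta}\Bigl[1-\prod_{r=i}^{l-1}\frac{q_r-\zeta}{q_r+\zeta}\Bigr]\upsilon_l\Upsilon(l),$$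 put $\rho(n;\zeta)=\prod_{r=1}^N\bigl(\frac{p_r+\zeta}{p_r-\zeta}\bigr)^{n_r}$, and let, with $i=i_o$, $$\mathtt A(\zeta)=\tfrac1{2\zeta}\bigl[(q_i+\zeta)\Upsilon(i;\zeta)\Lambda(i+1;\zeta)-(q_i-\zeta)\Upsilon(i+1;\zeta)\Lambda(i;\zeta)\bigr],$$ $$\mathtt B(\zeta)=\tfrac{q_i-\zeta}{2\zeta}\bigl[\Lambda(i;-\zeta)\Upsilon(i+1;\zeta)-\Lambda(i+1;-\zeta)\Upsilon(i;\zeta)\bigr].$$ The potential is *admissible* if moreover $\mathtt A$ has only finitely many zeros $\zeta_1,\dots,\zeta_M$ in $\mathbb C\setminus(\mathscr P\cup\partial\mathscr P\cup\{0\})$, all simple. Assume this. Put $C_j=c_j/\mathtt A'(\zeta_j)$, where $c_j$ is given by $\Upsilon(i;\zeta_j)=c_j\Lambda(i;\zeta_j)\rho(\Gamma(i);\zeta_j)$ for all $i$ if $\zeta_j\in\mathscr P^*$, and $c_j=\mathtt B(\zeta_j)$ otherwise; put $R=\mathtt B/\mathtt A$. *Contour.* Let $L\subset\mathbb C\setminus(\mathscr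 P\cup\partial\mathscr P)$ be a positively oriented, piecewise $C^1$, simple closed contour with interior $\mathcal R^+$ and exterior $\mathcal R^-$ such that $\mathscr P^*\subseteq\mathcal R^+$, $\zeta_j\in\mathcal R^+$ for all $j$, and $0,\pm a,\pm b\in\mathcal R^-$. Assume also that $-\zeta\in\mathcal R^-$ for all $\zeta\in L\cup\mathcal R^+$, and that no $\pm p_k$ lies on $L$ or equals some $\zeta_j$. *$N$-dimensional Jost function.* Call $n\in\mathbb Z^N$ *regular* if there is exactly one function $\Lambda(n;\cdot)$ on $-\mathcal R^-$, continuous on $L$, with $$\Lambda(n;\zeta)=1-\sum_{j=1}^M\frac{C_j\Lambda(n;\zeta_j)}{\zeta+\zeta_j}\rho(n;\zeta_j)+\frac1{2\pi i}\int_L\frac{R(\sigma)\Lambda(n;\sigma)}{\sigma+\zeta}\rho(n;\sigma)\,d\sigma\qquad(-\zeta\in\mathcal R^-).$$ Put $\mathcal F(x,y)(n)=\prod_{r=1}^N\bigl(\frac{(p_r+x)(p_r+y)}{P_r}\bigr)^{n_r}$ for $x=\pm a$, $y=\pm b$ (this is $\prod_r\bigl(\frac{(p_r+x)(p_r+y)}{(p_r-x)(p_r-y)}\bigr)^{n_r/2}$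 with the branch of the square root fixed by $P_r$). **Theorem 2.2.** In this setting the following hold. 1. Every point $\Gamma(i)$ is regular, and $\Lambda(\Gamma(i);\zeta)=\Lambda(i;\zeta)$ for $-\zeta\in\mathcal R^-$. 2. For $x=\pm a$, $y=\pm b$ and $n$, $n+e_k$ regular, the value $$\mathscr S(x,y)(n)=\frac1{x-y}\Bigl((p_k+x)\Lambda(n+e_k;x)\Lambda(n;y)-(p_k+y)\Lambda(n;x)\Lambda(n+e_k;y)\Bigr)$$ does not depend on the direction $k$, and $\mathscr S(x,y)(\Gamma(i))\to1$ as $i\to-\infty$. 3. Let $\mathscr A,\mathscr B,\mathscr C,\mathscr D\in\mathbb C$ satisfy $\mathscr A\mathscr D(a+b)^2-\mathscr B\mathscr C(a-b)^2=-\frac{\delta^2}{16ab}$. Let $$u=\mathscr A\mathcal F(a,b)\mathscr S(a,b)+\mathscr B\mathcal F(a,-b)\mathscr S(a,-b)+\mathscr C\mathcal F(-a,b)\mathscr S(-a,b)+\mathscr D\mathcal F(-a,-b)\mathscr S(-a,-b)$$ at all points $n$ where $\mathscr S$ is defined, i.e. $n$ and some $n+e_k$ are regular. Then $u$ satisfies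 Q3$_\delta$ on every elementary quadrilateral at whose four vertices it is defined. Moreover $u$ has the potential $\upsilon$ on $\Gamma$: there is a function $\mathscr U$ with $\mathscr U(n)\,\mathscr U(n+e_k)=\mathscr H_k(u(n),u(n+e_k))$ whenever $u$ is defined at $n$ and $n+e_k$, and with $$Q_{i+1}u(\Gamma(i+2))-(q_{i+1}^2-q_i^2)u(\Gamma(i+1))-Q_iu(\Gamma(i))=(q_i+q_{i+1}+\upsilon_{i+1})\,\mathscr U(\Gamma(i+1))\qquad(i\in\mathbb Z).$$ 4. Conversely, if $v,\mathscr V:\mathbb Z\to\mathbb C$, $\mathscr V$ without zeros, satisfy $\mathscr V_i\mathscr V_{i+1}=\mathscr H_{d(i)}(v_i,v_{i+1})$ and $\upsilon_{i+1}=\frac{Q_{i+1}v_{i+2}-(q_{i+1}^2-q_i^2)v_{i+1}-Q_iv_i}{\mathscr V_{i+1}}-q_i-q_{i+1}$ for all $i$, then $v_i=u(\Gamma(i))$ for all $i$ and some constants $\mathscr A,\mathscr B,\mathscr C,\mathscr D$ as in 3. -/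

import Mathlib

open Filter Topology

noncomputable section

namespace Q3IST

/-! ### Closed contours in the complex plane -/

/-- The point set of a closed contour parametrised by `[0,1]`. -/
def contourImage (γ : ℝ → ℂ) : Set ℂ := γ '' Set.Icc 0 1

/-- `∫_γ g(σ) dσ`. -/
def contourIntegral (γ : ℝ → ℂ) (g : ℂ → ℂ) : ℂ :=
  ∫ t in (0 : ℝ)..1, g (γ t) * deriv γ t

/-- The winding number of `γ` about `z` (for `z` off the contour). -/
def winding (γ : ℝ → ℂ) (z : ℂ) : ℂ :=
  (2 * (Real.pi : ℂ) * Complex.I)⁻¹ * contourIntegral γ (fun σ => 1 / (σ - z))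

/-- A positively oriented, piecewise continuously differentiable, simple closed contour. Every point
off the curve then has winding number `0` (exterior) or `1` (interior); this is how the positive
orientation is expressed. -/
structure IsPositiveContour (γ : ℝ → ℂ) : Prop where
  continuousOn : ContinuousOn γ (Set.Icc 0 1)
  closed : γ 0 = γ 1
  injOn : Set.InjOn γ (Set.Ico 0 1)
  piecewise_smooth : ∃ T : Finset ℝ, ∀ t ∈ Set.Ioo (0 : ℝ) 1, t ∉ T → ContDiffAt ℝ 1 γ t
  deriv_bounded : ∃ M : ℝ, ∀ t ∈ Set.Ioo (0 : ℝ) 1, ‖deriv γ t‖ ≤ M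
  positive : ∀ z, z ∉ contourImage γ → winding γ z = 0 ∨ winding γ z = 1

/-- The bounded region `R⁺` enclosed by the contour. -/
def interiorRegion (γ : ℝ → ℂ) : Set ℂ := {z | z ∉ contourImage γ ∧ winding γ z = 1}

/-- The unbounded region `R⁻` outside the contour. -/
def exteriorRegion (γ : ℝ → ℂ) : Set ℂ := {z | z ∉ contourImage γ ∧ winding γ z = 0}

/-! ### Jost solutions of the scattering problem along a staircase

Here `q i` is the lattice parameter of the step `i → i + 1` and `υ` the potential. The functions
`Λ`, `Υ` are the Jost solutions `φ`, `ψ` with their plane-wave factors removed; thus `Λ → 1` as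
`i → -∞`, `Υ → 1` as `i → +∞`, and for instance
`(q_{i+1} + ζ) Λ(i+2) - (q_i + q_{i+1} + υ_{i+1}) Λ(i+1) + (q_i - ζ) Λ(i) = 0`. -/

/-- The summation kernel `(1 / 2ζ) [1 - ∏_{r=l}^{i-1} (q_r - ζ) / (q_r + ζ)]`, `l ≤ i`, written so
that the removable singularity at `ζ = 0` is removed; see `kernel_eq`. -/
def kernel (q : ℤ → ℂ) (ζ : ℂ) (l i : ℤ) : ℂ :=
  ∑ r ∈ Finset.Ico l i, (∏ s ∈ Finset.Ico l r, (q s - ζ) / (q s + ζ)) / (q r + ζ)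

theorem kernel_eq (q : ℤ → ℂ) (ζ : ℂ) (h0 : ζ ≠ 0) (hq : ∀ r, q r + ζ ≠ 0) (l : ℤ) (k : ℕ) :
    kernel q ζ l (l + k) =
      1 / (2 * ζ) * (1 - ∏ r ∈ Finset.Ico l (l + k), (q r - ζ) / (q r + ζ)) := by
  unfold kernel
  induction k with
  | zero => simp
  | succ k ih =>
    have hI : Finset.Ico l (l + ((k + 1 : ℕ) : ℤ)) = insert (l + (k : ℤ)) (Finset.Ico l (l + k)) := by
      ext x
      simp only [Finset.mem_Ico, Finset.mem_insert]
      push_cast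
      omega
    have hn : (l + (k : ℤ)) ∉ Finset.Ico l (l + (k : ℤ)) := by simp
    rw [hI, Finset.sum_insert hn, Finset.prod_insert hn, ih]
    have := hq (l + k)
    field_simp
    ring

/-- Terms of the Neumann series of `Λ(i; ζ)`, that is of the summation equation
`Λ(i) = 1 + ∑_{l<i} F(i,l) υ_l Λ(l)`. -/
def neumannLeft (q υ : ℤ → ℂ) (ζ : ℂ) : ℕ → ℤ → ℂ
  | 0, _ => 1
  | k + 1, i => ∑' l : Set.Iio i, kernel q ζ l i * υ l * neumannLeft q υ ζ k l

/-- Terms of the Neumann series of `Υ(i; ζ)`, that is of the summation equation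
`Υ(i) = 1 + ∑_{l>i} G(i,l) υ_l Υ(l)`. -/
def neumannRight (q υ : ℤ → ℂ) (ζ : ℂ) : ℕ → ℤ → ℂ
  | 0, _ => 1
  | k + 1, i => ∑' l : Set.Ioi i, kernel q ζ i l * υ l * neumannRight q υ ζ k l

/-- The Jost function `Λ(i; ζ)` along the staircase, normalised at `i → -∞`. -/
def jostLam (q υ : ℤ → ℂ) (i : ℤ) (ζ : ℂ) : ℂ := ∑' k : ℕ, neumannLeft q υ ζ k i

/-- The Jost function `Υ(i; ζ)` along the staircase, normalised at `i → +∞`. -/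
def jostUps (q υ : ℤ → ℂ) (i : ℤ) (ζ : ℂ) : ℂ := ∑' k : ℕ, neumannRight q υ ζ k i

/-- The spectral function `A = W(ψ, φ) / 2ζ`, the Wronskian being evaluated at the base point. -/
def specA (q υ : ℤ → ℂ) (i₀ : ℤ) (ζ : ℂ) : ℂ :=
  ((q i₀ + ζ) * jostUps q υ i₀ ζ * jostLam q υ (i₀ + 1) ζ
    - (q i₀ - ζ) * jostUps q υ (i₀ + 1) ζ * jostLam q υ i₀ ζ) / (2 * ζ)

/-- The spectral function `B = W(φ°, ψ) / 2ζ`, where `φ°(ζ) = φ(-ζ)`, the Wronskian being evaluated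
at the base point. -/
def specB (q υ : ℤ → ℂ) (i₀ : ℤ) (ζ : ℂ) : ℂ :=
  (q i₀ - ζ) / (2 * ζ) *
    (jostLam q υ i₀ (-ζ) * jostUps q υ (i₀ + 1) ζ - jostLam q υ (i₀ + 1) (-ζ) * jostUps q υ i₀ ζ)

/-- The region `𝒫`, where `|(q_r - ζ) / (q_r + ζ)| > K` for some step `r`. -/
def regionP (q : ℤ → ℂ) (K : ℝ) : Set ℂ := {ζ | ∃ r, K * ‖q r + ζ‖ < ‖q r - ζ‖}

/-- The region `𝒫*`, where `|(q_r + ζ) / (q_r - ζ)| > K` for some step `r`. -/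
def regionPstar (q : ℤ → ℂ) (K : ℝ) : Set ℂ := {ζ | ∃ r, K * ‖q r - ζ‖ < ‖q r + ζ‖}

/-- The zeros of `A` outside `𝒫 ∪ ∂𝒫`. (At `ζ = 0` the function `A` has in general a pole.) -/
def zerosA (q υ : ℤ → ℂ) (i₀ : ℤ) (K : ℝ) : Set ℂ :=
  {ζ | ζ ≠ 0 ∧ ζ ∉ closure (regionP q K) ∧ specA q υ i₀ ζ = 0}

/-- Admissible potentials. -/
structure Admissible (q υ : ℤ → ℂ) (i₀ : ℤ) (K : ℝ) : Prop where
  summable : Summable fun i : ℤ => ‖υ i‖ * K ^ i.natAbs * (1 + |(i : ℝ)|)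
  finite_zeros : (zerosA q υ i₀ K).Finite
  simple_zeros : ∀ z ∈ zerosA q υ i₀ K, deriv (specA q υ i₀) z ≠ 0

/-! ### The lattice equation and its data -/

/-- The data: lattice parameters `(p_k, P_k)` for the `N` directions, constants `a, b, δ`, a
staircase `Γ` with the direction `step i` of its step `i → i + 1` and base point `i₀`, a potential
on the staircase in its dependence on the two parameters `a, b`, the weight `K`, and a contour. -/
structure Setup (N : ℕ) where
  p : Fin N → ℂ
  P : Fin N → ℂ
  a : ℂ
  b : ℂ
  δ : ℂ
  Γ : ℤ → (Fin N → ℤ)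
  step : ℤ → Fin N
  i₀ : ℤ
  pot : ℂ → ℂ → ℤ → ℂ
  K : ℝ
  γ : ℝ → ℂ

/-- The unit vector in lattice direction `k`. -/
def e {N : ℕ} (k : Fin N) : Fin N → ℤ := Pi.single k 1

namespace Setup

variable {N : ℕ} (D : Setup N)

/-- The parameter of the step `i → i + 1` of the staircase. -/
def q (i : ℤ) : ℂ := D.p (D.step i)

/-- The potential at the actual values of `a` and `b`. -/
def υ : ℤ → ℂ := D.pot D.a D.b

/-- The parameters `(p_k, P_k)` lie on the elliptic curve, and no denominator in the equation or in
the solution formula vanishes. -/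
structure ValidParameters : Prop where
  curve : ∀ k, D.P k ^ 2 = (D.p k ^ 2 - D.a ^ 2) * (D.p k ^ 2 - D.b ^ 2)
  p_ne_a : ∀ k, D.p k ^ 2 ≠ D.a ^ 2
  p_ne_b : ∀ k, D.p k ^ 2 ≠ D.b ^ 2
  a_ne_zero : D.a ≠ 0
  b_ne_zero : D.b ≠ 0
  a_ne_b : D.a ^ 2 ≠ D.b ^ 2

/-- `Γ` is a staircase that increases by one unit vector in every step and passes through the origin
at `i₀`, and its parameters do not vanish. -/
structure IsStaircase : Prop where
  base : D.Γ D.i₀ = 0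
  succ : ∀ i, D.Γ (i + 1) = D.Γ i + e (D.step i)
  param_ne_zero : ∀ i, D.q i ≠ 0

/-- The weight `K` exceeds all the moduli `|(p_r ± a)/(p_r ∓ a)|`, `|(p_r ± b)/(p_r ∓ b)|`, where `r`
runs through the directions in which the staircase exists. -/
structure ValidWeight : Prop where
  a_left : ∀ i, ‖(D.q i + D.a) / (D.q i - D.a)‖ < D.K
  a_right : ∀ i, ‖(D.q i - D.a) / (D.q i + D.a)‖ < D.K
  b_left : ∀ i, ‖(D.q i + D.b) / (D.q i - D.b)‖ < D.K
  b_right : ∀ i, ‖(D.q i - D.b) / (D.q i + D.b)‖ < D.K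

/-- The finite set of zeros `ζ_j` of `A`. -/
def zeros : Set ℂ := zerosA D.q D.υ D.i₀ D.K

/-- The contour of the inverse problem: it avoids `𝒫 ∪ ∂𝒫`, encloses `𝒫*` and all zeros of `A`, and
leaves `0, ±a, ±b` outside. The points `-ζ`, with `ζ` on or inside the contour, lie outside, so that
the kernel `1/(σ + ζ)` of the integral equation is never singular, and no plane-wave factor has a
zero or a pole on the contour or at a zero of `A`. -/
structure ValidContour : Prop where
  contour : IsPositiveContour D.γ
  avoids : ∀ z ∈ contourImage D.γ, z ∉ closure (regionP D.q D.K)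
  pstar_inside : regionPstar D.q D.K ⊆ interiorRegion D.γ
  zeros_inside : D.zeros ⊆ interiorRegion D.γ
  zero_outside : (0 : ℂ) ∈ exteriorRegion D.γ
  points_outside : ∀ z ∈ ({D.a, -D.a, D.b, -D.b} : Set ℂ), z ∈ exteriorRegion D.γ
  reflected_outside : ∀ z ∈ contourImage D.γ ∪ interiorRegion D.γ, -z ∈ exteriorRegion D.γ
  param_off : ∀ k, ∀ z ∈ contourImage D.γ ∪ D.zeros, z ≠ D.p k ∧ z ≠ -D.p k

/-! ### The `N`-dimensional Jost function -/

/-- The plane-wave factor `ρ(n; ζ) = ∏_r ((p_r + ζ)/(p_r - ζ))^{n_r}`. -/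
def ρ (n : Fin N → ℤ) (ζ : ℂ) : ℂ := ∏ r, ((D.p r + ζ) / (D.p r - ζ)) ^ n r

/-- The connection constant `c` at a zero of `A`: `ψ(i) = c φ(i)` for all `i`, that is
`Υ(i) = c Λ(i) ρ(Γ(i))`. -/
def conn (z : ℂ) : ℂ :=
  Classical.epsilon fun c : ℂ =>
    ∀ i, jostUps D.q D.υ i z = c * jostLam D.q D.υ i z * D.ρ (D.Γ i) z

open Classical in
/-- The constant `C_j` at the zero `z = ζ_j` of `A`. -/
def resC (z : ℂ) : ℂ :=
  (if z ∈ regionPstar D.q D.K then D.conn z else specB D.q D.υ D.i₀ z)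
    / deriv (specA D.q D.υ D.i₀) z

/-- The reflection coefficient. -/
def R (σ : ℂ) : ℂ := specB D.q D.υ D.i₀ σ / specA D.q D.υ D.i₀ σ

/-- The domain of the `N`-dimensional Jost function; it contains the contour, the zeros of `A`, and
the points `±a, ±b`. -/
def jostDomain : Set ℂ := {ζ | -ζ ∈ exteriorRegion D.γ}

/-- `f` solves the singular integral equation at the lattice point `n`. -/
def SolvesAt (n : Fin N → ℤ) (f : ℂ → ℂ) : Prop :=
  ContinuousOn f (contourImage D.γ) ∧
    ∀ ζ ∈ D.jostDomain,
      f ζ = 1 - ∑ᶠ z ∈ D.zeros, D.resC z * f z / (ζ + z) * D.ρ n z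
        + 1 / (2 * (Real.pi : ℂ) * Complex.I)
          * contourIntegral D.γ (fun σ => D.R σ * f σ / (σ + ζ) * D.ρ n σ)

/-- The singular integral equation at `n` has exactly one solution, so that the `N`-dimensional Jost
function exists at `n`. -/
def Regular (n : Fin N → ℤ) : Prop :=
  ∃ f, D.SolvesAt n f ∧ ∀ g, D.SolvesAt n g → Set.EqOn g f D.jostDomain

/-- The `N`-dimensional Jost function `Λ(n; ζ)`, the solution of the singular integral equation. -/
def Lam (n : Fin N → ℤ) : ℂ → ℂ := Classical.epsilon (D.SolvesAt n)

/-! ### The solution formula -/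

/-- `S(x,y)` at `n`, computed with a shift in direction `k`. -/
def shiftS (n : Fin N → ℤ) (k : Fin N) (x y : ℂ) : ℂ :=
  1 / (x - y) * ((D.p k + x) * D.Lam (n + e k) x * D.Lam n y
    - (D.p k + y) * D.Lam n x * D.Lam (n + e k) y)

/-- The exponential functions `F(x,y) = ∏_r ((p_r+x)(p_r+y) / ((p_r-x)(p_r-y)))^{n_r/2}` for
`x = ±a`, `y = ±b`, the branch of the square root being the one fixed by `P_r`, namely
`((p_r+x)(p_r+y) / ((p_r-x)(p_r-y)))^{1/2} = (p_r+x)(p_r+y) / P_r`. -/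
def F (x y : ℂ) (n : Fin N → ℤ) : ℂ := ∏ r, ((D.p r + x) * (D.p r + y) / D.P r) ^ n r

/-- The points at which `S` and `u` are defined. -/
def Defined (n : Fin N → ℤ) : Prop := D.Regular n ∧ ∃ k, D.Regular (n + e k)

/-- The combination `𝒜 F(a,b) S_𝒜 + ℬ F(a,-b) S_ℬ + 𝒞 F(-a,b) S_𝒞 + 𝒟 F(-a,-b) S_𝒟`. -/
def solution (S : ℂ → ℂ → (Fin N → ℤ) → ℂ) (cA cB cC cD : ℂ) (n : Fin N → ℤ) : ℂ :=
  cA * D.F D.a D.b n * S D.a D.b n + cB * D.F D.a (-D.b) n * S D.a (-D.b) n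
    + cC * D.F (-D.a) D.b n * S (-D.a) D.b n + cD * D.F (-D.a) (-D.b) n * S (-D.a) (-D.b) n

/-- The constraint on the four constants. -/
def Constraint (cA cB cC cD : ℂ) : Prop :=
  cA * cD * (D.a + D.b) ^ 2 - cB * cC * (D.a - D.b) ^ 2 = -(D.δ ^ 2 / (16 * D.a * D.b))

/-- The equation `Q3_δ` on an elementary quadrilateral in directions `k, l`, for the vertex values
`u`, `uk` (shift in direction `k`), `ul` (shift in direction `l`), `ukl` (both shifts). -/
def Q3 (k l : Fin N) (u uk ul ukl : ℂ) : Prop :=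
  D.P k * (u * ul + uk * ukl) - D.P l * (u * uk + ul * ukl)
    - (D.p k ^ 2 - D.p l ^ 2) * ((uk * ul + u * ukl) + D.δ ^ 2 / (4 * D.P k * D.P l)) = 0

/-- The biquadratic `H` of direction `k`. -/
def H (k : Fin N) (u v : ℂ) : ℂ :=
  D.P k * (u ^ 2 + v ^ 2) - (2 * D.p k ^ 2 - D.a ^ 2 - D.b ^ 2) * u * v + D.δ ^ 2 / (4 * D.P k)

/-- The numerator `P_{i+1} u(i+2) - (p_{i+1}² - p_i²) u(i+1) - P_i u(i)` in the definition of the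
potential, for a function `u` on the staircase. -/
def potNumerator (u : ℤ → ℂ) (i : ℤ) : ℂ :=
  D.P (D.step (i + 1)) * u (i + 2) - (D.q (i + 1) ^ 2 - D.q i ^ 2) * u (i + 1)
    - D.P (D.step i) * u i

end Setup

end Q3IST

end

/-!
The proof follows the inverse scattering transform, arranged so that the whole lattice equation is
read off from the values of the Jost functions at `±a, ±b`.

**Direct problem.** Off `𝒫` the summation kernel is dominated by a product kernel
`g i * a l` with summable `g l * a l`, so a discrete Grönwall estimate (`isMajorant_mul`) bounds the
Neumann series. This yields existence, continuity, holomorphy, the limits at `i → -∞` and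
`ζ → ∞`, and the three-term recurrence `jostLam_recurrence`; the right Jost function is obtained by
reversing the staircase. Constancy of Wronskians gives the scattering relation
`Υ = A Λ(-ζ) + B Λ(ζ) ρ` (`scattering_relation`).

**The staircase is regular.** Divide the scattering relation by `A` and integrate against the Cauchy
kernel. The term `Υ/A` is evaluated by residues inside the contour, the term `Λ(-σ)` by Cauchy's
formula outside. Both formulas are proved for winding numbers by Dixon's method
(`cauchy_interior`, `cauchy_exterior`). As the contour may touch the boundary of `𝒫*`, where `Λ(-σ)`
is continuous but need not be holomorphic, the second is applied to truncated potentials first.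
The result is that the Jost solution solves the singular integral equation
(`solvesAffine_jostLam`).

**Algebra of the integral equation.** Consider the equation with inhomogeneity `α ζ + β`. Because
the kernel `1/(s + σ)` is symmetric, two solutions satisfy the identity
`F(-w) G(w) - F(w) G(-w) = 2w (α' β - α β')` (`wronskian`). Multiplication by `p_k ± ζ` moves solutions
between neighbouring points (`shift_forward`, `shift_backward`). Hence solvability at `n` and
`n + e_k` implies uniqueness at `n` (`regular_of_solvable`), which makes every point of the staircase
regular, and uniqueness at a regular point turns combinations of shifted solutions without
linear term into multiples of `Λ(n)`. This produces relations with coefficients independent of `ζ`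
between the Jost functions at three points (`exists_shift_sub_shift`, `exists_three_point`), and on a
quadrilateral the coefficients are linked by `s t = p_k² - p_l²` (`exists_quadrilateral`).

**The solution.** With `α = Λ(n)` and `m = (p_k + ζ) Λ(n + e_k)`, the solution is
`u = form m α - form α m` for a bilinear form on functions on `{±a} × {±b}`, and
`U = (a² - b²) form α α`. The relations for `Λ` become linear relations between the values of `u` and
`U` (`solution_three_point`, `solution_shift_sub_shift`), the Cauchy-Binet formula and the constraint
give `U(n) U(n + e_k) = H_k(u(n), u(n + e_k))` (`factorU_mul_factorU`), and `Q3` is a polynomial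
consequence of these (`solution_Q3`). Conversely, `α` and `m` form a basis on each of `{±a}`, `{±b}`
by the Wronskian identity, so the form, and with it the four constants, can be fitted to arbitrary
initial data at the base point; the recurrence and the factorization of the
biquadratic then propagate the equality along the staircase
(`exists_solution_eq`).
-/

open Filter Topology

noncomputable section

namespace Q3IST

/-! ### Majorants for Neumann series -/

/-- Neumann series with nonnegative kernel `κ`; it dominates every Neumann series whose kernel is
bounded by `κ`. -/
def majorant (κ : ℤ → ℤ → ℝ) : ℕ → ℤ → ℝ
  | 0, _ => 1
  | k + 1, i => ∑' l : Set.Iio i, κ i l * majorant κ k l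

/-- `M` is a supersolution of the summation equation with nonnegative kernel `κ`, so that it bounds
the sum of the Neumann series. -/
structure IsMajorant (κ : ℤ → ℤ → ℝ) (M : ℤ → ℝ) : Prop where
  kernel_nonneg : ∀ i l, 0 ≤ κ i l
  nonneg : ∀ i, 0 ≤ M i
  summable : ∀ i, Summable fun l : Set.Iio i => κ i l * M l
  le : ∀ i, 1 + ∑' l : Set.Iio i, κ i l * M l ≤ M i

namespace IsMajorant

variable {κ : ℤ → ℤ → ℝ} {M : ℤ → ℝ}

theorem majorant_nonneg (h : IsMajorant κ M) (k : ℕ) (i : ℤ) : 0 ≤ majorant κ k i := by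
  induction k generalizing i with
  | zero => simp [majorant]
  | succ k ih => exact tsum_nonneg fun l => mul_nonneg (h.kernel_nonneg _ _) (ih _)

theorem sum_le (h : IsMajorant κ M) (n : ℕ) (i : ℤ) :
    ∑ k ∈ Finset.range n, majorant κ k i ≤ M i := by
  induction n generalizing i with
  | zero => simpa using h.nonneg i
  | succ n ih =>
    have hle : ∀ k < n, ∀ l, majorant κ k l ≤ M l := fun k hk l =>
      (Finset.single_le_sum (f := fun k => majorant κ k l) (fun j _ => h.majorant_nonneg j l)
        (Finset.mem_range.2 hk)).trans (ih l)
    have hs : ∀ k < n, Summable fun l : Set.Iio i => κ i l * majorant κ k l := fun k hk =>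
      (h.summable i).of_nonneg_of_le
        (fun l => mul_nonneg (h.kernel_nonneg _ _) (h.majorant_nonneg _ _))
        (fun l => mul_le_mul_of_nonneg_left (hle k hk l) (h.kernel_nonneg _ _))
    rw [Finset.sum_range_succ']
    have e1 : ∑ k ∈ Finset.range n, majorant κ (k + 1) i
        = ∑' l : Set.Iio i, κ i l * ∑ k ∈ Finset.range n, majorant κ k l := by
      simp only [majorant, Finset.mul_sum]
      rw [Summable.tsum_finsetSum]
      intro k hk
      exact hs k (Finset.mem_range.1 hk)
    have hs2 : Summable fun l : Set.Iio i => κ i l * ∑ k ∈ Finset.range n, majorant κ k l := by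
      simp only [Finset.mul_sum]
      exact summable_sum fun k hk => hs k (Finset.mem_range.1 hk)
    have := Summable.tsum_le_tsum
      (fun l : Set.Iio i => mul_le_mul_of_nonneg_left (ih l) (h.kernel_nonneg i l)) hs2
      (h.summable i)
    have h3 := h.le i
    rw [e1]
    simp only [majorant]
    linarith

theorem majorant_le (h : IsMajorant κ M) (k : ℕ) (i : ℤ) : majorant κ k i ≤ M i :=
  (Finset.single_le_sum (f := fun k => majorant κ k i) (fun j _ => h.majorant_nonneg j i)
    (Finset.mem_range.2 (Nat.lt_succ_self k))).trans (h.sum_le (k + 1) i)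

theorem summable_step (h : IsMajorant κ M) (k : ℕ) (i : ℤ) :
    Summable fun l : Set.Iio i => κ i l * majorant κ k l :=
  (h.summable i).of_nonneg_of_le
    (fun _ => mul_nonneg (h.kernel_nonneg _ _) (h.majorant_nonneg _ _))
    (fun l => mul_le_mul_of_nonneg_left (h.majorant_le k l) (h.kernel_nonneg _ _))

theorem summable_majorant (h : IsMajorant κ M) (i : ℤ) : Summable fun k => majorant κ k i :=
  summable_of_sum_range_le (fun k => h.majorant_nonneg k i) (fun n => h.sum_le n i)

theorem tsum_le (h : IsMajorant κ M) (i : ℤ) : ∑' k, majorant κ k i ≤ M i :=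
  (h.summable_majorant i).tsum_le_of_sum_range_le (fun n => h.sum_le n i)

/-! ### The Neumann series of the left Jost function -/

variable {q υ : ℤ → ℂ} {ζ : ℂ}

theorem norm_neumannLeft_le (h : IsMajorant κ M)
    (hb : ∀ i l, l < i → ‖kernel q ζ l i * υ l‖ ≤ κ i l) (k : ℕ) (i : ℤ) :
    ‖neumannLeft q υ ζ k i‖ ≤ majorant κ k i := by
  induction k generalizing i with
  | zero => simp [neumannLeft, majorant]
  | succ k ih =>
    refine tsum_of_norm_bounded (h.summable_step k i).hasSum fun l => ?_
    rw [norm_mul]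
    exact mul_le_mul (hb i l l.2) (ih l) (norm_nonneg _) (h.kernel_nonneg _ _)

theorem summable_neumannLeft (h : IsMajorant κ M)
    (hb : ∀ i l, l < i → ‖kernel q ζ l i * υ l‖ ≤ κ i l) (i : ℤ) :
    Summable fun k => neumannLeft q υ ζ k i :=
  (h.summable_majorant i).of_norm_bounded fun k => h.norm_neumannLeft_le hb k i

theorem norm_jostLam_le (h : IsMajorant κ M)
    (hb : ∀ i l, l < i → ‖kernel q ζ l i * υ l‖ ≤ κ i l) (i : ℤ) : ‖jostLam q υ i ζ‖ ≤ M i :=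
  (tsum_of_norm_bounded (h.summable_majorant i).hasSum
    fun k => h.norm_neumannLeft_le hb k i).trans (h.tsum_le i)

theorem summable_kernel_mul (h : IsMajorant κ M)
    (hb : ∀ i l, l < i → ‖kernel q ζ l i * υ l‖ ≤ κ i l) (i : ℤ) :
    Summable fun l : Set.Iio i => kernel q ζ l i * υ l * jostLam q υ l ζ := by
  refine (h.summable i).of_norm_bounded fun l => ?_
  rw [norm_mul]
  exact mul_le_mul (hb i l l.2) (h.norm_jostLam_le hb l) (norm_nonneg _) (h.kernel_nonneg _ _)

theorem jostLam_eq (h : IsMajorant κ M)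
    (hb : ∀ i l, l < i → ‖kernel q ζ l i * υ l‖ ≤ κ i l) (i : ℤ) :
    jostLam q υ i ζ = 1 + ∑' l : Set.Iio i, kernel q ζ l i * υ l * jostLam q υ l ζ := by
  have hs : Summable (Function.uncurry fun (l : Set.Iio i) (k : ℕ) =>
      kernel q ζ l i * υ l * neumannLeft q υ ζ k l) := by
    have hn : Summable fun x : Set.Iio i × ℕ => κ i x.1 * majorant κ x.2 x.1 := by
      have hnn : ∀ x : Set.Iio i × ℕ, 0 ≤ κ i x.1 * majorant κ x.2 x.1 := fun x =>
        mul_nonneg (h.kernel_nonneg i x.1) (h.majorant_nonneg x.2 x.1)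
      rw [summable_prod_of_nonneg hnn]
      refine ⟨fun l => (h.summable_majorant (l : ℤ)).mul_left (κ i (l : ℤ)), ?_⟩
      refine (h.summable i).of_nonneg_of_le
        (fun l => tsum_nonneg fun k => hnn (l, k)) (fun l => ?_)
      change ∑' k, κ i l * majorant κ k l ≤ _
      rw [tsum_mul_left]
      exact mul_le_mul_of_nonneg_left (h.tsum_le l) (h.kernel_nonneg _ _)
    have hle : ∀ x : Set.Iio i × ℕ, ‖kernel q ζ x.1 i * υ x.1 * neumannLeft q υ ζ x.2 x.1‖
        ≤ κ i x.1 * majorant κ x.2 x.1 := fun x => by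
      rw [norm_mul]
      exact mul_le_mul (hb i x.1 x.1.2) (h.norm_neumannLeft_le hb x.2 x.1) (norm_nonneg _)
        (h.kernel_nonneg _ _)
    exact hn.of_norm_bounded hle
  have e := (h.summable_neumannLeft hb i).tsum_eq_zero_add
  unfold jostLam
  rw [e]
  simp only [neumannLeft, ← tsum_mul_left]
  congr 1
  exact (hs.tsum_comm)

theorem norm_jostLam_sub_one_le (h : IsMajorant κ M)
    (hb : ∀ i l, l < i → ‖kernel q ζ l i * υ l‖ ≤ κ i l) (i : ℤ) :
    ‖jostLam q υ i ζ - 1‖ ≤ M i - 1 := by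
  rw [h.jostLam_eq hb i, add_sub_cancel_left]
  refine (tsum_of_norm_bounded (h.summable i).hasSum fun l => ?_).trans
    (by linarith [h.le i])
  rw [norm_mul]
  exact mul_le_mul (hb i l l.2) (h.norm_jostLam_le hb l) (norm_nonneg _) (h.kernel_nonneg _ _)

theorem continuousOn_jostLam (h : IsMajorant κ M) {s : Set ℂ}
    (hb : ∀ ζ ∈ s, ∀ i l, l < i → ‖kernel q ζ l i * υ l‖ ≤ κ i l)
    (hc : ∀ l i, ContinuousOn (fun ζ => kernel q ζ l i) s) (i : ℤ) :
    ContinuousOn (jostLam q υ i) s := by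
  have hN : ∀ k i, ContinuousOn (fun ζ => neumannLeft q υ ζ k i) s := by
    intro k
    induction k with
    | zero => intro i; simpa [neumannLeft] using continuousOn_const
    | succ k ih =>
      intro i
      refine continuousOn_tsum (u := fun l : Set.Iio i => κ i l * majorant κ k l)
        (fun l => ((hc l i).mul continuousOn_const).mul (ih l)) (h.summable_step k i)
        fun l ζ hζ => ?_
      rw [norm_mul]
      exact mul_le_mul (hb ζ hζ i l l.2) (h.norm_neumannLeft_le (hb ζ hζ) k l) (norm_nonneg _)
        (h.kernel_nonneg _ _)
  exact continuousOn_tsum (fun k => hN k i) (h.summable_majorant i)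
    fun k ζ hζ => h.norm_neumannLeft_le (hb ζ hζ) k i

theorem differentiableOn_jostLam (h : IsMajorant κ M) {s : Set ℂ} (hs : IsOpen s)
    (hb : ∀ ζ ∈ s, ∀ i l, l < i → ‖kernel q ζ l i * υ l‖ ≤ κ i l)
    (hc : ∀ l i, DifferentiableOn ℂ (fun ζ => kernel q ζ l i) s) (i : ℤ) :
    DifferentiableOn ℂ (jostLam q υ i) s := by
  have hN : ∀ k i, DifferentiableOn ℂ (fun ζ => neumannLeft q υ ζ k i) s := by
    intro k
    induction k with
    | zero => intro i; simp [neumannLeft]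
    | succ k ih =>
      intro i
      refine Complex.differentiableOn_tsum_of_summable_norm (h.summable_step k i)
        (fun l => ((hc l i).mul (differentiableOn_const _)).mul (ih l)) hs
        fun l ζ hζ => ?_
      rw [norm_mul]
      exact mul_le_mul (hb ζ hζ i l l.2) (h.norm_neumannLeft_le (hb ζ hζ) k l) (norm_nonneg _)
        (h.kernel_nonneg _ _)
  exact Complex.differentiableOn_tsum_of_summable_norm (h.summable_majorant i) (fun k => hN k i) hs
    fun k ζ hζ => h.norm_neumannLeft_le (hb ζ hζ) k i

/-- Continuity of the Jost function in the potential, under a common majorant. -/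
theorem tendsto_jostLam (h : IsMajorant κ M) {υs : ℕ → ℤ → ℂ}
    (hb : ∀ m i l, l < i → ‖kernel q ζ l i * υs m l‖ ≤ κ i l)
    (hlim : ∀ l, Tendsto (fun m => υs m l) atTop (𝓝 (υ l))) (i : ℤ) :
    Tendsto (fun m => jostLam q (υs m) i ζ) atTop (𝓝 (jostLam q υ i ζ)) := by
  have hN : ∀ k i, Tendsto (fun m => neumannLeft q (υs m) ζ k i) atTop
      (𝓝 (neumannLeft q υ ζ k i)) := by
    intro k
    induction k with
    | zero => intro i; simp [neumannLeft]
    | succ k ih =>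
      intro i
      refine tendsto_tsum_of_dominated_convergence (h.summable_step k i)
        (fun l => ((hlim l).const_mul _).mul (ih l)) (Eventually.of_forall fun m l => ?_)
      rw [norm_mul]
      exact mul_le_mul (hb m i l l.2) (h.norm_neumannLeft_le (hb m) k l) (norm_nonneg _)
        (h.kernel_nonneg _ _)
  exact tendsto_tsum_of_dominated_convergence (h.summable_majorant i) (fun k => hN k i)
    (Eventually.of_forall fun m k => h.norm_neumannLeft_le (hb m) k i)

end IsMajorant

/-! ### Sums over half-lines -/

theorem tsum_Iio_succ {E : Type*} [NormedAddCommGroup E] {f : ℤ → E} {i : ℤ}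
    (hf : Summable fun l : Set.Iio i => f l) :
    ∑' l : Set.Iio (i + 1), f l = f i + ∑' l : Set.Iio i, f l := by
  have hd : Disjoint ({i} : Set ℤ) (Set.Iio i) := by simp
  have hu : Set.Iio (i + 1) = {i} ∪ Set.Iio i := by
    ext x; simp only [Set.mem_Iio, Set.mem_union, Set.mem_singleton_iff]; omega
  rw [hu]
  have h1 : HasSum (f ∘ ((↑) : ({i} : Set ℤ) → ℤ)) (f i) := by
    have := hasSum_fintype (f ∘ ((↑) : ({i} : Set ℤ) → ℤ))
    simpa using this
  exact (h1.add_disjoint hd hf.hasSum).tsum_eq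

theorem summable_Iio_succ {E : Type*} [NormedAddCommGroup E] {f : ℤ → E} {i : ℤ}
    (hf : Summable fun l : Set.Iio i => f l) : Summable fun l : Set.Iio (i + 1) => f l := by
  have hd : Disjoint ({i} : Set ℤ) (Set.Iio i) := by simp
  have hu : Set.Iio (i + 1) = {i} ∪ Set.Iio i := by
    ext x; simp only [Set.mem_Iio, Set.mem_union, Set.mem_singleton_iff]; omega
  rw [hu]
  have h1 : HasSum (f ∘ ((↑) : ({i} : Set ℤ) → ℤ)) (f i) := by
    have := hasSum_fintype (f ∘ ((↑) : ({i} : Set ℤ) → ℤ))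
    simpa using this
  exact (h1.add_disjoint hd hf.hasSum).summable

/-- Discrete Grönwall inequality for the exponential of the partial sums. -/
theorem tsum_mul_exp_le {w : ℤ → ℝ} (hw : ∀ l, 0 ≤ w l) (hs : Summable w) (i : ℤ) :
    (Summable fun l : Set.Iio i => w l * Real.exp (∑' j : Set.Iio (l : ℤ), w j)) ∧
    1 + ∑' l : Set.Iio i, w l * Real.exp (∑' j : Set.Iio (l : ℤ), w j)
      ≤ Real.exp (∑' j : Set.Iio i, w j) := by
  set W : ℤ → ℝ := fun i => ∑' j : Set.Iio i, w j with hW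
  have hW0 : ∀ i, 0 ≤ W i := fun i => tsum_nonneg fun l => hw _
  have hstep : ∀ l, W (l + 1) = w l + W l := fun l => tsum_Iio_succ (hs.subtype _)
  have htel : ∀ n : ℕ, ∑ l ∈ Finset.Ico (i - n) i, w l * Real.exp (W l)
      ≤ Real.exp (W i) - Real.exp (W (i - n)) := by
    intro n
    induction n with
    | zero => simp
    | succ n ih =>
      have hI : Finset.Ico (i - ((n + 1 : ℕ) : ℤ)) i
          = insert (i - ((n + 1 : ℕ) : ℤ)) (Finset.Ico (i - n) i) := by
        ext x; simp only [Finset.mem_Ico, Finset.mem_insert]; push_cast; omega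
      rw [hI, Finset.sum_insert (by simp only [Finset.mem_Ico]; push_cast; omega)]
      have h1 := hstep (i - ((n + 1 : ℕ) : ℤ))
      have h2 : i - ((n + 1 : ℕ) : ℤ) + 1 = i - n := by push_cast; ring
      rw [h2] at h1
      rw [h1, Real.exp_add] at ih
      have h3 := Real.add_one_le_exp (w (i - ((n + 1 : ℕ) : ℤ)))
      have h4 := mul_le_mul_of_nonneg_right h3 (Real.exp_pos (W (i - ((n + 1 : ℕ) : ℤ)))).le
      nlinarith
  have hfin : ∀ s : Finset (Set.Iio i), ∑ l ∈ s, w l * Real.exp (W l) ≤ Real.exp (W i) - 1 := by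
    intro s
    obtain ⟨n, hn⟩ : ∃ n : ℕ, ∀ l ∈ s, i - n ≤ (l : ℤ) := by
      refine ⟨∑ l ∈ s, (i - l).natAbs, fun l hl => ?_⟩
      have := Finset.single_le_sum (f := fun l : Set.Iio i => (i - l).natAbs)
        (fun _ _ => Nat.zero_le _) hl
      omega
    have h1 : ∑ l ∈ s, w l * Real.exp (W l)
        = ∑ l ∈ s.map (Function.Embedding.subtype _), w l * Real.exp (W l) := by simp
    have h2 : s.map (Function.Embedding.subtype _) ⊆ Finset.Ico (i - n) i := by
      intro x hx
      obtain ⟨l, hl, rfl⟩ := Finset.mem_map.1 hx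
      exact Finset.mem_Ico.2 ⟨hn l hl, l.2⟩
    rw [h1]
    refine (Finset.sum_le_sum_of_subset_of_nonneg h2
      fun l _ _ => mul_nonneg (hw _) (Real.exp_pos _).le).trans ((htel n).trans ?_)
    have := Real.one_le_exp (hW0 (i - n))
    linarith
  have hsum : Summable fun l : Set.Iio i => w l * Real.exp (W l) :=
    summable_of_sum_le (fun l => mul_nonneg (hw _) (Real.exp_pos _).le) hfin
  refine ⟨hsum, ?_⟩
  have := hsum.tsum_le_of_sum_le hfin
  linarith

/-- A kernel of product form `g i * a l` has the majorant
`1 + g i * (∑ a) * exp (∑_{l<i} g l * a l)`. -/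
theorem isMajorant_mul {g a : ℤ → ℝ} (hg : ∀ i, 0 ≤ g i) (ha : ∀ i, 0 ≤ a i) (hsa : Summable a)
    (hsw : Summable fun l => g l * a l) :
    IsMajorant (fun i l => g i * a l)
      (fun i => 1 + g i * ((∑' l, a l) * Real.exp (∑' j : Set.Iio i, g j * a j))) := by
  have hH : 0 ≤ ∑' l, a l := tsum_nonneg ha
  have hw : ∀ l, 0 ≤ g l * a l := fun l => mul_nonneg (hg l) (ha l)
  have key : ∀ i, (Summable fun l : Set.Iio i => g i * a l *
        (1 + g l * ((∑' l, a l) * Real.exp (∑' j : Set.Iio (l : ℤ), g j * a j)))) ∧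
      ∑' l : Set.Iio i, g i * a l *
        (1 + g l * ((∑' l, a l) * Real.exp (∑' j : Set.Iio (l : ℤ), g j * a j)))
      ≤ g i * ((∑' l, a l) * Real.exp (∑' j : Set.Iio i, g j * a j)) := by
    intro i
    obtain ⟨hs, hle⟩ := tsum_mul_exp_le hw hsw i
    have e : ∀ l : Set.Iio i, g i * a l *
        (1 + g l * ((∑' l, a l) * Real.exp (∑' j : Set.Iio (l : ℤ), g j * a j)))
        = g i * (a l + (∑' l, a l) * (g l * a l * Real.exp (∑' j : Set.Iio (l : ℤ), g j * a j))) :=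
      fun l => by ring
    have hs1 : Summable fun l : Set.Iio i => a l := hsa.subtype _
    simp only [e]
    refine ⟨(hs1.add (hs.mul_left _)).mul_left _, ?_⟩
    rw [tsum_mul_left, Summable.tsum_add hs1 (hs.mul_left _), tsum_mul_left]
    refine mul_le_mul_of_nonneg_left ?_ (hg i)
    have h1 : ∑' l : Set.Iio i, a l ≤ ∑' l, a l := hsa.tsum_subtype_le a (Set.Iio i) ha
    nlinarith
  refine ⟨fun i l => mul_nonneg (hg i) (ha l), fun i => ?_, fun i => (key i).1, fun i => ?_⟩
  · have := mul_nonneg (hg i) (mul_nonneg hH (Real.exp_pos (∑' j : Set.Iio i, g j * a j)).le)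
    linarith
  · have := (key i).2
    linarith

/-! ### Bounds for the summation kernel -/

section Kernel

variable {q : ℤ → ℂ} {ζ : ℂ}

theorem kernel_succ {l i : ℤ} (h : l ≤ i) :
    kernel q ζ l (i + 1)
      = kernel q ζ l i + (∏ s ∈ Finset.Ico l i, (q s - ζ) / (q s + ζ)) / (q i + ζ) := by
  have hI : Finset.Ico l (i + 1) = insert i (Finset.Ico l i) := by
    ext x; simp only [Finset.mem_Ico, Finset.mem_insert]; omega
  unfold kernel
  rw [hI, Finset.sum_insert (by simp), add_comm]

theorem prod_Ico_succ {f : ℤ → ℂ} {l i : ℤ} (h : l ≤ i) :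
    ∏ s ∈ Finset.Ico l (i + 1), f s = (∏ s ∈ Finset.Ico l i, f s) * f i := by
  have hI : Finset.Ico l (i + 1) = insert i (Finset.Ico l i) := by
    ext x; simp only [Finset.mem_Ico, Finset.mem_insert]; omega
  rw [hI, Finset.prod_insert (by simp), mul_comm]

theorem norm_kernel_le {C K : ℝ} (hK : 1 ≤ K) (hx : ∀ s, ‖(q s - ζ) / (q s + ζ)‖ ≤ K)
    (hC : ∀ s, ‖(q s + ζ)⁻¹‖ ≤ C) {l i : ℤ} (h : l ≤ i) :
    ‖kernel q ζ l i‖ ≤ C * (1 + |(i : ℝ)|) * K ^ i * ((1 + |(l : ℝ)|) * K ^ (-l)) := by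
  have hK0 : 0 < K := by linarith
  have hC0 : 0 ≤ C := (norm_nonneg _).trans (hC 0)
  have hpow : ∀ r : ℤ, l ≤ r → r ≤ i →
      ‖∏ s ∈ Finset.Ico l r, (q s - ζ) / (q s + ζ)‖ ≤ K ^ (i - l) := by
    intro r h1 h2
    rw [norm_prod]
    calc ∏ s ∈ Finset.Ico l r, ‖(q s - ζ) / (q s + ζ)‖ ≤ ∏ s ∈ Finset.Ico l r, K :=
          Finset.prod_le_prod (fun _ _ => norm_nonneg _) fun s _ => hx s
      _ = K ^ (r - l) := by
          rw [Finset.prod_const, Int.card_Ico, ← zpow_natCast, Int.toNat_of_nonneg (by omega)]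
      _ ≤ K ^ (i - l) := zpow_le_zpow_right₀ hK (by omega)
  have h1 : ‖kernel q ζ l i‖ ≤ ∑ r ∈ Finset.Ico l i, K ^ (i - l) * C := by
    unfold kernel
    refine norm_sum_le_of_le _ fun r hr => ?_
    rw [Finset.mem_Ico] at hr
    rw [div_eq_mul_inv, norm_mul]
    exact mul_le_mul (hpow r hr.1 hr.2.le) (hC r) (norm_nonneg _) (by positivity)
  refine h1.trans ?_
  rw [Finset.sum_const, Int.card_Ico, nsmul_eq_mul]
  have hcast : (((i - l).toNat : ℕ) : ℝ) = (i : ℝ) - l := by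
    have : (((i - l).toNat : ℤ) : ℝ) = ((i - l : ℤ) : ℝ) := by
      rw [Int.toNat_of_nonneg (by omega)]
    push_cast at this
    exact_mod_cast this
  have hle : (i : ℝ) - l ≤ (1 + |(i : ℝ)|) * (1 + |(l : ℝ)|) := by
    have a1 := le_abs_self (i : ℝ)
    have a2 := neg_abs_le (l : ℝ)
    have a3 := mul_nonneg (abs_nonneg (i : ℝ)) (abs_nonneg (l : ℝ))
    nlinarith
  rw [hcast, sub_eq_add_neg i l, zpow_add₀ hK0.ne']
  have hz : 0 ≤ K ^ i * K ^ (-l) * C := by positivity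
  calc ((i : ℝ) - l) * (K ^ i * K ^ (-l) * C)
      ≤ ((1 + |(i : ℝ)|) * (1 + |(l : ℝ)|)) * (K ^ i * K ^ (-l) * C) :=
        mul_le_mul_of_nonneg_right hle hz
    _ = _ := by ring

theorem differentiableAt_kernel (h : ∀ r, q r + ζ ≠ 0) (l i : ℤ) :
    DifferentiableAt ℂ (fun ζ => kernel q ζ l i) ζ := by
  unfold kernel
  refine DifferentiableAt.fun_sum fun r _ => ?_
  refine DifferentiableAt.fun_div ?_ (by fun_prop) (h r)
  refine DifferentiableAt.fun_finsetProd fun s _ => ?_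
  exact DifferentiableAt.fun_div (by fun_prop) (by fun_prop) (h s)

/-- The kernel is symmetric under reversal of the staircase. -/
theorem kernel_reflect (h0 : ζ ≠ 0) (h : ∀ r, q r + ζ ≠ 0) {i l : ℤ} (hil : i ≤ l) :
    kernel (fun s => q (-1 - s)) ζ (-l) (-i) = kernel q ζ i l := by
  obtain ⟨k, rfl⟩ : ∃ k : ℕ, l = i + k := ⟨(l - i).toNat, by omega⟩
  have h1 := kernel_eq q ζ h0 h i k
  have h2 := kernel_eq (fun s => q (-1 - s)) ζ h0 (fun r => h _) (-(i + k)) k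
  have e : -(i + (k : ℤ)) + k = -i := by ring
  rw [e] at h2
  rw [h1, h2]
  congr 2
  refine Finset.prod_nbij' (fun s => -1 - s) (fun s => -1 - s) ?_ ?_ ?_ ?_ ?_
  · intro s hs; simp only [Finset.mem_Ico] at hs ⊢; omega
  · intro s hs; simp only [Finset.mem_Ico] at hs ⊢; omega
  · intro s _; ring
  · intro s _; ring
  · intro s _; rfl

end Kernel

/-! ### The excluded regions -/

section Regions

variable {q : ℤ → ℂ} {K : ℝ} {ζ : ℂ}

theorem notMem_regionP : ζ ∉ regionP q K ↔ ∀ r, ‖q r - ζ‖ ≤ K * ‖q r + ζ‖ := by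
  simp [regionP]

theorem neg_mem_regionP : -ζ ∈ regionP q K ↔ ζ ∈ regionPstar q K := by
  simp [regionP, regionPstar, sub_eq_add_neg]

theorem add_ne_zero_of_notMem_regionP (hq : ∀ i, q i ≠ 0) (h : ζ ∉ regionP q K) (r : ℤ) :
    q r + ζ ≠ 0 := by
  intro h0
  have h1 := notMem_regionP.1 h r
  have h2 : q r - ζ = 2 * q r := by linear_combination -h0
  rw [h0, h2, norm_zero, mul_zero] at h1
  have := norm_pos_iff.2 (mul_ne_zero two_ne_zero (hq r))
  linarith

theorem norm_div_le_of_notMem_regionP (hq : ∀ i, q i ≠ 0) (h : ζ ∉ regionP q K) (r : ℤ) :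
    ‖(q r - ζ) / (q r + ζ)‖ ≤ K := by
  have h0 := norm_pos_iff.2 (add_ne_zero_of_notMem_regionP hq h r)
  rw [norm_div, div_le_iff₀ h0]
  exact notMem_regionP.1 h r

/-- Off `𝒫` the denominators `q_r + ζ` are uniformly bounded below. -/
theorem exists_norm_inv_le (hfin : (Set.range q).Finite) (hq : ∀ i, q i ≠ 0) :
    ∃ C : ℝ, ∀ ζ ∉ regionP q K, ∀ r, ‖(q r + ζ)⁻¹‖ ≤ C := by
  obtain ⟨c, hc⟩ := (hfin.image fun z => (1 + K) * ‖z‖⁻¹).bddAbove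
  refine ⟨c, fun ζ h r => le_trans ?_ (hc ⟨q r, ⟨r, rfl⟩, rfl⟩)⟩
  have h0 := norm_pos_iff.2 (add_ne_zero_of_notMem_regionP hq h r)
  have h1 := norm_pos_iff.2 (hq r)
  have h2 := notMem_regionP.1 h r
  have h3 : 2 * ‖q r‖ ≤ ‖q r + ζ‖ + ‖q r - ζ‖ := by
    have e : (2 : ℂ) * q r = (q r + ζ) + (q r - ζ) := by ring
    have := norm_add_le (q r + ζ) (q r - ζ)
    rw [← e, norm_mul] at this
    simpa using this
  change _ ≤ (1 + K) * ‖q r‖⁻¹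
  rw [norm_inv, ← div_eq_mul_inv, inv_eq_one_div, div_le_div_iff₀ h0 h1]
  nlinarith

theorem notMem_closure_regionP (hfin : (Set.range q).Finite)
    (h : ∀ r, ‖q r - ζ‖ < K * ‖q r + ζ‖) : ζ ∉ closure (regionP q K) := by
  have hcl : IsClosed (⋃ z ∈ Set.range q, {ζ : ℂ | K * ‖z + ζ‖ ≤ ‖z - ζ‖}) := by
    refine hfin.isClosed_biUnion fun z _ => ?_
    exact isClosed_le (by fun_prop) (by fun_prop)
  have hsub : regionP q K ⊆ ⋃ z ∈ Set.range q, {ζ : ℂ | K * ‖z + ζ‖ ≤ ‖z - ζ‖} := by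
    rintro ζ ⟨r, hr⟩
    simp only [Set.mem_iUnion]
    exact ⟨q r, ⟨r, rfl⟩, hr.le⟩
  intro hmem
  have := closure_minimal hsub hcl hmem
  simp only [Set.mem_iUnion] at this
  obtain ⟨z, ⟨r, rfl⟩, hr⟩ := this
  exact absurd (h r) (not_lt.2 hr)

/-- A point that is no pole of the plane-wave factors lies off `𝒫` for a sufficiently large
weight. -/
theorem exists_notMem_closure_regionP (hfin : (Set.range q).Finite) (h : ∀ r, q r + ζ ≠ 0) :
    ∃ K : ℝ, 1 < K ∧ ζ ∉ closure (regionP q K) := by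
  obtain ⟨c, hc⟩ := (hfin.image fun z => ‖z - ζ‖ / ‖z + ζ‖).bddAbove
  refine ⟨max c 1 + 1, by linarith [le_max_right c 1], notMem_closure_regionP hfin fun r => ?_⟩
  have h1 : ‖q r - ζ‖ / ‖q r + ζ‖ ≤ c := hc ⟨q r, ⟨r, rfl⟩, rfl⟩
  rw [← div_lt_iff₀ (norm_pos_iff.2 (h r))]
  linarith [le_max_left c 1]

end Regions

/-! ### Jost functions along a staircase -/

/-- The weighted summability of the potential. -/
def WeightedSummable (K : ℝ) (υ : ℤ → ℂ) : Prop :=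
  Summable fun i : ℤ => ‖υ i‖ * K ^ i.natAbs * (1 + |(i : ℝ)|)

section Jost

variable {q υ : ℤ → ℂ} {K : ℝ}

theorem zpow_le_pow_natAbs (hK : 1 ≤ K) (l : ℤ) : K ^ l ≤ K ^ l.natAbs := by
  rw [← zpow_natCast]
  exact zpow_le_zpow_right₀ hK (by omega)

theorem summable_left_weight (hK : 1 < K) (hs : WeightedSummable K υ) :
    Summable fun l : ℤ => (1 + |(l : ℝ)|) * K ^ (-l) * ‖υ l‖ := by
  have hK0 : 0 < K := by linarith
  refine Summable.of_nonneg_of_le (fun l => by positivity) (fun l => ?_) hs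
  have h1 := zpow_le_pow_natAbs hK.le (-l)
  rw [Int.natAbs_neg] at h1
  have h2 : 0 ≤ (1 + |(l : ℝ)|) * ‖υ l‖ := by positivity
  nlinarith [mul_le_mul_of_nonneg_left h1 h2]

theorem summable_middle_weight (hK : 1 < K) (hs : WeightedSummable K υ) :
    Summable fun l : ℤ => (1 + |(l : ℝ)|) * K ^ l * ((1 + |(l : ℝ)|) * K ^ (-l) * ‖υ l‖) := by
  have hK0 : 0 < K := by linarith
  have hε : 0 < K - 1 := by linarith
  refine Summable.of_nonneg_of_le (fun l => by positivity) (fun l => ?_)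
    (Summable.mul_left (1 + (K - 1)⁻¹) hs)
  have e : K ^ l * K ^ (-l) = 1 := by rw [← zpow_add₀ hK0.ne']; simp
  have hb : 1 + (l.natAbs : ℝ) * (K - 1) ≤ K ^ l.natAbs := by
    have := one_add_mul_le_pow (a := K - 1) (by linarith) l.natAbs
    simpa using this
  have habs : (l.natAbs : ℝ) = |(l : ℝ)| := by rw [Nat.cast_natAbs, Int.cast_abs]
  rw [habs] at hb
  have h3 : 1 + |(l : ℝ)| ≤ (1 + (K - 1)⁻¹) * K ^ l.natAbs := by
    refine le_trans ?_ (mul_le_mul_of_nonneg_left hb (by positivity))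
    have : (K - 1)⁻¹ * (K - 1) = 1 := inv_mul_cancel₀ hε.ne'
    have h4 : 0 ≤ (K - 1)⁻¹ := by positivity
    have h5 := abs_nonneg (l : ℝ)
    nlinarith [mul_nonneg h5 hε.le]
  calc (1 + |(l : ℝ)|) * K ^ l * ((1 + |(l : ℝ)|) * K ^ (-l) * ‖υ l‖)
      = (K ^ l * K ^ (-l)) * ((1 + |(l : ℝ)|) * ((1 + |(l : ℝ)|) * ‖υ l‖)) := by ring
    _ = (1 + |(l : ℝ)|) * ((1 + |(l : ℝ)|) * ‖υ l‖) := by rw [e, one_mul]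
    _ ≤ ((1 + (K - 1)⁻¹) * K ^ l.natAbs) * ((1 + |(l : ℝ)|) * ‖υ l‖) :=
        mul_le_mul_of_nonneg_right h3 (by positivity)
    _ = _ := by ring

/-- The bound `C (1 + |i|) K^i · (1 + |l|) K^{-l} |υ_l|` for `F(i,l) υ_l`, where `C` bounds the
inverse denominators. -/
def jostKernelBound (υ : ℤ → ℂ) (K C : ℝ) (i l : ℤ) : ℝ :=
  C * ((1 + |(i : ℝ)|) * K ^ i) * ((1 + |(l : ℝ)|) * K ^ (-l) * ‖υ l‖)

/-- The resulting bound for `|Λ(i) - 1|`. -/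
def jostExcess (υ : ℤ → ℂ) (K C : ℝ) (i : ℤ) : ℝ :=
  C * ((1 + |(i : ℝ)|) * K ^ i) * ((∑' l : ℤ, (1 + |(l : ℝ)|) * K ^ (-l) * ‖υ l‖) *
    Real.exp (C * ∑' l : Set.Iio i,
      (1 + |((l : ℤ) : ℝ)|) * K ^ (l : ℤ) * ((1 + |((l : ℤ) : ℝ)|) * K ^ (-(l : ℤ)) * ‖υ l‖)))

theorem isMajorant_jost {C : ℝ} (hK : 1 < K) (hs : WeightedSummable K υ) (hC : 0 ≤ C) :
    IsMajorant (jostKernelBound υ K C) (fun i => 1 + jostExcess υ K C i) := by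
  have hK0 : 0 < K := by linarith
  have hw : Summable fun l : ℤ =>
      C * ((1 + |(l : ℝ)|) * K ^ l) * ((1 + |(l : ℝ)|) * K ^ (-l) * ‖υ l‖) := by
    refine ((summable_middle_weight hK hs).mul_left C).congr fun l => by ring
  have := isMajorant_mul (g := fun i : ℤ => C * ((1 + |(i : ℝ)|) * K ^ i))
    (a := fun l : ℤ => (1 + |(l : ℝ)|) * K ^ (-l) * ‖υ l‖) (fun i => by positivity)
    (fun l => by positivity) (summable_left_weight hK hs) hw
  refine Eq.subst (motive := fun M => IsMajorant (jostKernelBound υ K C) M)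
    (funext fun i => ?_) this
  unfold jostExcess
  rw [← tsum_mul_left]
  congr 5
  funext l
  ring

theorem norm_kernel_mul_le {C : ℝ} {ζ : ℂ} (hK : 1 < K) {υ' : ℤ → ℂ} (hυ : ∀ l, ‖υ' l‖ ≤ ‖υ l‖)
    (hx : ∀ s, ‖(q s - ζ) / (q s + ζ)‖ ≤ K) (hC : ∀ s, ‖(q s + ζ)⁻¹‖ ≤ C) (i l : ℤ) (h : l < i) :
    ‖kernel q ζ l i * υ' l‖ ≤ jostKernelBound υ K C i l := by
  have hK0 : 0 < K := by linarith
  have hC0 : 0 ≤ C := (norm_nonneg _).trans (hC 0)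
  rw [norm_mul]
  refine (mul_le_mul (norm_kernel_le hK.le hx hC h.le) (hυ l) (norm_nonneg _)
    (by positivity)).trans (le_of_eq ?_)
  unfold jostKernelBound
  ring

theorem tendsto_jostExcess_atBot (hK : 1 < K) (hs : WeightedSummable K υ) {C : ℝ} (hC : 0 ≤ C) :
    Tendsto (jostExcess υ K C) atBot (𝓝 0) := by
  have hK0 : 0 < K := by linarith
  set W : ℝ := ∑' l : ℤ, (1 + |(l : ℝ)|) * K ^ l * ((1 + |(l : ℝ)|) * K ^ (-l) * ‖υ l‖) with hW
  set H : ℝ := ∑' l : ℤ, (1 + |(l : ℝ)|) * K ^ (-l) * ‖υ l‖ with hH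
  have hH0 : 0 ≤ H := tsum_nonneg fun l => by positivity
  have hg : Tendsto (fun i : ℤ => (1 + |(i : ℝ)|) * K ^ i) atBot (𝓝 0) := by
    have hr : ‖K⁻¹‖ < 1 := by
      rw [Real.norm_of_nonneg (by positivity)]; exact inv_lt_one_of_one_lt₀ hK
    have h1 := (tendsto_self_mul_const_pow_of_abs_lt_one (r := K⁻¹) hr).add
      (tendsto_pow_atTop_nhds_zero_of_norm_lt_one hr)
    have h2 : Tendsto (fun i : ℤ => i.natAbs) atBot atTop := by
      refine tendsto_atTop.2 fun b => ?_
      filter_upwards [eventually_le_atBot (-(b : ℤ))] with i hi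
      omega
    have h3 := h1.comp h2
    rw [add_zero] at h3
    refine h3.congr' ?_
    filter_upwards [eventually_le_atBot (0 : ℤ)] with i hi
    have habs : (i.natAbs : ℝ) = |(i : ℝ)| := by rw [Nat.cast_natAbs, Int.cast_abs]
    have hp : K⁻¹ ^ i.natAbs = K ^ i := by
      rw [inv_pow, ← zpow_natCast, ← zpow_neg]
      congr 1
      omega
    simp only [Function.comp, habs, hp]
    ring
  have hup : Tendsto (fun i : ℤ => C * ((1 + |(i : ℝ)|) * K ^ i) * (H * Real.exp (C * W))) atBot
      (𝓝 0) := by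
    simpa using (hg.const_mul C).mul_const (H * Real.exp (C * W))
  refine squeeze_zero (fun i => ?_) (fun i => ?_) hup
  · unfold jostExcess
    positivity
  · unfold jostExcess
    refine mul_le_mul_of_nonneg_left (mul_le_mul_of_nonneg_left (Real.exp_le_exp.2
      (mul_le_mul_of_nonneg_left ?_ hC)) hH0) (by positivity)
    exact (summable_middle_weight hK hs).tsum_subtype_le _ (Set.Iio i) fun l => by positivity

/-- Standing assumptions on the steps of a staircase: finitely many nonzero parameters. -/
structure StepParameters (q : ℤ → ℂ) : Prop where
  finite_range : (Set.range q).Finite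
  ne_zero : ∀ i, q i ≠ 0

/-- Uniform control of the left Jost functions off `𝒫`, for all potentials dominated by `υ`. -/
theorem exists_jost_majorant (hq : StepParameters q) (hK : 1 < K) (hs : WeightedSummable K υ) :
    ∃ (κ : ℤ → ℤ → ℝ) (M : ℤ → ℝ), IsMajorant κ M ∧ Tendsto (fun i => M i - 1) atBot (𝓝 0) ∧
      ∀ υ' : ℤ → ℂ, (∀ l, ‖υ' l‖ ≤ ‖υ l‖) → ∀ ζ ∉ regionP q K, ∀ i l, l < i →
        ‖kernel q ζ l i * υ' l‖ ≤ κ i l := by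
  obtain ⟨C, hC⟩ := exists_norm_inv_le hq.finite_range hq.ne_zero
  have hC' : ∀ ζ ∉ regionP q K, ∀ r, ‖(q r + ζ)⁻¹‖ ≤ max C 0 := fun ζ h r =>
    (hC ζ h r).trans (le_max_left _ _)
  refine ⟨_, _, isMajorant_jost hK hs (le_max_right C 0), ?_, fun υ' hυ ζ h i l hl =>
    norm_kernel_mul_le hK hυ (norm_div_le_of_notMem_regionP hq.ne_zero h) (hC' ζ h) i l hl⟩
  simpa using tendsto_jostExcess_atBot hK hs (le_max_right C 0)

theorem continuousOn_jostLam (hq : StepParameters q) (hK : 1 < K) (hs : WeightedSummable K υ)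
    (i : ℤ) : ContinuousOn (jostLam q υ i) (regionP q K)ᶜ := by
  obtain ⟨κ, M, hM, -, hb⟩ := exists_jost_majorant hq hK hs
  exact hM.continuousOn_jostLam (fun ζ hζ => hb υ (fun _ => le_rfl) ζ hζ)
    (fun l i ζ hζ => (differentiableAt_kernel
      (add_ne_zero_of_notMem_regionP hq.ne_zero hζ) l i).continuousAt.continuousWithinAt) i

theorem differentiableOn_jostLam (hq : StepParameters q) (hK : 1 < K) (hs : WeightedSummable K υ)
    (i : ℤ) : DifferentiableOn ℂ (jostLam q υ i) (closure (regionP q K))ᶜ := by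
  obtain ⟨κ, M, hM, -, hb⟩ := exists_jost_majorant hq hK hs
  have hsub : ∀ ζ ∈ (closure (regionP q K))ᶜ, ζ ∉ regionP q K := fun ζ hζ h =>
    hζ (subset_closure h)
  exact hM.differentiableOn_jostLam isClosed_closure.isOpen_compl
    (fun ζ hζ => hb υ (fun _ => le_rfl) ζ (hsub ζ hζ))
    (fun l i ζ hζ => (differentiableAt_kernel
      (add_ne_zero_of_notMem_regionP hq.ne_zero (hsub ζ hζ)) l i).differentiableWithinAt) i

theorem tendsto_jostLam_atBot (hq : StepParameters q) (hK : 1 < K) (hs : WeightedSummable K υ)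
    {ζ : ℂ} (hζ : ζ ∉ regionP q K) : Tendsto (fun i => jostLam q υ i ζ) atBot (𝓝 1) := by
  obtain ⟨κ, M, hM, hlim, hb⟩ := exists_jost_majorant hq hK hs
  rw [tendsto_iff_norm_sub_tendsto_zero]
  exact squeeze_zero (fun _ => norm_nonneg _)
    (fun i => hM.norm_jostLam_sub_one_le (hb υ (fun _ => le_rfl) ζ hζ) i) hlim

theorem tendsto_inv_add_cocompact (z : ℂ) : Tendsto (fun ζ : ℂ => (z + ζ)⁻¹) (cocompact ℂ) (𝓝 0) :=
  tendsto_inv₀_cobounded.comp (by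
    rw [Metric.cobounded_eq_cocompact]
    exact (Homeomorph.addLeft z).isClosedEmbedding.tendsto_cocompact)

theorem tendsto_jostLam_cocompact (hq : StepParameters q) (hK : 1 < K)
    (hs : WeightedSummable K υ) (i : ℤ) :
    Tendsto (jostLam q υ i) (cocompact ℂ) (𝓝 1) := by
  set s := hq.finite_range.toFinset with hsdef
  have hmem : ∀ r, q r ∈ s := fun r => by simp [hsdef]
  set C : ℂ → ℝ := fun ζ => ∑ z ∈ s, ‖(z + ζ)⁻¹‖ with hC
  have hC0 : ∀ ζ, 0 ≤ C ζ := fun ζ => Finset.sum_nonneg fun _ _ => norm_nonneg _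
  have hCle : ∀ ζ r, ‖(q r + ζ)⁻¹‖ ≤ C ζ := fun ζ r =>
    Finset.single_le_sum (f := fun z => ‖(z + ζ)⁻¹‖) (fun _ _ => norm_nonneg _) (hmem r)
  have hClim : Tendsto C (cocompact ℂ) (𝓝 0) := by
    have := tendsto_finsetSum s fun z _ => (tendsto_inv_add_cocompact z).norm
    simpa [hC] using this
  have hexc : Tendsto (fun ζ => jostExcess υ K (C ζ) i) (cocompact ℂ) (𝓝 0) := by
    have hc : Continuous fun c : ℝ => jostExcess υ K c i := by
      unfold jostExcess
      fun_prop
    have := (hc.tendsto 0).comp hClim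
    simpa [jostExcess, Function.comp_def] using this
  have hev : ∀ᶠ ζ in cocompact ℂ, ∀ z ∈ s, ‖(z - ζ) / (z + ζ)‖ ≤ K := by
    rw [Filter.eventually_all_finset]
    intro z _
    have h1 : Tendsto (fun ζ : ℂ => -1 + 2 * z * (z + ζ)⁻¹) (cocompact ℂ) (𝓝 (-1)) := by
      simpa using ((tendsto_inv_add_cocompact z).const_mul (2 * z)).const_add (-1)
    have h2 := h1.norm
    rw [norm_neg, norm_one] at h2
    have h3 : ∀ᶠ ζ in cocompact ℂ, ζ ≠ -z := by
      have := (isCompact_singleton (x := -z)).compl_mem_cocompact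
      filter_upwards [this] with ζ hζ using hζ
    filter_upwards [h2.eventually_lt_const hK, h3] with ζ hζ h4
    have h5 : z + ζ ≠ 0 := fun h => h4 (by linear_combination h)
    have e : (z - ζ) / (z + ζ) = -1 + 2 * z * (z + ζ)⁻¹ := by field_simp; ring
    rw [e]
    exact hζ.le
  rw [tendsto_iff_norm_sub_tendsto_zero]
  refine squeeze_zero' (Eventually.of_forall fun _ => norm_nonneg _) ?_ hexc
  filter_upwards [hev] with ζ hζ
  have := (isMajorant_jost hK hs (hC0 ζ)).norm_jostLam_sub_one_le
    (norm_kernel_mul_le hK (fun _ => le_rfl) (fun r => hζ _ (hmem r)) (hCle ζ)) i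
  simpa using this

/-- The left Jost function satisfies the three-term recurrence of the scattering problem. -/
theorem jostLam_recurrence (hq : StepParameters q) (hK : 1 < K) (hs : WeightedSummable K υ)
    {ζ : ℂ} (hζ : ζ ∉ regionP q K) (i : ℤ) :
    (q (i + 1) + ζ) * jostLam q υ (i + 2) ζ
      - (q i + q (i + 1) + υ (i + 1)) * jostLam q υ (i + 1) ζ
      + (q i - ζ) * jostLam q υ i ζ = 0 := by
  obtain ⟨κ, M, hM, -, hb⟩ := exists_jost_majorant hq hK hs
  have hb' := hb υ (fun _ => le_rfl) ζ hζ
  have hne := add_ne_zero_of_notMem_regionP hq.ne_zero hζ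
  -- the increments of `Λ`
  have key : ∀ i, HasSum (fun l : Set.Iio (i + 1) =>
      (∏ s ∈ Finset.Ico (l : ℤ) i, (q s - ζ) / (q s + ζ)) * (υ l * jostLam q υ l ζ))
      ((q i + ζ) * (jostLam q υ (i + 1) ζ - jostLam q υ i ζ)) := by
    intro i
    have h1 := (hM.summable_kernel_mul hb' (i + 1)).hasSum
    have h0 := hM.summable_kernel_mul hb' i
    have h2 : HasSum (fun l : Set.Iio (i + 1) => kernel q ζ l i * υ l * jostLam q υ l ζ)
        (∑' l : Set.Iio i, kernel q ζ l i * υ l * jostLam q υ l ζ) := by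
      have hs' := summable_Iio_succ (f := fun l => kernel q ζ l i * υ l * jostLam q υ l ζ) h0
      have ht := tsum_Iio_succ (f := fun l => kernel q ζ l i * υ l * jostLam q υ l ζ) h0
      have hz : kernel q ζ i i = 0 := by simp [kernel]
      simp only [hz, zero_mul, zero_add] at ht
      rw [← ht]
      exact hs'.hasSum
    have h3 := (h1.sub h2).mul_left (q i + ζ)
    have e1 := hM.jostLam_eq hb' (i + 1)
    have e0 := hM.jostLam_eq hb' i
    have e2 : jostLam q υ (i + 1) ζ - jostLam q υ i ζ
        = ∑' l : Set.Iio (i + 1), kernel q ζ l (i + 1) * υ l * jostLam q υ l ζ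
          - ∑' l : Set.Iio i, kernel q ζ l i * υ l * jostLam q υ l ζ := by
      rw [e1, e0]; ring
    rw [e2]
    refine h3.congr_fun fun l => ?_
    have hl : (l : ℤ) ≤ i := by have := l.2; simp only [Set.mem_Iio] at this; omega
    rw [kernel_succ hl]
    have := hne i
    field_simp
    ring
  have k0 := key i
  have k1 := key (i + 1)
  have hd : HasSum (fun l : Set.Iio (i + 1) =>
      (∏ s ∈ Finset.Ico (l : ℤ) (i + 1), (q s - ζ) / (q s + ζ)) * (υ l * jostLam q υ l ζ))
      ((q i - ζ) * (jostLam q υ (i + 1) ζ - jostLam q υ i ζ)) := by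
    have h := k0.mul_left ((q i - ζ) / (q i + ζ))
    have e : (q i - ζ) / (q i + ζ) * ((q i + ζ) * (jostLam q υ (i + 1) ζ - jostLam q υ i ζ))
        = (q i - ζ) * (jostLam q υ (i + 1) ζ - jostLam q υ i ζ) := by
      have := hne i
      field_simp
    rw [e] at h
    refine h.congr_fun fun l => ?_
    have hl : (l : ℤ) ≤ i := by have := l.2; simp only [Set.mem_Iio] at this; omega
    rw [prod_Ico_succ hl]
    ring
  have ht := tsum_Iio_succ (f := fun l => (∏ s ∈ Finset.Ico (l : ℤ) (i + 1),
    (q s - ζ) / (q s + ζ)) * (υ l * jostLam q υ l ζ)) hd.summable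
  rw [k1.tsum_eq, hd.tsum_eq] at ht
  simp only [Finset.Ico_self, Finset.prod_empty, one_mul] at ht
  have e : i + 1 + 1 = i + 2 := by ring
  rw [e] at ht
  linear_combination ht

/-- The Wronskian of `Λ(ζ)` and `Λ(-ζ)`. -/
theorem jostLam_wronskian (hq : StepParameters q) (hK : 1 < K) (hs : WeightedSummable K υ)
    {ζ : ℂ} (hζ : ζ ∉ regionP q K) (hζ' : -ζ ∉ regionP q K) (i : ℤ) :
    (q i + ζ) * jostLam q υ (i + 1) ζ * jostLam q υ i (-ζ)
      - (q i - ζ) * jostLam q υ (i + 1) (-ζ) * jostLam q υ i ζ = 2 * ζ := by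
  set W : ℤ → ℂ := fun i => (q i + ζ) * jostLam q υ (i + 1) ζ * jostLam q υ i (-ζ)
      - (q i - ζ) * jostLam q υ (i + 1) (-ζ) * jostLam q υ i ζ with hW
  have hstep : ∀ i, W (i + 1) = W i := by
    intro i
    have h1 := jostLam_recurrence hq hK hs hζ i
    have h2 := jostLam_recurrence hq hK hs hζ' i
    have e : i + 1 + 1 = i + 2 := by ring
    simp only [hW, e]
    linear_combination jostLam q υ (i + 1) (-ζ) * h1 - jostLam q υ (i + 1) ζ * h2
  have hconst : ∀ n : ℕ, W (i - n) = W i := by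
    intro n
    induction n with
    | zero => simp
    | succ n ih =>
      rw [← ih, ← hstep]
      congr 1
      push_cast
      ring
  -- the Wronskian minus `2ζ` tends to zero at `-∞`, the parameters being bounded
  have hlim : Tendsto (fun j => W j - 2 * ζ) atBot (𝓝 0) := by
    have a0 := tendsto_jostLam_atBot hq hK hs hζ
    have b0 := tendsto_jostLam_atBot hq hK hs hζ'
    have hsh : Tendsto (fun j : ℤ => j + 1) atBot atBot :=
      tendsto_atBot_add_const_right _ _ tendsto_id
    have a1 := a0.comp hsh
    have b1 := b0.comp hsh
    obtain ⟨c, hc⟩ := (hq.finite_range.image norm).bddAbove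
    have hbd : IsBoundedUnder (· ≤ ·) atBot (norm ∘ q) :=
      ⟨c, Filter.eventually_map.2 (Eventually.of_forall fun j => hc ⟨q j, ⟨j, rfl⟩, rfl⟩)⟩
    have p1 : Tendsto (fun j => jostLam q υ (j + 1) ζ * jostLam q υ j (-ζ)
        - jostLam q υ (j + 1) (-ζ) * jostLam q υ j ζ) atBot (𝓝 0) := by
      simpa using (a1.mul b0).sub (b1.mul a0)
    have p2 : Tendsto (fun j => ζ * (jostLam q υ (j + 1) ζ * jostLam q υ j (-ζ)
        + jostLam q υ (j + 1) (-ζ) * jostLam q υ j ζ - 2)) atBot (𝓝 0) := by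
      have := (((a1.mul b0).add (b1.mul a0)).sub_const 2).const_mul ζ
      norm_num at this
      exact this
    have p3 := (isBoundedUnder_le_mul_tendsto_zero hbd p1).add p2
    rw [add_zero] at p3
    refine p3.congr fun j => ?_
    simp only [hW]
    ring
  have hl2 : Tendsto (fun n : ℕ => W (i - n) - 2 * ζ) atTop (𝓝 0) :=
    hlim.comp (tendsto_atBot.2 fun b => by
      filter_upwards [eventually_ge_atTop (i - b).toNat] with n hn
      omega)
  simp only [hconst] at hl2
  have := tendsto_nhds_unique hl2 tendsto_const_nhds
  exact (sub_eq_zero.1 this.symm)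

/-! ### The right Jost function, by reversal of the staircase -/

theorem neumannRight_eq {ζ : ℂ} (h0 : ζ ≠ 0) (h : ∀ r, q r + ζ ≠ 0) (k : ℕ) (i : ℤ) :
    neumannRight q υ ζ k i
      = neumannLeft (fun s => q (-1 - s)) (fun l => υ (-l)) ζ k (-i) := by
  induction k generalizing i with
  | zero => rfl
  | succ k ih =>
    simp only [neumannRight, neumannLeft]
    rw [← ((Equiv.neg ℤ).subtypeEquiv (p := (· ∈ Set.Ioi i)) (q := (· ∈ Set.Iio (-i)))
      (by simp)).tsum_eq]
    refine tsum_congr fun l => ?_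
    have hl : i ≤ (l : ℤ) := (Set.mem_Ioi.1 l.2).le
    simp only [Equiv.subtypeEquiv_apply, Equiv.neg_apply, neg_neg]
    rw [kernel_reflect h0 h hl, ih]

theorem jostUps_eq {ζ : ℂ} (h0 : ζ ≠ 0) (h : ∀ r, q r + ζ ≠ 0) (i : ℤ) :
    jostUps q υ i ζ = jostLam (fun s => q (-1 - s)) (fun l => υ (-l)) (-i) ζ :=
  tsum_congr fun k => neumannRight_eq h0 h k i

theorem StepParameters.reflect (hq : StepParameters q) :
    StepParameters (fun s => q (-1 - s)) :=
  ⟨hq.finite_range.subset (by rintro _ ⟨s, rfl⟩; exact ⟨_, rfl⟩), fun i => hq.ne_zero _⟩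

theorem WeightedSummable.reflect (hs : WeightedSummable K υ) :
    WeightedSummable K fun l => υ (-l) := by
  have := (Equiv.neg ℤ).summable_iff.2 hs
  refine this.congr fun i => ?_
  simp

theorem regionP_reflect : regionP (fun s => q (-1 - s)) K = regionP q K := by
  ext ζ
  constructor
  · rintro ⟨r, hr⟩
    exact ⟨_, hr⟩
  · rintro ⟨r, hr⟩
    exact ⟨-1 - r, by simpa using hr⟩

theorem jostUps_recurrence (hq : StepParameters q) (hK : 1 < K) (hs : WeightedSummable K υ)
    {ζ : ℂ} (h0 : ζ ≠ 0) (hζ : ζ ∉ regionP q K) (i : ℤ) :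
    (q (i + 1) - ζ) * jostUps q υ (i + 2) ζ
      - (q i + q (i + 1) + υ (i + 1)) * jostUps q υ (i + 1) ζ
      + (q i + ζ) * jostUps q υ i ζ = 0 := by
  have hne := add_ne_zero_of_notMem_regionP hq.ne_zero hζ
  have h := jostLam_recurrence hq.reflect hK hs.reflect (regionP_reflect (q := q) ▸ hζ) (-i - 2)
  have e1 : (-1 - (-i - 2 + 1) : ℤ) = i := by ring
  have e2 : (-1 - (-i - 2) : ℤ) = i + 1 := by ring
  have e3 : -(-i - 2 + 1) = i + 1 := by ring
  have e4 : (-i - 2 + 2 : ℤ) = -i := by ring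
  have e5 : (-i - 2 + 1 : ℤ) = -(i + 1) := by ring
  have e6 : (-i - 2 : ℤ) = -(i + 2) := by ring
  rw [e1, e2, e3, e4, e5, e6] at h
  rw [jostUps_eq h0 hne, jostUps_eq h0 hne, jostUps_eq h0 hne]
  linear_combination h

theorem differentiableOn_jostUps (hq : StepParameters q) (hK : 1 < K) (hs : WeightedSummable K υ)
    (i : ℤ) : DifferentiableOn ℂ (jostUps q υ i) ((closure (regionP q K))ᶜ ∩ {0}ᶜ) := by
  have h := differentiableOn_jostLam hq.reflect hK hs.reflect (-i)
  rw [regionP_reflect] at h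
  refine (h.mono Set.inter_subset_left).congr fun ζ hζ => ?_
  exact jostUps_eq hζ.2 (add_ne_zero_of_notMem_regionP hq.ne_zero
    fun hmem => hζ.1 (subset_closure hmem)) i

/-! ### Truncated potentials -/

/-- The potential cut off outside `[-m, m]`. -/
def truncate (υ : ℤ → ℂ) (m : ℕ) (l : ℤ) : ℂ := if l.natAbs ≤ m then υ l else 0

theorem norm_truncate_le (m : ℕ) (l : ℤ) : ‖truncate υ m l‖ ≤ ‖υ l‖ := by
  unfold truncate
  split_ifs <;> simp

theorem weightedSummable_truncate (K : ℝ) (υ : ℤ → ℂ) (m : ℕ) :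
    WeightedSummable K (truncate υ m) := by
  refine summable_of_hasFiniteSupport ((Set.finite_Icc (-(m : ℤ)) m).subset fun l hl => ?_)
  by_contra hc
  refine hl ?_
  have : ¬ l.natAbs ≤ m := fun h => hc (Set.mem_Icc.2 ⟨by omega, by omega⟩)
  simp [truncate, this]

/-- For a finitely supported potential the only singularities are the points `-q_r`. -/
theorem differentiableAt_jostLam_truncate (hq : StepParameters q) (m : ℕ) (i : ℤ) {ζ : ℂ}
    (h : ∀ r, q r + ζ ≠ 0) : DifferentiableAt ℂ (jostLam q (truncate υ m) i) ζ := by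
  obtain ⟨K', hK', hmem⟩ := exists_notMem_closure_regionP hq.finite_range h
  exact (differentiableOn_jostLam hq hK' (weightedSummable_truncate K' υ m) i).differentiableAt
    (isClosed_closure.isOpen_compl.mem_nhds hmem)

theorem tendsto_jostLam_truncate (hq : StepParameters q) (hK : 1 < K)
    (hs : WeightedSummable K υ) {ζ : ℂ} (hζ : ζ ∉ regionP q K) (i : ℤ) :
    Tendsto (fun m => jostLam q (truncate υ m) i ζ) atTop (𝓝 (jostLam q υ i ζ)) := by
  obtain ⟨κ, M, hM, -, hb⟩ := exists_jost_majorant hq hK hs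
  refine hM.tendsto_jostLam (fun m => hb _ (norm_truncate_le m) ζ hζ) (fun l => ?_) i
  refine tendsto_const_nhds.congr' ?_
  filter_upwards [eventually_ge_atTop l.natAbs] with m hm
  simp [truncate, hm]

theorem exists_norm_jostLam_truncate_le (hq : StepParameters q) (hK : 1 < K)
    (hs : WeightedSummable K υ) (i : ℤ) :
    ∃ C, ∀ m, ∀ ζ ∉ regionP q K, ‖jostLam q (truncate υ m) i ζ‖ ≤ C := by
  obtain ⟨κ, M, hM, -, hb⟩ := exists_jost_majorant hq hK hs
  exact ⟨M i, fun m ζ hζ => hM.norm_jostLam_le (hb _ (norm_truncate_le m) ζ hζ) i⟩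

end Jost

/-! ### Integrals along a contour -/

section Contour

open MeasureTheory

variable {γ : ℝ → ℂ}

theorem IsPositiveContour.isCompact (hγ : IsPositiveContour γ) : IsCompact (contourImage γ) :=
  isCompact_Icc.image_of_continuousOn hγ.continuousOn

theorem mem_contourImage {t : ℝ} (ht : t ∈ Set.uIoc (0 : ℝ) 1) : γ t ∈ contourImage γ := by
  rw [Set.uIoc_of_le zero_le_one] at ht
  exact ⟨t, ⟨ht.1.le, ht.2⟩, rfl⟩

/-- The bound for the derivative holds almost everywhere on `[0,1]`. -/
theorem IsPositiveContour.exists_deriv_le (hγ : IsPositiveContour γ) :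
    ∃ M : ℝ, 0 ≤ M ∧ ∀ᵐ t ∂(volume : Measure ℝ), t ∈ Set.uIoc (0 : ℝ) 1 → ‖deriv γ t‖ ≤ M := by
  obtain ⟨M, hM⟩ := hγ.deriv_bounded
  refine ⟨max M 0, le_max_right _ _, ?_⟩
  have h1 : ∀ᵐ t ∂(volume : Measure ℝ), t ≠ 1 := by
    simp [ae_iff]
  filter_upwards [h1] with t ht hmem
  rw [Set.uIoc_of_le zero_le_one] at hmem
  exact (hM t ⟨hmem.1, lt_of_le_of_ne hmem.2 ht⟩).trans (le_max_left _ _)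

theorem IsPositiveContour.aestronglyMeasurable (hγ : IsPositiveContour γ) {φ : ℂ → ℂ}
    (hφ : ContinuousOn φ (contourImage γ)) :
    AEStronglyMeasurable (fun t => φ (γ t) * deriv γ t)
      (volume.restrict (Set.uIoc (0 : ℝ) 1)) := by
  refine AEStronglyMeasurable.mul ?_ (measurable_deriv γ).aestronglyMeasurable
  have h1 : ContinuousOn (fun t => φ (γ t)) (Set.uIoc (0 : ℝ) 1) := by
    refine hφ.comp (hγ.continuousOn.mono ?_) fun t ht => mem_contourImage ht
    rw [Set.uIoc_of_le zero_le_one]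
    exact Set.Ioc_subset_Icc_self
  exact h1.aestronglyMeasurable measurableSet_uIoc

theorem IsPositiveContour.exists_norm_le (hγ : IsPositiveContour γ) {φ : ℂ → ℂ}
    (hφ : ContinuousOn φ (contourImage γ)) : ∃ C, 0 ≤ C ∧ ∀ σ ∈ contourImage γ, ‖φ σ‖ ≤ C := by
  obtain ⟨C, hC⟩ := hγ.isCompact.exists_bound_of_continuousOn hφ
  exact ⟨max C 0, le_max_right _ _, fun σ hσ => (hC σ hσ).trans (le_max_left _ _)⟩

theorem IsPositiveContour.intervalIntegrable (hγ : IsPositiveContour γ) {φ : ℂ → ℂ}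
    (hφ : ContinuousOn φ (contourImage γ)) :
    IntervalIntegrable (fun t => φ (γ t) * deriv γ t) volume 0 1 := by
  obtain ⟨M, hM0, hM⟩ := hγ.exists_deriv_le
  obtain ⟨C, hC0, hC⟩ := hγ.exists_norm_le hφ
  rw [intervalIntegrable_iff]
  refine (intervalIntegrable_iff.1 (intervalIntegrable_const (c := C * M))).mono'
    (hγ.aestronglyMeasurable hφ) ?_
  rw [ae_restrict_iff' measurableSet_uIoc]
  filter_upwards [hM] with t ht hmem
  rw [norm_mul]
  exact mul_le_mul (hC _ (mem_contourImage hmem)) (ht hmem) (norm_nonneg _) hC0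

theorem contourIntegral_congr {φ ψ : ℂ → ℂ} (h : ∀ σ ∈ contourImage γ, φ σ = ψ σ) :
    contourIntegral γ φ = contourIntegral γ ψ := by
  refine intervalIntegral.integral_congr_ae (Eventually.of_forall fun t ht => ?_)
  simp only [h _ (mem_contourImage ht)]

theorem IsPositiveContour.integral_add (hγ : IsPositiveContour γ) {φ ψ : ℂ → ℂ}
    (hφ : ContinuousOn φ (contourImage γ)) (hψ : ContinuousOn ψ (contourImage γ)) :
    contourIntegral γ (fun σ => φ σ + ψ σ) = contourIntegral γ φ + contourIntegral γ ψ := by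
  unfold contourIntegral
  rw [← intervalIntegral.integral_add (hγ.intervalIntegrable hφ) (hγ.intervalIntegrable hψ)]
  simp only [add_mul]

theorem contourIntegral_const_mul (c : ℂ) (φ : ℂ → ℂ) :
    contourIntegral γ (fun σ => c * φ σ) = c * contourIntegral γ φ := by
  unfold contourIntegral
  rw [← intervalIntegral.integral_const_mul]
  simp only [mul_assoc]

theorem IsPositiveContour.integral_sub (hγ : IsPositiveContour γ) {φ ψ : ℂ → ℂ}
    (hφ : ContinuousOn φ (contourImage γ)) (hψ : ContinuousOn ψ (contourImage γ)) :
    contourIntegral γ (fun σ => φ σ - ψ σ) = contourIntegral γ φ - contourIntegral γ ψ := by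
  unfold contourIntegral
  rw [← intervalIntegral.integral_sub (hγ.intervalIntegrable hφ) (hγ.intervalIntegrable hψ)]
  simp only [sub_mul]

theorem IsPositiveContour.integral_finset_sum (hγ : IsPositiveContour γ) {ι : Type*}
    (s : Finset ι) {φ : ι → ℂ → ℂ} (hφ : ∀ i ∈ s, ContinuousOn (φ i) (contourImage γ)) :
    contourIntegral γ (fun σ => ∑ i ∈ s, φ i σ) = ∑ i ∈ s, contourIntegral γ (φ i) := by
  unfold contourIntegral
  rw [← intervalIntegral.integral_finsetSum fun i hi => hγ.intervalIntegrable (hφ i hi)]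
  simp only [Finset.sum_mul]

theorem IsPositiveContour.exists_norm_integral_le (hγ : IsPositiveContour γ) :
    ∃ M : ℝ, 0 ≤ M ∧ ∀ (φ : ℂ → ℂ) (C : ℝ), (∀ σ ∈ contourImage γ, ‖φ σ‖ ≤ C) →
      ‖contourIntegral γ φ‖ ≤ C * M := by
  obtain ⟨M, hM0, hM⟩ := hγ.exists_deriv_le
  refine ⟨M, hM0, fun φ C hC => ?_⟩
  have hC0 : 0 ≤ C := (norm_nonneg _).trans (hC (γ 1) ⟨1, by simp, rfl⟩)
  have := intervalIntegral.norm_integral_le_of_norm_le_const_ae (a := 0) (b := 1) (C := C * M)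
    (f := fun t => φ (γ t) * deriv γ t) (by
      filter_upwards [hM] with t ht hmem
      rw [norm_mul]
      exact mul_le_mul (hC _ (mem_contourImage hmem)) (ht hmem) (norm_nonneg _) hC0)
  simpa [contourIntegral] using this

theorem IsPositiveContour.tendsto_integral (hγ : IsPositiveContour γ) {φ : ℕ → ℂ → ℂ}
    {ψ : ℂ → ℂ} {C : ℝ} (hφ : ∀ m, ContinuousOn (φ m) (contourImage γ))
    (hC : ∀ m, ∀ σ ∈ contourImage γ, ‖φ m σ‖ ≤ C)
    (hlim : ∀ σ ∈ contourImage γ, Tendsto (fun m => φ m σ) atTop (𝓝 (ψ σ))) :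
    Tendsto (fun m => contourIntegral γ (φ m)) atTop (𝓝 (contourIntegral γ ψ)) := by
  obtain ⟨M, hM0, hM⟩ := hγ.exists_deriv_le
  have hC0 : 0 ≤ C := (norm_nonneg _).trans (hC 0 (γ 1) ⟨1, by simp, rfl⟩)
  refine intervalIntegral.tendsto_integral_filter_of_dominated_convergence (fun _ => C * M)
    (Eventually.of_forall fun m => hγ.aestronglyMeasurable (hφ m))
    (Eventually.of_forall fun m => ?_) intervalIntegrable_const
    (Eventually.of_forall fun t ht => (hlim _ (mem_contourImage ht)).mul_const _)
  filter_upwards [hM] with t ht hmem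
  rw [norm_mul]
  exact mul_le_mul (hC m _ (mem_contourImage hmem)) (ht hmem) (norm_nonneg _) hC0

/-- Holomorphic dependence of a contour integral on a parameter. -/
theorem IsPositiveContour.differentiableAt_integral (hγ : IsPositiveContour γ) {g : ℂ → ℂ → ℂ}
    {w₀ : ℂ} {r C : ℝ} (hr : 0 < r)
    (hd : ∀ σ ∈ contourImage γ, DifferentiableOn ℂ (g σ) (Metric.ball w₀ r))
    (hc : ∀ w ∈ Metric.ball w₀ r, ContinuousOn (fun σ => g σ w) (contourImage γ))
    (hb : ∀ σ ∈ contourImage γ, ∀ w ∈ Metric.ball w₀ r, ‖g σ w‖ ≤ C) :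
    DifferentiableAt ℂ (fun w => contourIntegral γ (fun σ => g σ w)) w₀ := by
  obtain ⟨M, hM0, hM⟩ := hγ.exists_deriv_le
  have hC0 : 0 ≤ C := (norm_nonneg _).trans
    (hb (γ 1) ⟨1, by simp, rfl⟩ w₀ (Metric.mem_ball_self hr))
  have hw₀ : w₀ ∈ Metric.ball w₀ r := Metric.mem_ball_self hr
  have hsub : ∀ x ∈ Metric.ball w₀ (r / 2), Metric.closedBall x (r / 4) ⊆ Metric.ball w₀ r := by
    intro x hx y hy
    rw [Metric.mem_ball] at hx ⊢
    rw [Metric.mem_closedBall] at hy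
    linarith [dist_triangle y x w₀]
  have hderiv : ∀ σ ∈ contourImage γ, ∀ x ∈ Metric.ball w₀ (r / 2),
      HasDerivAt (g σ) (deriv (g σ) x) x := by
    intro σ hσ x hx
    refine DifferentiableAt.hasDerivAt ((hd σ hσ).differentiableAt
      (Metric.isOpen_ball.mem_nhds ?_))
    exact Metric.ball_subset_ball (by linarith) hx
  have hdb : ∀ σ ∈ contourImage γ, ∀ x ∈ Metric.ball w₀ (r / 2),
      ‖deriv (g σ) x‖ ≤ C / (r / 4) := by
    intro σ hσ x hx
    refine Complex.norm_deriv_le_of_forall_mem_sphere_norm_le (by positivity) ?_ fun z hz =>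
      hb σ hσ z (hsub x hx (Metric.sphere_subset_closedBall hz))
    refine DifferentiableOn.diffContOnCl ((hd σ hσ).mono ?_)
    rw [closure_ball _ (by positivity)]
    exact hsub x hx
  refine (intervalIntegral.hasDerivAt_integral_of_dominated_loc_of_deriv_le
    (F := fun w t => g (γ t) w * deriv γ t) (F' := fun w t => deriv (g (γ t)) w * deriv γ t)
    (s := Metric.ball w₀ (r / 2)) (bound := fun _ => C / (r / 4) * M)
    (Metric.ball_mem_nhds w₀ (by positivity)) ?_ (hγ.intervalIntegrable (hc w₀ hw₀)) ?_ ?_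
    intervalIntegrable_const ?_).2.differentiableAt
  · filter_upwards [Metric.ball_mem_nhds w₀ hr] with w hw
    exact hγ.aestronglyMeasurable (hc w hw)
  · -- the derivative is a pointwise limit of difference quotients
    set x : ℕ → ℂ := fun n => w₀ + ((r / (n + 2) : ℝ) : ℂ) with hx
    have hpos : ∀ n : ℕ, 0 < r / (n + 2) := fun n => by positivity
    have hxb : ∀ n, x n ∈ Metric.ball w₀ r := by
      intro n
      rw [Metric.mem_ball, hx, dist_self_add_left, Complex.norm_real,
        Real.norm_of_nonneg (hpos n).le]
      rw [div_lt_iff₀ (by positivity)]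
      nlinarith [(Nat.cast_nonneg n : (0 : ℝ) ≤ n)]
    have hxlim : Tendsto x atTop (𝓝[≠] w₀) := by
      refine tendsto_nhdsWithin_iff.2 ⟨?_, Eventually.of_forall fun n => ?_⟩
      · have h1 : Tendsto (fun n : ℕ => r / ((n : ℝ) + 2)) atTop (𝓝 0) :=
          Tendsto.div_atTop tendsto_const_nhds
            (tendsto_atTop_add_const_right _ _ tendsto_natCast_atTop_atTop)
        have h2 := (Complex.continuous_ofReal.tendsto 0).comp h1
        simpa [hx] using h2.const_add w₀
      · simp only [hx, Set.mem_compl_iff, Set.mem_singleton_iff, add_eq_left,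
          Complex.ofReal_eq_zero]
        exact (hpos n).ne'
    refine aestronglyMeasurable_of_tendsto_ae atTop
      (f := fun n t => slope (g (γ t)) w₀ (x n) * deriv γ t) (fun n => ?_) ?_
    · simp only [slope_def_module, smul_eq_mul]
      exact hγ.aestronglyMeasurable (φ := fun σ => (x n - w₀)⁻¹ * (g σ (x n) - g σ w₀))
        (continuousOn_const.mul ((hc _ (hxb n)).sub (hc _ hw₀)))
    · rw [ae_restrict_iff' measurableSet_uIoc]
      refine Eventually.of_forall fun t ht => Tendsto.mul_const _ ?_
      exact (hasDerivAt_iff_tendsto_slope.1 (hderiv _ (mem_contourImage ht) w₀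
        (Metric.mem_ball_self (by positivity)))).comp hxlim
  · filter_upwards [hM] with t ht hmem x hx
    rw [norm_mul]
    exact mul_le_mul (hdb _ (mem_contourImage hmem) x hx) (ht hmem) (norm_nonneg _) (by positivity)
  · exact Eventually.of_forall fun t ht x hx => (hderiv _ (mem_contourImage ht) x hx).mul_const _

theorem IsPositiveContour.continuousOn_div_sub {φ : ℂ → ℂ}
    (hφ : ContinuousOn φ (contourImage γ)) {w : ℂ} (hw : w ∉ contourImage γ) :
    ContinuousOn (fun σ => φ σ / (σ - w)) (contourImage γ) :=
  hφ.div (by fun_prop) fun σ hσ h => hw (by rwa [← sub_eq_zero.1 h])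

/-- A point off a contour has positive distance from it. -/
theorem IsPositiveContour.exists_ball (hγ : IsPositiveContour γ) {w : ℂ}
    (hw : w ∉ contourImage γ) :
    ∃ r > 0, ∀ σ ∈ contourImage γ, ∀ z ∈ Metric.ball w r, r ≤ ‖σ - z‖ := by
  obtain ⟨r, hr, hball⟩ := Metric.isOpen_iff.1 hγ.isCompact.isClosed.isOpen_compl w hw
  refine ⟨r / 2, by positivity, fun σ hσ z hz => ?_⟩
  have h1 : r ≤ dist σ w := by
    by_contra h
    exact hball (Metric.mem_ball.2 (not_le.1 h)) hσ
  rw [Metric.mem_ball] at hz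
  rw [← dist_eq_norm]
  linarith [dist_triangle σ z w]

/-- The Cauchy integral is holomorphic off the contour. -/
theorem IsPositiveContour.differentiableAt_cauchy (hγ : IsPositiveContour γ) {φ : ℂ → ℂ}
    (hφ : ContinuousOn φ (contourImage γ)) {w : ℂ} (hw : w ∉ contourImage γ) :
    DifferentiableAt ℂ (fun w => contourIntegral γ (fun σ => φ σ / (σ - w))) w := by
  obtain ⟨r, hr, hball⟩ := hγ.exists_ball hw
  obtain ⟨C, hC0, hC⟩ := hγ.exists_norm_le hφ
  have hne : ∀ σ ∈ contourImage γ, ∀ z ∈ Metric.ball w r, σ - z ≠ 0 := fun σ hσ z hz =>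
    norm_pos_iff.1 (hr.trans_le (hball σ hσ z hz))
  refine hγ.differentiableAt_integral (C := C / r) hr (fun σ hσ z hz => ?_) (fun z hz => ?_)
    fun σ hσ z hz => ?_
  · exact (DifferentiableAt.fun_div (by fun_prop) (by fun_prop)
      (hne σ hσ z hz)).differentiableWithinAt
  · exact hφ.div (by fun_prop) fun σ hσ => hne σ hσ z hz
  · rw [norm_div]
    exact div_le_div₀ hC0 (hC σ hσ) hr (hball σ hσ z hz)

theorem IsPositiveContour.tendsto_cauchy_cocompact (hγ : IsPositiveContour γ) {φ : ℂ → ℂ}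
    (hφ : ContinuousOn φ (contourImage γ)) :
    Tendsto (fun w => contourIntegral γ (fun σ => φ σ / (σ - w))) (cocompact ℂ) (𝓝 0) := by
  obtain ⟨M, hM0, hM⟩ := hγ.exists_norm_integral_le
  obtain ⟨C, hC0, hC⟩ := hγ.exists_norm_le hφ
  obtain ⟨B, hB0, hB⟩ := hγ.exists_norm_le (φ := id) continuousOn_id
  have hlim : Tendsto (fun w : ℂ => C / (‖w‖ - B) * M) (cocompact ℂ) (𝓝 0) := by
    have h1 : Tendsto (fun w : ℂ => ‖w‖ - B) (cocompact ℂ) atTop :=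
      tendsto_atTop_add_const_right _ _ (tendsto_norm_cocompact_atTop (E := ℂ))
    simpa using (h1.const_div_atTop C).mul_const M
  refine squeeze_zero_norm' ?_ hlim
  filter_upwards [(tendsto_norm_cocompact_atTop (E := ℂ)).eventually_gt_atTop B] with w hw
  refine hM _ _ fun σ hσ => ?_
  rw [norm_div]
  refine div_le_div₀ hC0 (hC σ hσ) (by linarith) ?_
  have h1 := hB σ hσ
  have h2 := norm_sub_norm_le w σ
  rw [norm_sub_rev] at h2
  simp only [id] at h1
  linarith

/-- The winding number is locally constant off the contour. -/
theorem IsPositiveContour.eventually_winding_eq (hγ : IsPositiveContour γ) {w : ℂ}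
    (hw : w ∉ contourImage γ) :
    ∀ᶠ z in 𝓝 w, z ∉ contourImage γ ∧ winding γ z = winding γ w := by
  have hopen := hγ.isCompact.isClosed.isOpen_compl.mem_nhds hw
  have hcont : ContinuousAt (winding γ) w :=
    continuousAt_const.mul
      (hγ.differentiableAt_cauchy (φ := fun _ => 1) continuousOn_const hw).continuousAt
  have hnear : ∀ᶠ z in 𝓝 w, ‖winding γ z - winding γ w‖ < 1 := by
    refine Tendsto.eventually_lt_const (by norm_num) (show Tendsto _ (𝓝 w) (𝓝 (0 : ℝ)) from ?_)
    have h2 := (Filter.Tendsto.sub hcont.tendsto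
      (tendsto_const_nhds (x := winding γ w))).norm
    simpa using h2
  filter_upwards [hopen, hnear] with z hz h1
  refine ⟨hz, ?_⟩
  rcases hγ.positive z hz with h2 | h2 <;> rcases hγ.positive w hw with h3 | h3 <;>
    simp [h2, h3] at h1 ⊢

theorem IsPositiveContour.eventually_exterior (hγ : IsPositiveContour γ) :
    ∀ᶠ z in cocompact ℂ, z ∈ exteriorRegion γ := by
  have h1 : Tendsto (winding γ) (cocompact ℂ) (𝓝 0) := by
    have := (hγ.tendsto_cauchy_cocompact (φ := fun _ => 1) continuousOn_const).const_mul
      (2 * (Real.pi : ℂ) * Complex.I)⁻¹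
    rw [mul_zero] at this
    exact this
  have h2 : ∀ᶠ z in cocompact ℂ, ‖winding γ z‖ < 1 :=
    Tendsto.eventually_lt_const zero_lt_one (by simpa using h1.norm)
  filter_upwards [h2, hγ.isCompact.compl_mem_cocompact] with z hz hz2
  refine ⟨hz2, ?_⟩
  rcases hγ.positive z hz2 with h | h
  · exact h
  · simp [h] at hz

theorem IsPositiveContour.isOpen_exterior (hγ : IsPositiveContour γ) :
    IsOpen (exteriorRegion γ) := by
  rw [isOpen_iff_mem_nhds]
  intro z hz
  filter_upwards [hγ.eventually_winding_eq hz.1] with w hw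
  exact ⟨hw.1, hw.2.trans hz.2⟩

theorem IsPositiveContour.isOpen_interior (hγ : IsPositiveContour γ) :
    IsOpen (interiorRegion γ) := by
  rw [isOpen_iff_mem_nhds]
  intro z hz
  filter_upwards [hγ.eventually_winding_eq hz.1] with w hw
  exact ⟨hw.1, hw.2.trans hz.2⟩

theorem IsPositiveContour.trichotomy (hγ : IsPositiveContour γ) (z : ℂ) :
    z ∈ contourImage γ ∨ z ∈ interiorRegion γ ∨ z ∈ exteriorRegion γ := by
  by_cases h : z ∈ contourImage γ
  · exact Or.inl h
  · rcases hγ.positive z h with h1 | h1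
    · exact Or.inr (Or.inr ⟨h, h1⟩)
    · exact Or.inr (Or.inl ⟨h, h1⟩)

theorem disjoint_interior_exterior {z : ℂ} (h1 : z ∈ interiorRegion γ)
    (h2 : z ∈ exteriorRegion γ) : False := by
  have := h1.2.symm.trans h2.2
  norm_num at this

/-- A piecewise smooth contour has planar measure zero. -/
theorem IsPositiveContour.volume_eq_zero (hγ : IsPositiveContour γ) :
    volume (contourImage γ) = 0 := by
  obtain ⟨T, hT⟩ := hγ.piecewise_smooth
  set s : Set ℂ := {z | z.im = 0 ∧ z.re ∈ Set.Ioo (0 : ℝ) 1 ∧ z.re ∉ T} with hs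
  have hs0 : volume s = 0 := by
    have h1 : volume ({z : ℂ | z.im = 0}) = 0 := by
      have := Measure.addHaar_submodule (volume : Measure ℂ) (LinearMap.ker Complex.imLm) (by
        intro h
        have : Complex.I ∈ LinearMap.ker Complex.imLm := by rw [h]; trivial
        simp at this)
      exact this
    exact measure_mono_null (fun z hz => hz.1) h1
  have himg : volume ((fun z : ℂ => γ z.re) '' s) = 0 := by
    refine addHaar_image_eq_zero_of_differentiableOn_of_addHaar_eq_zero volume ?_ hs0
    intro z hz
    have h1 : DifferentiableAt ℝ γ z.re := (hT z.re hz.2.1 hz.2.2).differentiableAt (by norm_num)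
    exact (h1.comp z Complex.reCLM.differentiableAt).differentiableWithinAt
  have hfin : ((γ '' (T : Set ℝ)) ∪ {γ 0, γ 1} : Set ℂ).Finite :=
    (T.finite_toSet.image _).union (by simp)
  refine measure_mono_null ?_ (measure_union_null himg (hfin.measure_zero volume))
  rintro _ ⟨t, ht, rfl⟩
  by_cases h : t ∈ Set.Ioo (0 : ℝ) 1 ∧ t ∉ T
  · exact Or.inl ⟨(t : ℂ), ⟨by simp, by simpa using h.1, by simpa using h.2⟩, by simp⟩
  · right
    by_cases hT' : t ∈ T
    · exact Or.inl ⟨t, hT', rfl⟩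
    · have h2 : t ∉ Set.Ioo (0 : ℝ) 1 := fun h3 => h ⟨h3, hT'⟩
      rcases ht.1.eq_or_lt with h3 | h3
      · right; left; rw [h3]
      · rcases ht.2.eq_or_lt with h4 | h4
        · right; right; rw [h4]; rfl
        · exact absurd ⟨h3, h4⟩ h2

theorem IsPositiveContour.dense_compl (hγ : IsPositiveContour γ) {s : Set ℂ} (hs : s.Finite) :
    Dense ((contourImage γ ∪ s)ᶜ) := by
  have h : volume (contourImage γ ∪ s) = 0 :=
    measure_union_null hγ.volume_eq_zero (hs.measure_zero _)
  rw [← interior_eq_empty_iff_dense_compl]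
  exact Measure.interior_eq_empty_of_null (μ := volume) h

end Contour

/-! ### Cauchy's integral formula for winding numbers -/

section Dixon

variable {γ : ℝ → ℂ} {U : Set ℂ} {F : ℂ → ℂ}

theorem differentiableAt_one_div_sub {σ y : ℂ} (h : σ - y ≠ 0) :
    DifferentiableAt ℂ (fun σ => 1 / (σ - y)) σ :=
  DifferentiableAt.fun_div (by fun_prop) (by fun_prop) h

/-- Dixon's function, the contour integral of the difference quotients of `F`, is holomorphic. -/
theorem IsPositiveContour.differentiableAt_integral_dslope (hγ : IsPositiveContour γ)
    (hU : IsOpen U) (hsub : contourImage γ ⊆ U) (hF : DifferentiableOn ℂ F U) {w : ℂ}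
    (hw : w ∈ U) :
    DifferentiableAt ℂ (fun w => contourIntegral γ (fun σ => dslope F w σ)) w := by
  obtain ⟨r, hr, hball⟩ : ∃ r > 0, Metric.closedBall w (3 * r) ⊆ U := by
    obtain ⟨ε, hε, h⟩ := Metric.nhds_basis_closedBall.mem_iff.1 (hU.mem_nhds hw)
    exact ⟨ε / 3, by positivity, by rwa [mul_div_cancel₀ ε (by norm_num)]⟩
  have hd : ∀ z ∈ U, DifferentiableAt ℂ F z := fun z hz => hF.differentiableAt (hU.mem_nhds hz)
  have hb1 : Metric.ball w r ⊆ Metric.closedBall w (3 * r) := fun z hz => by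
    rw [Metric.mem_ball] at hz; rw [Metric.mem_closedBall]; linarith
  have hb2 : Metric.ball w (2 * r) ⊆ Metric.closedBall w (3 * r) := fun z hz => by
    rw [Metric.mem_ball] at hz; rw [Metric.mem_closedBall]; linarith
  -- the symmetric roles of the two arguments
  have hsymm : ∀ z σ, dslope F z σ = dslope F σ z := by
    intro z σ
    rcases eq_or_ne z σ with rfl | h
    · rfl
    · rw [dslope_of_ne _ h.symm, dslope_of_ne _ h, slope_comm]
  -- a common bound for `F` on the ball and on the contour
  obtain ⟨B, hB0, hB⟩ : ∃ B, 0 ≤ B ∧ ∀ z ∈ contourImage γ ∪ Metric.closedBall w (3 * r),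
      ‖F z‖ ≤ B := by
    have hcomp : IsCompact (contourImage γ ∪ Metric.closedBall w (3 * r)) :=
      hγ.isCompact.union (isCompact_closedBall _ _)
    obtain ⟨B, hB⟩ := hcomp.exists_bound_of_continuousOn
      (hF.continuousOn.mono (Set.union_subset hsub hball))
    exact ⟨max B 0, le_max_right _ _, fun z hz => (hB z hz).trans (le_max_left _ _)⟩
  have hderiv : ∀ z ∈ Metric.ball w (2 * r), ‖deriv F z‖ ≤ B / r := by
    intro z hz
    have hsub' : Metric.closedBall z r ⊆ Metric.closedBall w (3 * r) := by
      intro y hy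
      rw [Metric.mem_closedBall] at hy ⊢
      rw [Metric.mem_ball] at hz
      linarith [dist_triangle y z w]
    refine Complex.norm_deriv_le_of_forall_mem_sphere_norm_le hr ?_ fun y hy =>
      hB y (Or.inr (hsub' (Metric.sphere_subset_closedBall hy)))
    refine DifferentiableOn.diffContOnCl (hF.mono ?_)
    rw [closure_ball _ hr.ne']
    exact hsub'.trans hball
  refine hγ.differentiableAt_integral (g := fun σ w => dslope F w σ) (C := 2 * B / r) hr
    (fun σ hσ => ?_) (fun z hz => ?_) fun σ hσ z hz => ?_
  · have h1 : DifferentiableOn ℂ (dslope F σ) U :=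
      (Complex.differentiableOn_dslope (hU.mem_nhds (hsub hσ))).2 hF
    exact (h1.mono (hb1.trans hball)).congr fun z _ => hsymm z σ
  · have h1 : DifferentiableOn ℂ (dslope F z) U :=
      (Complex.differentiableOn_dslope (hU.mem_nhds (hball (hb1 hz)))).2 hF
    exact h1.continuousOn.mono hsub
  · by_cases hfar : σ ∈ Metric.ball w (2 * r)
    · have hz2 : z ∈ Metric.ball w (2 * r) := Metric.ball_subset_ball (by linarith) hz
      have h2 : B / r ≤ 2 * B / r := by gcongr; linarith
      refine le_trans ?_ h2
      rcases eq_or_ne σ z with rfl | h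
      · rw [dslope_same]; exact hderiv _ hfar
      · rw [dslope_of_ne _ h, slope_def_module, norm_smul, norm_inv]
        have h3 := Convex.norm_image_sub_le_of_norm_deriv_le
          (fun x hx => hd x (hball (hb2 hx))) hderiv (convex_ball w (2 * r)) hz2 hfar
        have h4 : 0 < ‖σ - z‖ := norm_pos_iff.2 (sub_ne_zero.2 h)
        rw [inv_mul_le_iff₀ h4]
        linarith
    · have h5 : r ≤ ‖σ - z‖ := by
        rw [Metric.mem_ball, not_lt] at hfar
        rw [Metric.mem_ball] at hz
        rw [← dist_eq_norm]
        linarith [dist_triangle σ z w]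
      have h : σ ≠ z := by
        rintro rfl
        rw [sub_self, norm_zero] at h5
        linarith
      rw [dslope_of_ne _ h, slope_def_module, smul_eq_mul, mul_comm, ← div_eq_mul_inv, norm_div]
      refine div_le_div₀ (by positivity) ?_ hr h5
      have h6 := hB σ (Or.inl hσ)
      have h7 := hB z (Or.inr (hb1 hz))
      linarith [norm_sub_le (F σ) (F z)]

theorem IsPositiveContour.integral_dslope (hγ : IsPositiveContour γ)
    (hF : ContinuousOn F (contourImage γ)) {w : ℂ} (hw : w ∉ contourImage γ) :
    contourIntegral γ (fun σ => dslope F w σ)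
      = contourIntegral γ (fun σ => F σ / (σ - w))
        - 2 * (Real.pi : ℂ) * Complex.I * winding γ w * F w := by
  have h1 : contourIntegral γ (fun σ => dslope F w σ)
      = contourIntegral γ (fun σ => F σ / (σ - w) - F w * (1 / (σ - w))) := by
    refine contourIntegral_congr fun σ hσ => ?_
    have h : σ ≠ w := fun h => hw (h ▸ hσ)
    have h' := sub_ne_zero.2 h
    rw [dslope_of_ne _ h, slope_def_field]
    field_simp
  have hc := IsPositiveContour.continuousOn_div_sub (γ := γ) (φ := fun _ => (1 : ℂ))
    continuousOn_const hw
  rw [h1, hγ.integral_sub (IsPositiveContour.continuousOn_div_sub hF hw)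
    (ψ := fun σ => F w * (1 / (σ - w))) (continuousOn_const.mul hc), contourIntegral_const_mul]
  unfold winding
  have := Complex.two_pi_I_ne_zero
  field_simp

/-- **Cauchy's formula**, after Dixon: if `F` is holomorphic on a neighbourhood of the contour whose
complement has winding number `0`, then the Cauchy integral of `F` is `2πi · winding · F`. -/
theorem IsPositiveContour.cauchy_interior (hγ : IsPositiveContour γ) (hU : IsOpen U)
    (hsub : contourImage γ ⊆ U) (hext : ∀ z, z ∉ U → z ∈ exteriorRegion γ)
    (hF : DifferentiableOn ℂ F U) {w : ℂ} (hw : w ∉ contourImage γ) :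
    contourIntegral γ (fun σ => F σ / (σ - w))
      = 2 * (Real.pi : ℂ) * Complex.I * winding γ w * F w := by
  classical
  have hFc : ContinuousOn F (contourImage γ) := hF.continuousOn.mono hsub
  set G : ℂ → ℂ := fun w => if w ∈ U then contourIntegral γ (fun σ => dslope F w σ)
    else contourIntegral γ (fun σ => F σ / (σ - w)) with hG
  have hGext : ∀ z ∈ exteriorRegion γ, G z = contourIntegral γ (fun σ => F σ / (σ - z)) := by
    intro z hz
    by_cases h : z ∈ U
    · simp only [hG, h, if_true]
      rw [hγ.integral_dslope hFc hz.1, hz.2]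
      ring
    · simp only [hG, h, if_false]
  have hdiff : Differentiable ℂ G := by
    intro z
    by_cases h : z ∈ U
    · refine (hγ.differentiableAt_integral_dslope hU hsub hF h).congr_of_eventuallyEq ?_
      filter_upwards [hU.mem_nhds h] with y hy
      simp only [hG, hy, if_true]
    · have hz := hext z h
      refine (hγ.differentiableAt_cauchy hFc hz.1).congr_of_eventuallyEq ?_
      filter_upwards [hγ.isOpen_exterior.mem_nhds hz] with y hy
      exact hGext y hy
  have hlim : Tendsto G (cocompact ℂ) (𝓝 0) := by
    refine (hγ.tendsto_cauchy_cocompact hFc).congr' ?_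
    filter_upwards [hγ.eventually_exterior] with y hy
    exact (hGext y hy).symm
  have h0 := hdiff.apply_eq_of_tendsto_cocompact w hlim
  by_cases h : w ∈ U
  · simp only [hG, h, if_true] at h0
    rw [hγ.integral_dslope hFc hw] at h0
    linear_combination h0
  · simp only [hG, h, if_false] at h0
    rw [h0, (hext w h).2]
    ring

/-- **Cauchy's formula for the exterior**: if `F` is holomorphic on a neighbourhood of the contour
whose complement has winding number `1`, and `F → c` at infinity, then the Cauchy integral of `F` at
an exterior point is `2πi (c - F)`. -/
theorem IsPositiveContour.cauchy_exterior (hγ : IsPositiveContour γ) (hU : IsOpen U)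
    (hsub : contourImage γ ⊆ U) (hint : ∀ z, z ∉ U → z ∈ interiorRegion γ)
    (hF : DifferentiableOn ℂ F U) {c : ℂ} (hc : Tendsto F (cocompact ℂ) (𝓝 c)) {w : ℂ}
    (hw : w ∈ exteriorRegion γ) :
    contourIntegral γ (fun σ => F σ / (σ - w))
      = 2 * (Real.pi : ℂ) * Complex.I * (c - F w) := by
  classical
  have hFc : ContinuousOn F (contourImage γ) := hF.continuousOn.mono hsub
  have hextU : ∀ z ∈ exteriorRegion γ, z ∈ U := fun z hz => by
    by_contra h
    exact disjoint_interior_exterior (hint z h) hz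
  set G : ℂ → ℂ := fun w => if w ∈ U then contourIntegral γ (fun σ => dslope F w σ)
      + 2 * (Real.pi : ℂ) * Complex.I * F w
    else contourIntegral γ (fun σ => F σ / (σ - w)) with hG
  have hGint : ∀ z ∈ interiorRegion γ, G z = contourIntegral γ (fun σ => F σ / (σ - z)) := by
    intro z hz
    by_cases h : z ∈ U
    · simp only [hG, h, if_true]
      rw [hγ.integral_dslope hFc hz.1, hz.2]
      ring
    · simp only [hG, h, if_false]
  have hGext : ∀ z ∈ exteriorRegion γ, G z = contourIntegral γ (fun σ => F σ / (σ - z))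
      + 2 * (Real.pi : ℂ) * Complex.I * F z := by
    intro z hz
    simp only [hG, hextU z hz, if_true]
    rw [hγ.integral_dslope hFc hz.1, hz.2]
    ring
  have hdiff : Differentiable ℂ G := by
    intro z
    by_cases h : z ∈ U
    · refine ((hγ.differentiableAt_integral_dslope hU hsub hF h).add
        ((hF.differentiableAt (hU.mem_nhds h)).const_mul
          (2 * (Real.pi : ℂ) * Complex.I))).congr_of_eventuallyEq ?_
      filter_upwards [hU.mem_nhds h] with y hy
      simp only [hG, hy, if_true]
      rfl
    · have hz := hint z h
      refine (hγ.differentiableAt_cauchy hFc hz.1).congr_of_eventuallyEq ?_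
      filter_upwards [hγ.isOpen_interior.mem_nhds hz] with y hy
      exact hGint y hy
  have hlim : Tendsto G (cocompact ℂ) (𝓝 (2 * (Real.pi : ℂ) * Complex.I * c)) := by
    have := (hγ.tendsto_cauchy_cocompact hFc).add
      (hc.const_mul (2 * (Real.pi : ℂ) * Complex.I))
    rw [zero_add] at this
    refine this.congr' ?_
    filter_upwards [hγ.eventually_exterior] with y hy
    exact (hGext y hy).symm
  have h0 := hdiff.apply_eq_of_tendsto_cocompact w hlim
  rw [hGext w hw] at h0
  linear_combination h0

/-- Removing simple poles: `f / g` is the sum of its principal parts and a holomorphic function. -/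
theorem exists_differentiableOn_div (hU : IsOpen U) {f g : ℂ → ℂ} (hf : DifferentiableOn ℂ f U)
    (hg : DifferentiableOn ℂ g U) (Z : Finset ℂ) (hZU : ∀ z ∈ Z, z ∈ U)
    (hZ : ∀ z ∈ U, g z = 0 ↔ z ∈ Z) (hsimple : ∀ z ∈ Z, deriv g z ≠ 0) :
    ∃ G : ℂ → ℂ, DifferentiableOn ℂ G U ∧ ∀ σ ∈ U, σ ∉ Z →
      f σ / g σ = G σ + ∑ z ∈ Z, f z / deriv g z * (1 / (σ - z)) := by
  classical
  -- near a zero `z` of `g`, the function `f / g` has the form `h σ / (σ - z)`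
  have hloc : ∀ z ∈ Z, ∃ k : ℂ → ℂ, DifferentiableAt ℂ k z ∧
      ∀ᶠ σ in 𝓝[≠] z, f σ / g σ - ∑ z ∈ Z, f z / deriv g z * (1 / (σ - z)) = k σ := by
    intro z hz
    have hzU := hU.mem_nhds (hZU z hz)
    have hgz : g z = 0 := (hZ z (hZU z hz)).2 hz
    set a := dslope g z with ha
    have had : DifferentiableOn ℂ a U := (Complex.differentiableOn_dslope hzU).2 hg
    have haz : a z ≠ 0 := by rw [ha, dslope_same]; exact hsimple z hz
    have hacont : ContinuousAt a z := (had.differentiableAt hzU).continuousAt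
    obtain ⟨V, hVsub, hVo, hzV⟩ := mem_nhds_iff.1
      (Filter.inter_mem hzU (hacont.eventually_ne haz))
    have hh : DifferentiableOn ℂ (fun σ => f σ / a σ) V :=
      (hf.mono fun σ hσ => (hVsub hσ).1).div (had.mono fun σ hσ => (hVsub hσ).1)
        fun σ hσ => (hVsub hσ).2
    have hk := (Complex.differentiableOn_dslope (hVo.mem_nhds hzV)).2 hh
    refine ⟨fun σ => dslope (fun σ => f σ / a σ) z σ
      - ∑ y ∈ Z.erase z, f y / deriv g y * (1 / (σ - y)), ?_, ?_⟩
    · refine (hk.differentiableAt (hVo.mem_nhds hzV)).fun_sub ?_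
      refine DifferentiableAt.fun_sum fun y hy => ?_
      have hne : z - y ≠ 0 := sub_ne_zero.2 (Finset.ne_of_mem_erase hy).symm
      exact (differentiableAt_one_div_sub hne).const_mul _
    · filter_upwards [self_mem_nhdsWithin, nhdsWithin_le_nhds (hVo.mem_nhds hzV)] with σ hσ hσV
      have hne : σ ≠ z := hσ
      have hsub' := sub_ne_zero.2 hne
      have haσ : a σ = g σ / (σ - z) := by
        rw [ha, dslope_of_ne _ hne, slope_def_field, hgz, sub_zero]
      have haσ0 : a σ ≠ 0 := (hVsub hσV).2
      have hgσ : g σ ≠ 0 := by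
        intro h0
        rw [haσ, h0, zero_div] at haσ0
        exact haσ0 rfl
      have haz' : a z = deriv g z := by rw [ha, dslope_same]
      have hdz := hsimple z hz
      rw [← Finset.add_sum_erase Z _ hz, dslope_of_ne _ hne, slope_def_field, haσ, haz']
      field_simp
      ring
  choose! k hkd hke using hloc
  set g0 : ℂ → ℂ := fun σ => f σ / g σ - ∑ z ∈ Z, f z / deriv g z * (1 / (σ - z)) with hg0
  refine ⟨fun σ => if σ ∈ Z then k σ σ else g0 σ, fun σ hσ => ?_, fun σ hσ hσZ => ?_⟩
  · refine DifferentiableAt.differentiableWithinAt ?_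
    by_cases h : σ ∈ Z
    · refine (hkd σ h).congr_of_eventuallyEq ?_
      have h1 := hke σ h
      rw [eventually_nhdsWithin_iff] at h1
      have h2 : ∀ᶠ y in 𝓝 σ, y ∉ Z.erase σ :=
        (Z.erase σ).finite_toSet.isClosed.isOpen_compl.mem_nhds (by simp)
      filter_upwards [h1, h2] with y hy hy2
      by_cases hyσ : y = σ
      · subst hyσ; simp [h]
      · have : y ∉ Z := fun hyZ => hy2 (Finset.mem_erase.2 ⟨hyσ, hyZ⟩)
        simp only [this, if_false]
        exact hy hyσ
    · have hgσ : g σ ≠ 0 := fun h0 => h ((hZ σ hσ).1 h0)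
      have hd : DifferentiableAt ℂ g0 σ := by
        refine ((hf.differentiableAt (hU.mem_nhds hσ)).fun_div
          (hg.differentiableAt (hU.mem_nhds hσ)) hgσ).fun_sub ?_
        refine DifferentiableAt.fun_sum fun y hy => ?_
        have hne : σ - y ≠ 0 := sub_ne_zero.2 fun h' => h (h' ▸ hy)
        exact (differentiableAt_one_div_sub hne).const_mul _
      refine hd.congr_of_eventuallyEq ?_
      filter_upwards [Z.finite_toSet.isClosed.isOpen_compl.mem_nhds h] with y hy
      have hy' : y ∉ Z := hy
      simp only [hy', if_false]
  · simp only [hσZ, if_false, hg0]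
    ring

end Dixon

open MeasureTheory

/-! ### The singular integral equation -/

/-- Fubini's theorem for the kernel `1/(s + σ)`. -/
theorem IsPositiveContour.integral_swap {γ : ℝ → ℂ} (hγ : IsPositiveContour γ)
    (hsum : ∀ s ∈ contourImage γ, ∀ σ ∈ contourImage γ, s + σ ≠ 0) {a b : ℂ → ℂ}
    (ha : ContinuousOn a (contourImage γ)) (hb : ContinuousOn b (contourImage γ)) :
    contourIntegral γ (fun s => a s * contourIntegral γ (fun σ => b σ / (s + σ)))
      = contourIntegral γ (fun σ => b σ * contourIntegral γ (fun s => a s / (σ + s))) := by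
  set ν := volume.restrict (Set.Ioc (0 : ℝ) 1) with hν
  have hcl : ∀ {c : ℂ → ℂ}, ContinuousOn c (contourImage γ) →
      Integrable (fun t => c (γ t) * deriv γ t) ν := fun hc => by
    have := intervalIntegrable_iff.1 (hγ.intervalIntegrable hc)
    rwa [Set.uIoc_of_le zero_le_one] at this
  have hmeas : AEStronglyMeasurable (fun x : ℝ × ℝ => (γ x.1 + γ x.2)⁻¹) (ν.prod ν) := by
    rw [hν, Measure.prod_restrict]
    refine ContinuousOn.aestronglyMeasurable ?_ (measurableSet_Ioc.prod measurableSet_Ioc)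
    have hc := hγ.continuousOn.mono Set.Ioc_subset_Icc_self
    refine ContinuousOn.inv₀ ((hc.comp continuousOn_fst fun x hx => hx.1).add
      (hc.comp continuousOn_snd fun x hx => hx.2)) fun x hx => ?_
    exact hsum _ ⟨x.1, Set.Ioc_subset_Icc_self hx.1, rfl⟩ _ ⟨x.2, Set.Ioc_subset_Icc_self hx.2, rfl⟩
  obtain ⟨C, hC⟩ : ∃ C, ∀ s ∈ contourImage γ, ∀ σ ∈ contourImage γ, ‖(s + σ)⁻¹‖ ≤ C := by
    have hcomp := hγ.isCompact.prod hγ.isCompact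
    obtain ⟨C, hC⟩ := hcomp.exists_bound_of_continuousOn (f := fun x : ℂ × ℂ => (x.1 + x.2)⁻¹)
      (ContinuousOn.inv₀ (by fun_prop) fun x hx => hsum _ hx.1 _ hx.2)
    exact ⟨C, fun s hs σ hσ => hC (s, σ) ⟨hs, hσ⟩⟩
  have hint : Integrable (Function.uncurry fun s t : ℝ =>
      (γ s + γ t)⁻¹ * ((a (γ s) * deriv γ s) * (b (γ t) * deriv γ t))) (ν.prod ν) := by
    refine Integrable.bdd_mul (c := C) ((hcl ha).mul_prod (hcl hb)) hmeas ?_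
    rw [hν, Measure.prod_restrict, ae_restrict_iff' (measurableSet_Ioc.prod measurableSet_Ioc)]
    exact Eventually.of_forall fun x hx =>
      hC _ ⟨x.1, Set.Ioc_subset_Icc_self hx.1, rfl⟩ _ ⟨x.2, Set.Ioc_subset_Icc_self hx.2, rfl⟩
  have hswap := integral_integral_swap hint
  unfold contourIntegral
  simp only [intervalIntegral.integral_of_le zero_le_one, ← hν]
  have e1 : ∀ s : ℝ, (a (γ s) * ∫ t, b (γ t) / (γ s + γ t) * deriv γ t ∂ν) * deriv γ s
      = ∫ t, (γ s + γ t)⁻¹ * ((a (γ s) * deriv γ s) * (b (γ t) * deriv γ t)) ∂ν := fun s => by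
    rw [mul_right_comm, ← integral_const_mul]
    refine integral_congr_ae (Eventually.of_forall fun t => ?_)
    simp only [div_eq_mul_inv]
    ring
  have e2 : ∀ t : ℝ, (b (γ t) * ∫ s, a (γ s) / (γ t + γ s) * deriv γ s ∂ν) * deriv γ t
      = ∫ s, (γ s + γ t)⁻¹ * ((a (γ s) * deriv γ s) * (b (γ t) * deriv γ t)) ∂ν := fun t => by
    rw [mul_right_comm, ← integral_const_mul]
    refine integral_congr_ae (Eventually.of_forall fun s => ?_)
    simp only [div_eq_mul_inv, add_comm (γ t)]
    ring
  simp only [e1, e2]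
  exact hswap

theorem prod_zpow_add_single {N : ℕ} {x : Fin N → ℂ} {k : Fin N} (hk : x k ≠ 0)
    (n : Fin N → ℤ) : ∏ r, x r ^ (n + e k) r = (∏ r, x r ^ n r) * x k := by
  have h : ∀ r, x r ^ (n + e k) r = x r ^ n r * if r = k then x k else 1 := by
    intro r
    by_cases hr : r = k
    · subst hr
      simp [e, zpow_add₀ hk]
    · simp [e, hr]
  simp only [h, Finset.prod_mul_distrib, Finset.prod_ite_eq', Finset.mem_univ, if_true]

namespace Setup

variable {N : ℕ} {D : Setup N}

/-- What the singular integral equation needs of the scattering data: an admissible contour, a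
reflection coefficient continuous on it, and finitely many discrete eigenvalues. -/
structure InverseData (D : Setup N) : Prop where
  valid : D.ValidContour
  continuousOn_R : ContinuousOn D.R (contourImage D.γ)
  finite_zeros : D.zeros.Finite

/-- The linear functional of the singular integral equation: integration against the scattering
data at the lattice point `n`. The equation reads `f(ζ) = 1 + ⟨f / (· + ζ)⟩`. -/
def pairing (D : Setup N) (n : Fin N → ℤ) (φ : ℂ → ℂ) : ℂ :=
  1 / (2 * (Real.pi : ℂ) * Complex.I) * contourIntegral D.γ (fun σ => D.R σ * D.ρ n σ * φ σ)
    - ∑ᶠ z ∈ D.zeros, D.resC z * D.ρ n z * φ z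

/-- The support of the scattering data: the contour and the zeros of `A`. -/
def support (D : Setup N) : Set ℂ := contourImage D.γ ∪ D.zeros

/-- `F` solves the singular integral equation with inhomogeneity `α ζ + β` at `n`. -/
def SolvesAffine (D : Setup N) (n : Fin N → ℤ) (α β : ℂ) (F : ℂ → ℂ) : Prop :=
  ContinuousOn F (contourImage D.γ) ∧
    ∀ ζ ∈ D.jostDomain, F ζ = α * ζ + β + D.pairing n (fun σ => F σ / (σ + ζ))

theorem solvesAt_iff {n : Fin N → ℤ} {f : ℂ → ℂ} : D.SolvesAt n f ↔ D.SolvesAffine n 0 1 f := by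
  unfold SolvesAt SolvesAffine
  refine and_congr_right fun _ => forall₂_congr fun ζ _ => ?_
  have e1 : contourIntegral D.γ (fun σ => D.R σ * f σ / (σ + ζ) * D.ρ n σ)
      = contourIntegral D.γ (fun σ => D.R σ * D.ρ n σ * (f σ / (σ + ζ))) :=
    contourIntegral_congr fun σ _ => by ring
  have e2 : ∑ᶠ z ∈ D.zeros, D.resC z * f z / (ζ + z) * D.ρ n z
      = ∑ᶠ z ∈ D.zeros, D.resC z * D.ρ n z * (f z / (z + ζ)) :=
    finsum_mem_congr rfl fun z _ => by rw [add_comm ζ z]; ring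
  rw [e1, e2]
  unfold pairing
  constructor <;> intro h <;> rw [h] <;> ring

theorem pairing_congr {n : Fin N → ℤ} {φ ψ : ℂ → ℂ} (h : ∀ σ ∈ D.support, φ σ = ψ σ) :
    D.pairing n φ = D.pairing n ψ := by
  unfold pairing
  congr 1
  · congr 1
    exact contourIntegral_congr fun σ hσ => by rw [h σ (Or.inl hσ)]
  · exact finsum_mem_congr rfl fun z hz => by rw [h z (Or.inr hz)]

theorem ρ_add_single {n : Fin N → ℤ} {k : Fin N} {ζ : ℂ} (h1 : D.p k + ζ ≠ 0)
    (h2 : D.p k - ζ ≠ 0) :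
    D.ρ (n + e k) ζ = D.ρ n ζ * ((D.p k + ζ) / (D.p k - ζ)) :=
  prod_zpow_add_single (x := fun r => (D.p r + ζ) / (D.p r - ζ)) (div_ne_zero h1 h2) n

theorem pairing_const_mul (n : Fin N → ℤ) (c : ℂ) (φ : ℂ → ℂ) :
    D.pairing n (fun σ => c * φ σ) = c * D.pairing n φ := by
  unfold pairing
  have e1 : contourIntegral D.γ (fun σ => D.R σ * D.ρ n σ * (c * φ σ))
      = c * contourIntegral D.γ (fun σ => D.R σ * D.ρ n σ * φ σ) := by
    rw [← contourIntegral_const_mul]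
    exact contourIntegral_congr fun σ _ => by ring
  have e2 : ∑ᶠ z ∈ D.zeros, D.resC z * D.ρ n z * (c * φ z)
      = c * ∑ᶠ z ∈ D.zeros, D.resC z * D.ρ n z * φ z := by
    rw [mul_finsum_mem]
    exact finsum_mem_congr rfl fun z _ => by ring
  rw [e1, e2]
  ring

namespace InverseData

theorem support_subset (h : D.InverseData) {σ : ℂ} (hσ : σ ∈ D.support) :
    σ ∈ contourImage D.γ ∪ interiorRegion D.γ :=
  hσ.imp id fun hz => h.valid.zeros_inside hz

theorem mem_domain (h : D.InverseData) {σ : ℂ} (hσ : σ ∈ D.support) : σ ∈ D.jostDomain :=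
  h.valid.reflected_outside σ (h.support_subset hσ)

theorem add_ne_zero (h : D.InverseData) {σ ζ : ℂ} (hσ : σ ∈ D.support)
    (hζ : ζ ∈ D.jostDomain) : σ + ζ ≠ 0 := by
  intro h0
  have hζ' : σ ∈ exteriorRegion D.γ := by
    have : σ = -ζ := eq_neg_of_add_eq_zero_left h0
    rw [this]; exact hζ
  rcases h.support_subset hσ with h1 | h1
  · exact hζ'.1 h1
  · exact disjoint_interior_exterior h1 hζ'

theorem isOpen_domain (h : D.InverseData) : IsOpen D.jostDomain :=
  h.valid.contour.isOpen_exterior.preimage continuous_neg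

theorem p_add_ne_zero (h : D.InverseData) (k : Fin N) {σ : ℂ} (hσ : σ ∈ D.support) :
    D.p k + σ ≠ 0 := fun h0 =>
  (h.valid.param_off k σ hσ).2 (by linear_combination h0)

theorem p_sub_ne_zero (h : D.InverseData) (k : Fin N) {σ : ℂ} (hσ : σ ∈ D.support) :
    D.p k - σ ≠ 0 := fun h0 =>
  (h.valid.param_off k σ hσ).1 (by linear_combination -h0)

theorem continuousOn_weight (h : D.InverseData) (n : Fin N → ℤ) :
    ContinuousOn (fun σ => D.R σ * D.ρ n σ) (contourImage D.γ) := by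
  refine h.continuousOn_R.mul ?_
  unfold ρ
  refine continuousOn_finsetProd _ fun r _ => ?_
  refine ContinuousOn.zpow₀ (ContinuousOn.div (by fun_prop) (by fun_prop) fun σ hσ =>
    h.p_sub_ne_zero r (Or.inl hσ)) _ fun σ hσ => Or.inl (div_ne_zero
      (h.p_add_ne_zero r (Or.inl hσ)) (h.p_sub_ne_zero r (Or.inl hσ)))

theorem continuousOn_weight_mul (h : D.InverseData) (n : Fin N → ℤ) {φ : ℂ → ℂ}
    (hφ : ContinuousOn φ (contourImage D.γ)) :
    ContinuousOn (fun σ => D.R σ * D.ρ n σ * φ σ) (contourImage D.γ) :=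
  (h.continuousOn_weight n).mul hφ

theorem pairing_eq_sum (h : D.InverseData) (n : Fin N → ℤ) (φ : ℂ → ℂ) :
    D.pairing n φ = 1 / (2 * (Real.pi : ℂ) * Complex.I) *
        contourIntegral D.γ (fun σ => D.R σ * D.ρ n σ * φ σ)
      - ∑ z ∈ h.finite_zeros.toFinset, D.resC z * D.ρ n z * φ z := by
  unfold pairing
  rw [finsum_mem_eq_finite_toFinset_sum _ h.finite_zeros]

theorem pairing_add (h : D.InverseData) (n : Fin N → ℤ) {φ ψ : ℂ → ℂ}
    (hφ : ContinuousOn φ (contourImage D.γ)) (hψ : ContinuousOn ψ (contourImage D.γ)) :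
    D.pairing n (fun σ => φ σ + ψ σ) = D.pairing n φ + D.pairing n ψ := by
  rw [h.pairing_eq_sum, h.pairing_eq_sum, h.pairing_eq_sum]
  simp only [mul_add]
  rw [h.valid.contour.integral_add (h.continuousOn_weight_mul n hφ)
    (h.continuousOn_weight_mul n hψ), Finset.sum_add_distrib]
  ring

theorem pairing_sub (h : D.InverseData) (n : Fin N → ℤ) {φ ψ : ℂ → ℂ}
    (hφ : ContinuousOn φ (contourImage D.γ)) (hψ : ContinuousOn ψ (contourImage D.γ)) :
    D.pairing n (fun σ => φ σ - ψ σ) = D.pairing n φ - D.pairing n ψ := by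
  rw [h.pairing_eq_sum, h.pairing_eq_sum, h.pairing_eq_sum]
  simp only [mul_sub]
  rw [h.valid.contour.integral_sub (h.continuousOn_weight_mul n hφ)
    (h.continuousOn_weight_mul n hψ), Finset.sum_sub_distrib]
  ring

theorem continuousOn_div_add (h : D.InverseData) {φ : ℂ → ℂ}
    (hφ : ContinuousOn φ (contourImage D.γ)) {ζ : ℂ} (hζ : ζ ∈ D.jostDomain) :
    ContinuousOn (fun σ => φ σ / (σ + ζ)) (contourImage D.γ) :=
  hφ.div (by fun_prop) fun _ hσ => h.add_ne_zero (Or.inl hσ) hζ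

theorem differentiableAt_pairing (h : D.InverseData) (n : Fin N → ℤ) {φ : ℂ → ℂ}
    (hφ : ContinuousOn φ (contourImage D.γ)) {ζ : ℂ} (hζ : ζ ∈ D.jostDomain) :
    DifferentiableAt ℂ (fun ζ => D.pairing n (fun σ => φ σ / (σ + ζ))) ζ := by
  simp only [h.pairing_eq_sum]
  refine DifferentiableAt.fun_sub (DifferentiableAt.const_mul ?_ _) ?_
  · have h1 := h.valid.contour.differentiableAt_cauchy ((h.continuousOn_weight n).mul hφ) hζ.1
    have h2 := h1.comp ζ (differentiableAt_id.neg)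
    refine h2.congr_of_eventuallyEq (Eventually.of_forall fun w => ?_)
    change contourIntegral D.γ (fun σ => D.R σ * D.ρ n σ * (φ σ / (σ + w)))
      = contourIntegral D.γ (fun σ => D.R σ * D.ρ n σ * φ σ / (σ - -w))
    exact contourIntegral_congr fun σ _ => by rw [sub_neg_eq_add, mul_div_assoc]
  · refine DifferentiableAt.fun_sum fun z hz => DifferentiableAt.const_mul ?_ _
    have hz' : z ∈ D.support := Or.inr (h.finite_zeros.mem_toFinset.1 hz)
    exact DifferentiableAt.fun_div (by fun_prop) (by fun_prop) (h.add_ne_zero hz' hζ)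

theorem continuousOn_pairing (h : D.InverseData) (n : Fin N → ℤ) {φ : ℂ → ℂ}
    (hφ : ContinuousOn φ (contourImage D.γ)) :
    ContinuousOn (fun ζ => D.pairing n (fun σ => φ σ / (σ + ζ))) D.jostDomain :=
  fun _ hζ => (h.differentiableAt_pairing n hφ hζ).continuousAt.continuousWithinAt

theorem continuousOn_pairing_contour (h : D.InverseData) (n : Fin N → ℤ) {φ : ℂ → ℂ}
    (hφ : ContinuousOn φ (contourImage D.γ)) :
    ContinuousOn (fun ζ => D.pairing n (fun σ => φ σ / (σ + ζ))) (contourImage D.γ) :=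
  (h.continuousOn_pairing n hφ).mono fun _ hσ => h.mem_domain (Or.inl hσ)

/-- The kernel `1/(s + σ)` is symmetric under the pairing. -/
theorem pairing_swap (h : D.InverseData) (n : Fin N → ℤ) {φ ψ : ℂ → ℂ}
    (hφ : ContinuousOn φ (contourImage D.γ)) (hψ : ContinuousOn ψ (contourImage D.γ)) :
    D.pairing n (fun s => φ s * D.pairing n (fun σ => ψ σ / (σ + s)))
      = D.pairing n (fun σ => ψ σ * D.pairing n (fun s => φ s / (s + σ))) := by
  have hγ := h.valid.contour
  have hw := h.continuousOn_weight n
  set w : ℂ → ℂ := fun σ => D.R σ * D.ρ n σ with hwdef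
  set m : ℂ → ℂ := fun z => D.resC z * D.ρ n z with hm
  set c : ℂ := 1 / (2 * (Real.pi : ℂ) * Complex.I) with hc
  set Z := h.finite_zeros.toFinset with hZ
  have hZs : ∀ z ∈ Z, z ∈ D.support := fun z hz => Or.inr (h.finite_zeros.mem_toFinset.1 hz)
  -- one half of the computation, symmetric in `φ` and `ψ` up to Fubini
  have key : ∀ {φ ψ : ℂ → ℂ}, ContinuousOn φ (contourImage D.γ) →
      ContinuousOn ψ (contourImage D.γ) →
      D.pairing n (fun s => φ s * D.pairing n (fun σ => ψ σ / (σ + s)))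
        = c * c * contourIntegral D.γ (fun s => (w s * φ s) *
            contourIntegral D.γ (fun σ => (w σ * ψ σ) / (s + σ)))
          - c * ∑ z ∈ Z, m z * ψ z * contourIntegral D.γ (fun s => w s * φ s / (s + z))
          - c * ∑ y ∈ Z, m y * φ y * contourIntegral D.γ (fun σ => w σ * ψ σ / (σ + y))
          + ∑ y ∈ Z, ∑ z ∈ Z, m y * φ y * (m z * ψ z) / (y + z) := by
    intro φ ψ hφ hψ
    have hinner : ∀ s, D.pairing n (fun σ => ψ σ / (σ + s))
        = c * contourIntegral D.γ (fun σ => (w σ * ψ σ) / (s + σ))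
          - ∑ z ∈ Z, m z * ψ z * (1 / (s + z)) := by
      intro s
      rw [h.pairing_eq_sum]
      congr 1
      · congr 1
        exact contourIntegral_congr fun σ _ => by rw [add_comm s σ, mul_div_assoc]
      · exact Finset.sum_congr rfl fun z _ => by rw [add_comm s z]; simp only [hm]; ring
    have hI : ContinuousOn (fun s => contourIntegral D.γ (fun σ => (w σ * ψ σ) / (s + σ)))
        (contourImage D.γ) := by
      intro s hs
      have h1 := hγ.differentiableAt_cauchy (hw.mul hψ) (h.mem_domain (Or.inl hs)).1
      have h2 := (h1.comp s (differentiableAt_id.neg)).continuousAt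
      refine (h2.congr (Eventually.of_forall fun x => ?_)).continuousWithinAt
      change contourIntegral D.γ (fun σ => w σ * ψ σ / (σ - -x))
        = contourIntegral D.γ (fun σ => w σ * ψ σ / (x + σ))
      exact contourIntegral_congr fun σ _ => by rw [sub_neg_eq_add, add_comm x σ]
    have hpole : ∀ z ∈ Z, ContinuousOn (fun s => 1 / (s + z)) (contourImage D.γ) := fun z hz =>
      continuousOn_const.div (by fun_prop) fun s hs =>
        h.add_ne_zero (Or.inl hs) (h.mem_domain (hZs z hz))
    rw [h.pairing_eq_sum]
    have e1 : contourIntegral D.γ (fun s => D.R s * D.ρ n s *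
          (φ s * D.pairing n (fun σ => ψ σ / (σ + s))))
        = c * contourIntegral D.γ (fun s => (w s * φ s) *
            contourIntegral D.γ (fun σ => (w σ * ψ σ) / (s + σ)))
          - ∑ z ∈ Z, m z * ψ z * contourIntegral D.γ (fun s => w s * φ s / (s + z)) := by
      have e2 : contourIntegral D.γ (fun s => D.R s * D.ρ n s *
          (φ s * D.pairing n (fun σ => ψ σ / (σ + s))))
          = contourIntegral D.γ (fun s => c * ((w s * φ s) *
            contourIntegral D.γ (fun σ => (w σ * ψ σ) / (s + σ)))
            - ∑ z ∈ Z, m z * ψ z * (w s * φ s * (1 / (s + z)))) := by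
        refine contourIntegral_congr fun s _ => ?_
        rw [hinner s, mul_sub, Finset.mul_sum, mul_sub, Finset.mul_sum]
        congr 1
        · simp only [hwdef]; ring
        · exact Finset.sum_congr rfl fun z _ => by simp only [hwdef]; ring
      rw [e2, hγ.integral_sub
        (φ := fun s => c * ((w s * φ s) *
            contourIntegral D.γ (fun σ => (w σ * ψ σ) / (s + σ))))
        (ψ := fun s => ∑ z ∈ Z, m z * ψ z * (w s * φ s * (1 / (s + z))))
        (continuousOn_const.mul ((hw.mul hφ).mul hI))
        (continuousOn_finsetSum _ fun z hz => continuousOn_const.mul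
          ((hw.mul hφ).mul (hpole z hz))), contourIntegral_const_mul,
        hγ.integral_finset_sum Z
          (φ := fun z s => m z * ψ z * (w s * φ s * (1 / (s + z)))) fun z hz =>
          continuousOn_const.mul ((hw.mul hφ).mul (hpole z hz))]
      congr 1
      refine Finset.sum_congr rfl fun z _ => ?_
      rw [contourIntegral_const_mul]
      simp only [mul_one_div]
    rw [e1]
    have e3 : ∑ y ∈ Z, D.resC y * D.ρ n y * (φ y * D.pairing n (fun σ => ψ σ / (σ + y)))
        = c * ∑ y ∈ Z, m y * φ y * contourIntegral D.γ (fun σ => w σ * ψ σ / (σ + y))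
          - ∑ y ∈ Z, ∑ z ∈ Z, m y * φ y * (m z * ψ z) / (y + z) := by
      rw [Finset.mul_sum, ← Finset.sum_sub_distrib]
      refine Finset.sum_congr rfl fun y _ => ?_
      rw [hinner y, mul_sub, mul_sub, Finset.mul_sum, Finset.mul_sum]
      congr 1
      · simp only [hm, add_comm y]; ring
      · exact Finset.sum_congr rfl fun z _ => by simp only [hm]; ring
    rw [e3]
    ring
  rw [key hφ hψ, key hψ hφ, hγ.integral_swap
    (a := fun σ => w σ * φ σ) (b := fun σ => w σ * ψ σ)
    (fun s hs σ hσ => h.add_ne_zero (Or.inl hs) (h.mem_domain (Or.inl hσ)))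
    (h.continuousOn_weight_mul n hφ) (h.continuousOn_weight_mul n hψ)]
  have hsum : ∑ y ∈ Z, ∑ z ∈ Z, m y * φ y * (m z * ψ z) / (y + z)
      = ∑ y ∈ Z, ∑ z ∈ Z, m y * ψ y * (m z * φ z) / (y + z) := by
    rw [Finset.sum_comm]
    exact Finset.sum_congr rfl fun y _ => Finset.sum_congr rfl fun z _ => by
      rw [add_comm]; ring
  rw [hsum]
  ring

end InverseData

end Setup

namespace Setup

variable {N : ℕ} {D : Setup N}

/-! ### Algebra of the singular integral equation -/

namespace InverseData

variable {n : Fin N → ℤ} {α β α' β' : ℂ} {F G : ℂ → ℂ}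

theorem solvesAffine_add (h : D.InverseData) (hF : D.SolvesAffine n α β F)
    (hG : D.SolvesAffine n α' β' G) :
    D.SolvesAffine n (α + α') (β + β') (fun ζ => F ζ + G ζ) := by
  refine ⟨hF.1.fun_add hG.1, fun ζ hζ => ?_⟩
  have e : D.pairing n (fun σ => (F σ + G σ) / (σ + ζ))
      = D.pairing n (fun σ => F σ / (σ + ζ)) + D.pairing n (fun σ => G σ / (σ + ζ)) := by
    rw [← h.pairing_add n (h.continuousOn_div_add hF.1 hζ) (h.continuousOn_div_add hG.1 hζ)]
    exact pairing_congr fun σ _ => add_div _ _ _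
  beta_reduce
  rw [e, hF.2 ζ hζ, hG.2 ζ hζ]
  ring

theorem solvesAffine_const_mul (c : ℂ) (hF : D.SolvesAffine n α β F) :
    D.SolvesAffine n (c * α) (c * β) (fun ζ => c * F ζ) := by
  refine ⟨continuousOn_const.fun_mul hF.1, fun ζ hζ => ?_⟩
  have e : D.pairing n (fun σ => c * F σ / (σ + ζ)) = c * D.pairing n (fun σ => F σ / (σ + ζ)) := by
    rw [← pairing_const_mul]
    exact pairing_congr fun σ _ => mul_div_assoc _ _ _
  beta_reduce
  rw [e, hF.2 ζ hζ]
  ring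

theorem solvesAffine_sub (h : D.InverseData) (hF : D.SolvesAffine n α β F)
    (hG : D.SolvesAffine n α' β' G) :
    D.SolvesAffine n (α - α') (β - β') (fun ζ => F ζ - G ζ) := by
  have := h.solvesAffine_add hF (solvesAffine_const_mul (-1) hG)
  convert this using 1 <;> first | (funext ζ; ring) | ring

/-- The Wronskian identity. The bracket is the value at `-w` of the right-hand side of the
equation, even if `-w` is not in the domain of the solutions. -/
theorem wronskian (h : D.InverseData) (hF : D.SolvesAffine n α β F)
    (hG : D.SolvesAffine n α' β' G) {w : ℂ} (hw : w ∈ D.jostDomain) (hwE : w ∉ D.support) :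
    (-α * w + β + D.pairing n (fun σ => F σ / (σ - w))) * G w
      - F w * (-α' * w + β' + D.pairing n (fun σ => G σ / (σ - w)))
      = 2 * w * (α' * β - α * β') := by
  have hwL : w ∉ contourImage D.γ := fun h' => hwE (Or.inl h')
  -- difference quotients of a solution, as integrals of `1 / ((s + σ) (s + w))`
  have hquot : ∀ {F : ℂ → ℂ} {α β : ℂ}, D.SolvesAffine n α β F → ∀ σ ∈ D.support,
      F σ - F w = (σ - w) * (α - D.pairing n (fun s => F s / (s + w) / (s + σ))) := by
    intro F α β hF σ hσ
    have hσ' := h.mem_domain hσ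
    have hc := h.continuousOn_div_add (h.continuousOn_div_add hF.1 hw) hσ'
    have e : D.pairing n (fun s => F s / (s + σ))
        = D.pairing n (fun s => F s / (s + w)) - (σ - w) *
          D.pairing n (fun s => F s / (s + w) / (s + σ)) := by
      rw [← pairing_const_mul, ← h.pairing_sub n (h.continuousOn_div_add hF.1 hw)
        (continuousOn_const.fun_mul hc)]
      refine pairing_congr fun s hs => ?_
      have h1 := h.add_ne_zero hs hw
      have h2 := h.add_ne_zero hs hσ'
      field_simp
      ring
    rw [hF.2 σ hσ', hF.2 w hw, e]
    ring
  have hFw := h.continuousOn_div_add hF.1 hw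
  have hGw := h.continuousOn_div_add hG.1 hw
  have hKF := h.continuousOn_pairing_contour n hFw
  have hKG := h.continuousOn_pairing_contour n hGw
  have hdF := IsPositiveContour.continuousOn_div_sub hF.1 hwL
  have hdG := IsPositiveContour.continuousOn_div_sub hG.1 hwL
  have e1 : G w * D.pairing n (fun σ => F σ / (σ - w)) - F w * D.pairing n (fun σ => G σ / (σ - w))
      = (α * D.pairing n G - D.pairing n (fun σ => G σ *
          D.pairing n (fun s => F s / (s + w) / (s + σ))))
        - (α' * D.pairing n F - D.pairing n (fun σ => F σ *
          D.pairing n (fun s => G s / (s + w) / (s + σ)))) := by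
    rw [← pairing_const_mul, ← pairing_const_mul, ← pairing_const_mul, ← pairing_const_mul,
      ← h.pairing_sub n (continuousOn_const.fun_mul hdF) (continuousOn_const.fun_mul hdG),
      ← h.pairing_sub n (continuousOn_const.fun_mul hG.1) (hG.1.fun_mul hKF),
      ← h.pairing_sub n (continuousOn_const.fun_mul hF.1) (hF.1.fun_mul hKG),
      ← h.pairing_sub n ((continuousOn_const.fun_mul hG.1).fun_sub (hG.1.fun_mul hKF))
        ((continuousOn_const.fun_mul hF.1).fun_sub (hF.1.fun_mul hKG))]
    refine pairing_congr fun σ hσ => ?_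
    have hne : σ - w ≠ 0 := sub_ne_zero.2 fun h' => hwE (h' ▸ hσ)
    have qF := hquot hF σ hσ
    have qG := hquot hG σ hσ
    generalize D.pairing n (fun s => F s / (s + w) / (s + σ)) = kF at qF ⊢
    generalize D.pairing n (fun s => G s / (s + w) / (s + σ)) = kG at qG ⊢
    field_simp
    linear_combination G σ * qF - F σ * qG
  have sF : D.pairing n (fun σ => G σ * D.pairing n (fun s => F s / (s + w) / (s + σ)))
      = D.pairing n (fun s => F s / (s + w) * (G s - α' * s - β')) := by
    rw [h.pairing_swap n hG.1 hFw]
    refine pairing_congr fun s hs => ?_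
    rw [hG.2 s (h.mem_domain hs)]
    ring
  have sG : D.pairing n (fun σ => F σ * D.pairing n (fun s => G s / (s + w) / (s + σ)))
      = D.pairing n (fun s => G s / (s + w) * (F s - α * s - β)) := by
    rw [h.pairing_swap n hF.1 hGw]
    refine pairing_congr fun s hs => ?_
    rw [hF.2 s (h.mem_domain hs)]
    ring
  have e2 : D.pairing n (fun s => G s / (s + w) * (F s - α * s - β))
      - D.pairing n (fun s => F s / (s + w) * (G s - α' * s - β'))
      = (α' * D.pairing n F + (β' - α' * w) * D.pairing n (fun s => F s / (s + w)))
        - (α * D.pairing n G + (β - α * w) * D.pairing n (fun s => G s / (s + w))) := by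
    have c1 : ContinuousOn (fun s => F s - α * s - β) (contourImage D.γ) :=
      (hF.1.fun_sub (by fun_prop)).fun_sub continuousOn_const
    have c2 : ContinuousOn (fun s => G s - α' * s - β') (contourImage D.γ) :=
      (hG.1.fun_sub (by fun_prop)).fun_sub continuousOn_const
    rw [← pairing_const_mul, ← pairing_const_mul, ← pairing_const_mul, ← pairing_const_mul,
      ← h.pairing_sub n (hGw.fun_mul c1) (hFw.fun_mul c2),
      ← h.pairing_add n (continuousOn_const.fun_mul hF.1) (continuousOn_const.fun_mul hFw),
      ← h.pairing_add n (continuousOn_const.fun_mul hG.1) (continuousOn_const.fun_mul hGw),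
      ← h.pairing_sub n ((continuousOn_const.fun_mul hF.1).fun_add (continuousOn_const.fun_mul hFw))
        ((continuousOn_const.fun_mul hG.1).fun_add (continuousOn_const.fun_mul hGw))]
    refine pairing_congr fun s hs => ?_
    have h1 := h.add_ne_zero hs hw
    field_simp
    ring
  rw [sF, sG] at e1
  have f1 := hF.2 w hw
  have g1 := hG.2 w hw
  linear_combination e1 + e2 - (β' - α' * w) * f1 + (β - α * w) * g1

/-- The Wronskian identity at a point where both `w` and `-w` are in the domain. -/
theorem wronskian_symm (h : D.InverseData) (hF : D.SolvesAffine n α β F)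
    (hG : D.SolvesAffine n α' β' G) {w : ℂ} (hw : w ∈ D.jostDomain) (hw' : -w ∈ D.jostDomain) :
    F (-w) * G w - F w * G (-w) = 2 * w * (α' * β - α * β') := by
  have hwE : w ∉ D.support := by
    intro hmem
    have h1 := h.add_ne_zero hmem hw'
    exact h1 (add_neg_cancel w)
  have h1 := h.wronskian hF hG hw hwE
  have f1 := hF.2 (-w) hw'
  have g1 := hG.2 (-w) hw'
  simp only [← sub_eq_add_neg] at f1 g1
  rw [f1, g1]
  linear_combination h1

theorem pairing_add_single (h : D.InverseData) (n : Fin N → ℤ) (k : Fin N) (φ : ℂ → ℂ) :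
    D.pairing (n + e k) φ = D.pairing n (fun σ => (D.p k + σ) / (D.p k - σ) * φ σ) := by
  have hρ : ∀ σ ∈ D.support, D.ρ (n + e k) σ = D.ρ n σ * ((D.p k + σ) / (D.p k - σ)) :=
    fun σ hσ => ρ_add_single (h.p_add_ne_zero k hσ) (h.p_sub_ne_zero k hσ)
  unfold pairing
  congr 1
  · congr 1
    exact contourIntegral_congr fun σ hσ => by rw [hρ σ (Or.inl hσ)]; ring
  · exact finsum_mem_congr rfl fun z hz => by rw [hρ z (Or.inr hz)]; ring

/-- A solution at `n + e_k`, multiplied by `p_k + ζ`, solves an affine equation at `n`. -/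
theorem shift_forward (h : D.InverseData) (k : Fin N) (hF : D.SolvesAffine (n + e k) 0 1 F) :
    ∃ c, D.SolvesAffine n 1 c (fun ζ => (D.p k + ζ) * F ζ) := by
  refine ⟨D.p k + D.pairing n (fun σ => (D.p k + σ) / (D.p k - σ) * F σ),
    (ContinuousOn.fun_mul (by fun_prop) hF.1), fun ζ hζ => ?_⟩
  have hx : ContinuousOn (fun σ => (D.p k + σ) / (D.p k - σ)) (contourImage D.γ) :=
    ContinuousOn.div (by fun_prop) (by fun_prop) fun σ hσ => h.p_sub_ne_zero k (Or.inl hσ)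
  have hm : ContinuousOn (fun σ => (D.p k + σ) * F σ) (contourImage D.γ) :=
    ContinuousOn.fun_mul (by fun_prop) hF.1
  have e1 : (D.p k + ζ) * D.pairing n (fun σ => (D.p k + σ) / (D.p k - σ) * (F σ / (σ + ζ)))
      = D.pairing n (fun σ => (D.p k + σ) / (D.p k - σ) * F σ)
        + D.pairing n (fun σ => (D.p k + σ) * F σ / (σ + ζ)) := by
    rw [← pairing_const_mul, ← h.pairing_add n (hx.fun_mul hF.1) (h.continuousOn_div_add hm hζ)]
    refine pairing_congr fun σ hσ => ?_
    have h1 := h.add_ne_zero hσ hζ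
    have h2 := h.p_sub_ne_zero k hσ
    field_simp
    ring
  beta_reduce
  rw [hF.2 ζ hζ, h.pairing_add_single]
  linear_combination e1

/-- A solution at `n`, multiplied by `p_k - ζ`, solves an affine equation at `n + e_k`. -/
theorem shift_backward (h : D.InverseData) (k : Fin N) (hF : D.SolvesAffine n 0 1 F) :
    ∃ c, D.SolvesAffine (n + e k) (-1) c (fun ζ => (D.p k - ζ) * F ζ) := by
  refine ⟨D.p k - D.pairing n F, (ContinuousOn.fun_mul (by fun_prop) hF.1), fun ζ hζ => ?_⟩
  have e1 : D.pairing n (fun σ => (D.p k + σ) / (D.p k - σ) * ((D.p k - σ) * F σ / (σ + ζ)))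
      = (D.p k - ζ) * D.pairing n (fun σ => F σ / (σ + ζ)) + D.pairing n F := by
    rw [← pairing_const_mul, ← h.pairing_add n
      (continuousOn_const.fun_mul (h.continuousOn_div_add hF.1 hζ)) hF.1]
    refine pairing_congr fun σ hσ => ?_
    have h1 := h.add_ne_zero hσ hζ
    have h2 := h.p_sub_ne_zero k hσ
    field_simp
    ring
  beta_reduce
  rw [h.pairing_add_single, e1, hF.2 ζ hζ]
  ring

theorem solvesAffine_lam (hn : D.Regular n) : D.SolvesAffine n 0 1 (D.Lam n) := by
  obtain ⟨f, hf, -⟩ := hn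
  exact solvesAt_iff.1 (Classical.epsilon_spec (p := D.SolvesAt n) ⟨f, hf⟩)

theorem eqOn_lam (hn : D.Regular n) (hF : D.SolvesAffine n 0 1 F) :
    Set.EqOn F (D.Lam n) D.jostDomain := by
  obtain ⟨f, -, hu⟩ := id hn
  exact (hu F (solvesAt_iff.2 hF)).trans (hu _ (solvesAt_iff.2 (solvesAffine_lam hn))).symm

/-- At a regular point, the solution with constant inhomogeneity `β` is `β Λ`. -/
theorem eq_const_mul_lam (h : D.InverseData) (hn : D.Regular n) (hF : D.SolvesAffine n 0 β F)
    {ζ : ℂ} (hζ : ζ ∈ D.jostDomain) : F ζ = β * D.Lam n ζ := by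
  have hG := h.solvesAffine_sub (h.solvesAffine_add (solvesAffine_lam hn) hF)
    (solvesAffine_const_mul β (solvesAffine_lam hn))
  have hG' : D.SolvesAffine n 0 1 (fun ζ => D.Lam n ζ + F ζ - β * D.Lam n ζ) := by
    convert hG using 1 <;> ring
  have := eqOn_lam hn hG' hζ
  linear_combination this

/-- Solvability at two neighbouring points implies uniqueness: a solution of the homogeneous
equation has vanishing Wronskian with the two solutions `Λ(n)` and `(p_k + ζ) Λ(n + e_k)`, whose mutual
Wronskian is `2ζ`. -/
theorem regular_of_solvable (h : D.InverseData) {k : Fin N} (hF : D.SolvesAffine n 0 1 F)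
    (hG : D.SolvesAffine (n + e k) 0 1 G) : D.Regular n := by
  refine ⟨F, solvesAt_iff.2 hF, fun g hg => ?_⟩
  obtain ⟨c, hm⟩ := h.shift_forward k hG
  have hf := h.solvesAffine_sub (solvesAt_iff.1 hg) hF
  rw [sub_self, sub_self] at hf
  set f : ℂ → ℂ := fun ζ => g ζ - F ζ with hfdef
  have hgen : ∀ w ∈ D.jostDomain, w ∉ D.support ∪ {0} → f w = 0 := by
    intro w hw hwE
    have hwE' : w ∉ D.support := fun h' => hwE (Or.inl h')
    have hw0 : w ≠ 0 := fun h' => hwE (Or.inr h')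
    have w1 := h.wronskian hf hF hw hwE'
    have w2 := h.wronskian hf hm hw hwE'
    have w3 := h.wronskian hF hm hw hwE'
    have : 2 * w * f w = 0 := by
      linear_combination -f w * w3 + F w * w2 - (D.p k + w) * G w * w1
    simpa [hw0] using this
  have hcont : ContinuousOn f D.jostDomain :=
    (h.continuousOn_pairing n hf.1).congr fun ζ hζ => by
      have := hf.2 ζ hζ
      simpa using this
  have hdense : Dense (D.support ∪ {0})ᶜ := by
    have := h.valid.contour.dense_compl (h.finite_zeros.union (Set.finite_singleton 0))
    rwa [← Set.union_assoc] at this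
  intro ζ hζ
  have hz : f ζ = 0 := by
    by_contra hne
    have hopen : IsOpen (D.jostDomain ∩ f ⁻¹' {0}ᶜ) :=
      hcont.isOpen_inter_preimage h.isOpen_domain isOpen_compl_singleton
    obtain ⟨w, hw, hwE⟩ := hdense.inter_open_nonempty _ hopen ⟨ζ, hζ, hne⟩
    exact hw.2 (hgen w hw.1 hwE)
  exact sub_eq_zero.1 hz

end InverseData

end Setup

/-! ### The Jost solutions solve the singular integral equation -/

/-- A solution of a three-term recurrence with nonvanishing outer coefficients is determined by two
consecutive values. -/
theorem eq_of_recurrence {α β γ f g : ℤ → ℂ} (hα : ∀ i, α i ≠ 0) (hγ : ∀ i, γ i ≠ 0)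
    (hf : ∀ i, α i * f (i + 2) - β i * f (i + 1) + γ i * f i = 0)
    (hg : ∀ i, α i * g (i + 2) - β i * g (i + 1) + γ i * g i = 0) (i₀ : ℤ)
    (h0 : f i₀ = g i₀) (h1 : f (i₀ + 1) = g (i₀ + 1)) (i : ℤ) : f i = g i := by
  have key : ∀ i, f i = g i ∧ f (i + 1) = g (i + 1) := by
    intro i
    induction i using Int.inductionOn' (b := i₀) with
    | zero => exact ⟨h0, h1⟩
    | succ k _ ih =>
      refine ⟨ih.2, mul_left_cancel₀ (hα k) ?_⟩
      have e : k + 1 + 1 = k + 2 := by ring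
      rw [e]
      have a := hf k
      have b := hg k
      rw [ih.1, ih.2] at a
      linear_combination a - b
    | pred k _ ih =>
      have a := hf (k - 1)
      have b := hg (k - 1)
      have e1 : k - 1 + 2 = k + 1 := by ring
      have e2 : k - 1 + 1 = k := by ring
      rw [e1, e2] at a b
      rw [e2]
      rw [ih.1, ih.2] at a
      exact ⟨mul_left_cancel₀ (hγ (k - 1)) (by linear_combination a - b), ih.1⟩
  exact (key i).1

namespace Setup

variable {N : ℕ} {D : Setup N}

/-- The hypotheses of the inverse scattering problem. -/
structure ScatteringProblem (D : Setup N) : Prop where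
  param : D.ValidParameters
  stair : D.IsStaircase
  weight : D.ValidWeight
  adm : Admissible D.q D.υ D.i₀ D.K
  valid : D.ValidContour

namespace ScatteringProblem

theorem steps (h : D.ScatteringProblem) : StepParameters D.q :=
  ⟨(Set.finite_range D.p).subset (by rintro _ ⟨i, rfl⟩; exact ⟨D.step i, rfl⟩),
    h.stair.param_ne_zero⟩

theorem one_lt_K (h : D.ScatteringProblem) : 1 < D.K := by
  have h1 := h.weight.a_left 0
  have h2 := h.weight.a_right 0
  have hne := h.param.p_ne_a (D.step 0)
  have n1 : D.q 0 + D.a ≠ 0 := fun h' => hne (by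
    change D.q 0 ^ 2 = _
    linear_combination (D.q 0 - D.a) * h')
  have n2 : D.q 0 - D.a ≠ 0 := fun h' => hne (by
    change D.q 0 ^ 2 = _
    linear_combination (D.q 0 + D.a) * h')
  have e : ‖(D.q 0 + D.a) / (D.q 0 - D.a)‖ * ‖(D.q 0 - D.a) / (D.q 0 + D.a)‖ = 1 := by
    rw [← norm_mul]
    have : (D.q 0 + D.a) / (D.q 0 - D.a) * ((D.q 0 - D.a) / (D.q 0 + D.a)) = 1 := by field_simp
    rw [this, norm_one]
  have g1 := norm_nonneg ((D.q 0 + D.a) / (D.q 0 - D.a))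
  have g2 := norm_nonneg ((D.q 0 - D.a) / (D.q 0 + D.a))
  by_contra hK
  nlinarith

theorem summable (h : D.ScatteringProblem) : WeightedSummable D.K D.υ := h.adm.summable

theorem notMem_regionP_of_domain (h : D.ScatteringProblem) {ζ : ℂ} (hζ : ζ ∈ D.jostDomain) :
    ζ ∉ regionP D.q D.K := by
  intro hmem
  rw [← neg_neg ζ, neg_mem_regionP] at hmem
  exact disjoint_interior_exterior (h.valid.pstar_inside hmem) hζ

theorem notMem_regionP (h : D.ScatteringProblem) {σ : ℂ} (hσ : σ ∈ contourImage D.γ) :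
    σ ∉ regionP D.q D.K := fun hmem => h.valid.avoids σ hσ (subset_closure hmem)

theorem neg_notMem_regionP (h : D.ScatteringProblem) {σ : ℂ} (hσ : σ ∈ contourImage D.γ) :
    -σ ∉ regionP D.q D.K := by
  rw [neg_mem_regionP]
  exact fun hmem => (h.valid.pstar_inside hmem).1 hσ

theorem ne_zero_of_mem (h : D.ScatteringProblem) {σ : ℂ} (hσ : σ ∈ contourImage D.γ) : σ ≠ 0 := by
  rintro rfl
  exact h.valid.zero_outside.1 hσ

theorem contour_subset (h : D.ScatteringProblem) :
    contourImage D.γ ⊆ (closure (regionP D.q D.K))ᶜ ∩ {0}ᶜ := fun σ hσ =>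
  ⟨h.valid.avoids σ hσ, h.ne_zero_of_mem hσ⟩

theorem continuousOn_jostLam (h : D.ScatteringProblem) (i : ℤ) :
    ContinuousOn (jostLam D.q D.υ i) (contourImage D.γ) :=
  (Q3IST.continuousOn_jostLam h.steps h.one_lt_K h.summable i).mono fun _ hσ => h.notMem_regionP hσ

theorem continuousOn_jostLam_neg (h : D.ScatteringProblem) (i : ℤ) :
    ContinuousOn (fun σ => jostLam D.q D.υ i (-σ)) (contourImage D.γ) :=
  (Q3IST.continuousOn_jostLam h.steps h.one_lt_K h.summable i).comp continuousOn_neg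
    fun _ hσ => h.neg_notMem_regionP hσ

theorem continuousOn_jostUps (h : D.ScatteringProblem) (i : ℤ) :
    ContinuousOn (jostUps D.q D.υ i) (contourImage D.γ) :=
  (differentiableOn_jostUps h.steps h.one_lt_K h.summable i).continuousOn.mono h.contour_subset

theorem differentiableOn_specA (h : D.ScatteringProblem) :
    DifferentiableOn ℂ (specA D.q D.υ D.i₀) ((closure (regionP D.q D.K))ᶜ ∩ {0}ᶜ) := by
  have hU := differentiableOn_jostUps h.steps h.one_lt_K h.summable
  have hL := fun i => (differentiableOn_jostLam h.steps h.one_lt_K h.summable i).mono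
    (Set.inter_subset_left (t := {(0 : ℂ)}ᶜ))
  unfold specA
  refine DifferentiableOn.fun_div (DifferentiableOn.fun_sub ?_ ?_) (by fun_prop) fun z hz =>
    mul_ne_zero two_ne_zero hz.2
  · exact (DifferentiableOn.fun_mul (by fun_prop) (hU _)).fun_mul (hL _)
  · exact (DifferentiableOn.fun_mul (by fun_prop) (hU _)).fun_mul (hL _)

theorem specA_ne_zero (h : D.ScatteringProblem) {σ : ℂ} (hσ : σ ∈ contourImage D.γ) :
    specA D.q D.υ D.i₀ σ ≠ 0 := fun h0 =>
  (h.valid.zeros_inside ⟨h.ne_zero_of_mem hσ, h.valid.avoids σ hσ, h0⟩).1 hσ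

theorem continuousOn_R (h : D.ScatteringProblem) : ContinuousOn D.R (contourImage D.γ) := by
  refine ContinuousOn.div ?_ (h.differentiableOn_specA.continuousOn.mono h.contour_subset)
    fun σ hσ => h.specA_ne_zero hσ
  unfold specB
  refine ContinuousOn.mul (ContinuousOn.div (by fun_prop) (by fun_prop) fun σ hσ =>
    mul_ne_zero two_ne_zero (h.ne_zero_of_mem hσ)) ?_
  exact ((h.continuousOn_jostLam_neg _).fun_mul (h.continuousOn_jostUps _)).fun_sub
    ((h.continuousOn_jostLam_neg _).fun_mul (h.continuousOn_jostUps _))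

theorem inverseData (h : D.ScatteringProblem) : D.InverseData :=
  ⟨h.valid, h.continuousOn_R, h.adm.finite_zeros⟩

theorem ρ_base (h : D.ScatteringProblem) (ζ : ℂ) : D.ρ (D.Γ D.i₀) ζ = 1 := by
  simp [ρ, h.stair.base]

theorem ρ_succ (h : D.ScatteringProblem) {ζ : ℂ} {i : ℤ} (h1 : D.q i + ζ ≠ 0)
    (h2 : D.q i - ζ ≠ 0) :
    D.ρ (D.Γ (i + 1)) ζ = D.ρ (D.Γ i) ζ * ((D.q i + ζ) / (D.q i - ζ)) := by
  rw [h.stair.succ]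
  exact ρ_add_single h1 h2

/-- Multiplication by the plane-wave factor turns `Λ` into a solution of the recurrence of `Υ`. -/
theorem recurrence_mul_ρ (h : D.ScatteringProblem) {ζ : ℂ} (hζ : ζ ∉ regionP D.q D.K)
    (hne : ∀ i, D.q i - ζ ≠ 0) (i : ℤ) :
    (D.q (i + 1) - ζ) * (jostLam D.q D.υ (i + 2) ζ * D.ρ (D.Γ (i + 2)) ζ)
      - (D.q i + D.q (i + 1) + D.υ (i + 1))
        * (jostLam D.q D.υ (i + 1) ζ * D.ρ (D.Γ (i + 1)) ζ)
      + (D.q i + ζ) * (jostLam D.q D.υ i ζ * D.ρ (D.Γ i) ζ) = 0 := by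
  have hp := add_ne_zero_of_notMem_regionP h.steps.ne_zero hζ
  have r := jostLam_recurrence h.steps h.one_lt_K h.summable hζ i
  have e : i + 2 = i + 1 + 1 := by ring
  rw [e] at r ⊢
  rw [h.ρ_succ (hp (i + 1)) (hne (i + 1)), h.ρ_succ (hp i) (hne i)]
  have n1 := hne i
  have n2 := hne (i + 1)
  field_simp
  linear_combination D.ρ (D.Γ i) ζ * (D.q i + ζ) * r

/-- The scattering relation `ψ = A φ° + B φ`. -/
theorem scattering_relation (h : D.ScatteringProblem) {ζ : ℂ} (h0 : ζ ≠ 0)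
    (hζ : ζ ∉ regionP D.q D.K) (hζ' : -ζ ∉ regionP D.q D.K) (i : ℤ) :
    jostUps D.q D.υ i ζ = specA D.q D.υ D.i₀ ζ * jostLam D.q D.υ i (-ζ)
      + specB D.q D.υ D.i₀ ζ * (jostLam D.q D.υ i ζ * D.ρ (D.Γ i) ζ) := by
  have hp := add_ne_zero_of_notMem_regionP h.steps.ne_zero hζ
  have hm : ∀ i, D.q i - ζ ≠ 0 := fun i => by
    have := add_ne_zero_of_notMem_regionP h.steps.ne_zero hζ' i
    rwa [← sub_eq_add_neg] at this
  have W := jostLam_wronskian h.steps h.one_lt_K h.summable hζ hζ' D.i₀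
  refine eq_of_recurrence (α := fun i => D.q (i + 1) - ζ)
    (β := fun i => D.q i + D.q (i + 1) + D.υ (i + 1)) (γ := fun i => D.q i + ζ)
    (f := fun i => jostUps D.q D.υ i ζ)
    (g := fun i => specA D.q D.υ D.i₀ ζ * jostLam D.q D.υ i (-ζ)
      + specB D.q D.υ D.i₀ ζ * (jostLam D.q D.υ i ζ * D.ρ (D.Γ i) ζ))
    (fun i => hm _) hp (jostUps_recurrence h.steps h.one_lt_K h.summable h0 hζ) (fun i => ?_)
    D.i₀ ?_ ?_ i
  · have r1 := jostLam_recurrence h.steps h.one_lt_K h.summable hζ' i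
    have r2 := h.recurrence_mul_ρ hζ hm i
    linear_combination specA D.q D.υ D.i₀ ζ * r1 + specB D.q D.υ D.i₀ ζ * r2
  · simp only [h.ρ_base, specA, specB]
    field_simp
    linear_combination -jostUps D.q D.υ D.i₀ ζ * W
  · simp only [h.ρ_succ (hp D.i₀) (hm D.i₀), h.ρ_base, specA, specB]
    have := hm D.i₀
    field_simp
    linear_combination -jostUps D.q D.υ (D.i₀ + 1) ζ * W

/-- At a zero of `A` the two Jost solutions are proportional, with the constant that enters
`C_j`. -/
theorem jostUps_eq_at_zero (h : D.ScatteringProblem) {z : ℂ} (hz : z ∈ D.zeros) (i : ℤ) :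
    jostUps D.q D.υ i z / deriv (specA D.q D.υ D.i₀) z
      = D.resC z * (jostLam D.q D.υ i z * D.ρ (D.Γ i) z) := by
  have hzP : z ∉ regionP D.q D.K := fun hmem => hz.2.1 (subset_closure hmem)
  have hA := hz.2.2
  have hd := h.adm.simple_zeros z hz
  have hp : ∀ i, D.q i + z ≠ 0 := fun i h' =>
    (h.valid.param_off (D.step i) z (Or.inr hz)).2 (by
      change z = -D.q i
      linear_combination h')
  have hm : ∀ i, D.q i - z ≠ 0 := fun i h' =>
    (h.valid.param_off (D.step i) z (Or.inr hz)).1 (by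
      change z = D.q i
      linear_combination -h')
  by_cases hstar : z ∈ regionPstar D.q D.K
  · have hex : ∃ c : ℂ, ∀ i, jostUps D.q D.υ i z = c * jostLam D.q D.υ i z * D.ρ (D.Γ i) z := by
      set g : ℤ → ℂ := fun i => jostLam D.q D.υ i z * D.ρ (D.Γ i) z with hg
      have hU := jostUps_recurrence h.steps h.one_lt_K h.summable hz.1 hzP
      have hrec := h.recurrence_mul_ρ hzP hm
      -- the vanishing of `A` is the vanishing of the Wronskian of `Υ` and `g`
      have hW : jostUps D.q D.υ D.i₀ z * g (D.i₀ + 1) = jostUps D.q D.υ (D.i₀ + 1) z * g D.i₀ := by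
        have hA' : (D.q D.i₀ + z) * jostUps D.q D.υ D.i₀ z * jostLam D.q D.υ (D.i₀ + 1) z
            - (D.q D.i₀ - z) * jostUps D.q D.υ (D.i₀ + 1) z * jostLam D.q D.υ D.i₀ z = 0 := by
          have := hA
          unfold specA at this
          rcases div_eq_zero_iff.1 this with h' | h'
          · exact h'
          · exact absurd h' (mul_ne_zero two_ne_zero hz.1)
        simp only [hg, h.ρ_succ (hp D.i₀) (hm D.i₀), h.ρ_base]
        have := hm D.i₀
        field_simp
        linear_combination hA'
      have hprop : ∀ c, jostUps D.q D.υ D.i₀ z = c * g D.i₀ →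
          jostUps D.q D.υ (D.i₀ + 1) z = c * g (D.i₀ + 1) →
          ∃ c : ℂ, ∀ i, jostUps D.q D.υ i z = c * jostLam D.q D.υ i z * D.ρ (D.Γ i) z := by
        intro c c0 c1
        refine ⟨c, fun i => ?_⟩
        rw [mul_assoc]
        exact eq_of_recurrence (f := fun i => jostUps D.q D.υ i z) (g := fun i => c * g i)
          (fun i => hm (i + 1)) hp hU (fun i => by
            simp only [hg]; linear_combination c * hrec i) D.i₀ c0 c1 i
      by_cases g0 : g D.i₀ = 0
      · by_cases g1 : g (D.i₀ + 1) = 0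
        · exfalso
          have hgz : ∀ i, g i = 0 := eq_of_recurrence (f := g) (g := fun _ => 0)
            (fun i => hm (i + 1)) hp hrec (fun i => by ring) D.i₀ g0 g1
          have hLz : ∀ i, jostLam D.q D.υ i z = 0 := fun i => by
            rcases mul_eq_zero.1 (hgz i) with h' | h'
            · exact h'
            · exfalso
              obtain ⟨r, -, hr⟩ := Finset.prod_eq_zero_iff.1 h'
              have hoff := h.valid.param_off r z (Or.inr hz)
              have n1 : D.p r + z ≠ 0 := fun e => hoff.2 (by linear_combination e)
              have n2 : D.p r - z ≠ 0 := fun e => hoff.1 (by linear_combination -e)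
              exact zpow_ne_zero _ (div_ne_zero n1 n2) hr
          have hlim := tendsto_jostLam_atBot h.steps h.one_lt_K h.summable hzP
          simp only [hLz] at hlim
          exact zero_ne_one (tendsto_nhds_unique tendsto_const_nhds hlim)
        · refine hprop (jostUps D.q D.υ (D.i₀ + 1) z / g (D.i₀ + 1)) ?_ (by field_simp)
          field_simp
          linear_combination hW
      · refine hprop (jostUps D.q D.υ D.i₀ z / g D.i₀) (by field_simp) ?_
        field_simp
        linear_combination -hW
    have hc : ∀ i, jostUps D.q D.υ i z = D.conn z * jostLam D.q D.υ i z * D.ρ (D.Γ i) z :=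
      Classical.epsilon_spec hex
    simp only [resC, hstar, if_true]
    rw [hc i]
    ring
  · have hzP' : -z ∉ regionP D.q D.K := by rwa [neg_mem_regionP]
    have := h.scattering_relation hz.1 hzP hzP' i
    rw [hA, zero_mul, zero_add] at this
    simp only [resC, hstar, if_false]
    rw [this]
    ring

/-- The Cauchy integral of `Λ(-σ)` at an exterior point. The contour may touch the boundary of `𝒫*`,
so the formula is first proved for truncated potentials, whose Jost functions are singular at the
points `-q_r` only. -/
theorem cauchy_jostLam (h : D.ScatteringProblem) (i : ℤ) {w : ℂ} (hw : w ∈ exteriorRegion D.γ) :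
    contourIntegral D.γ (fun σ => jostLam D.q D.υ i (-σ) / (σ - w))
      = 2 * (Real.pi : ℂ) * Complex.I * (1 - jostLam D.q D.υ i (-w)) := by
  have hγ := h.valid.contour
  set U : Set ℂ := (Set.range D.q)ᶜ with hU
  have hUo : IsOpen U := h.steps.finite_range.isClosed.isOpen_compl
  have hstar : ∀ z, z ∉ U → z ∈ regionPstar D.q D.K := by
    intro z hz
    obtain ⟨r, rfl⟩ := not_not.1 hz
    refine ⟨r, ?_⟩
    have := norm_pos_iff.2 (mul_ne_zero two_ne_zero (h.steps.ne_zero r))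
    rwa [sub_self, norm_zero, mul_zero, ← two_mul]
  have hsub : contourImage D.γ ⊆ U := fun σ hσ => by
    by_contra hσU
    exact (h.valid.pstar_inside (hstar σ hσU)).1 hσ
  set Λm : ℕ → ℂ → ℂ := fun m σ => jostLam D.q (truncate D.υ m) i (-σ) with hΛm
  have hdm : ∀ m, DifferentiableOn ℂ (Λm m) U := by
    intro m σ hσ
    have hne : ∀ r, D.q r + -σ ≠ 0 := fun r h' => hσ ⟨r, by linear_combination h'⟩
    exact ((differentiableAt_jostLam_truncate h.steps m i hne).comp σ
      differentiableAt_id.neg).differentiableWithinAt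
  have hinf : ∀ m, Tendsto (Λm m) (cocompact ℂ) (𝓝 1) := fun m =>
    (tendsto_jostLam_cocompact h.steps h.one_lt_K (weightedSummable_truncate D.K D.υ m) i).comp
      (Homeomorph.neg ℂ).isClosedEmbedding.tendsto_cocompact
  have hform : ∀ m, contourIntegral D.γ (fun σ => Λm m σ / (σ - w))
      = 2 * (Real.pi : ℂ) * Complex.I * (1 - Λm m w) := fun m =>
    hγ.cauchy_exterior hUo hsub (fun z hz => h.valid.pstar_inside (hstar z hz)) (hdm m) (hinf m) hw
  obtain ⟨C, hC⟩ := exists_norm_jostLam_truncate_le h.steps h.one_lt_K h.summable i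
  have hwP : -w ∉ regionP D.q D.K := h.notMem_regionP_of_domain (by
    change - -w ∈ exteriorRegion D.γ
    rwa [neg_neg])
  have hC0 : 0 ≤ C := (norm_nonneg _).trans (hC 0 _ hwP)
  have hcw := IsPositiveContour.continuousOn_div_sub (γ := D.γ) (φ := fun _ => (1 : ℂ))
    continuousOn_const hw.1
  obtain ⟨B, hB0, hB⟩ := hγ.exists_norm_le hcw
  have hL := hγ.tendsto_integral (φ := fun m σ => Λm m σ / (σ - w))
    (ψ := fun σ => jostLam D.q D.υ i (-σ) / (σ - w)) (C := C * B)
    (fun m => IsPositiveContour.continuousOn_div_sub ((hdm m).continuousOn.mono hsub) hw.1)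
    (fun m σ hσ => by
      rw [div_eq_mul_one_div, norm_mul]
      exact mul_le_mul (hC m _ (h.neg_notMem_regionP hσ)) (hB σ hσ) (norm_nonneg _) hC0)
    (fun σ hσ => (tendsto_jostLam_truncate h.steps h.one_lt_K h.summable
      (h.neg_notMem_regionP hσ) i).div_const _)
  have hR : Tendsto (fun m => 2 * (Real.pi : ℂ) * Complex.I * (1 - Λm m w)) atTop
      (𝓝 (2 * (Real.pi : ℂ) * Complex.I * (1 - jostLam D.q D.υ i (-w)))) :=
    ((tendsto_jostLam_truncate h.steps h.one_lt_K h.summable hwP i).const_sub 1).const_mul _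
  simp only [hform] at hL
  exact tendsto_nhds_unique hL hR

/-- The Cauchy integral of `Υ / A` at an exterior point, by residues at the zeros of `A`. -/
theorem cauchy_jostUps_div (h : D.ScatteringProblem) (i : ℤ) {w : ℂ}
    (hw : w ∈ exteriorRegion D.γ) :
    contourIntegral D.γ (fun σ => jostUps D.q D.υ i σ / specA D.q D.υ D.i₀ σ / (σ - w))
      = 2 * (Real.pi : ℂ) * Complex.I * ∑ z ∈ h.adm.finite_zeros.toFinset,
        jostUps D.q D.υ i z / deriv (specA D.q D.υ D.i₀) z / (z - w) := by
  have hγ := h.valid.contour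
  set U : Set ℂ := (closure (regionP D.q D.K))ᶜ ∩ {0}ᶜ with hU
  have hUo : IsOpen U := isClosed_closure.isOpen_compl.inter isOpen_compl_singleton
  set Z := h.adm.finite_zeros.toFinset with hZ
  have hmemZ : ∀ {z : ℂ}, z ∈ Z ↔ z ∈ D.zeros := fun {z} => h.adm.finite_zeros.mem_toFinset
  obtain ⟨G, hG, hdec⟩ := exists_differentiableOn_div hUo
    (differentiableOn_jostUps h.steps h.one_lt_K h.summable i) h.differentiableOn_specA Z
    (fun z hz => ⟨(hmemZ.1 hz).2.1, (hmemZ.1 hz).1⟩)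
    (fun z hz => ⟨fun h0 => hmemZ.2 ⟨hz.2, hz.1, h0⟩, fun h0 => (hmemZ.1 h0).2.2⟩)
    (fun z hz => h.adm.simple_zeros z (hmemZ.1 hz))
  have hZL : ∀ z ∈ Z, z ∉ contourImage D.γ := fun z hz => (h.valid.zeros_inside (hmemZ.1 hz)).1
  have hext : ∀ z, z ∉ U → z ∈ exteriorRegion D.γ := by
    intro z hz
    by_cases hz0 : z = 0
    · rw [hz0]; exact h.valid.zero_outside
    · have hzc : z ∈ closure (regionP D.q D.K) := by
        by_contra h'
        exact hz ⟨h', hz0⟩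
      rcases hγ.trichotomy z with h1 | h1 | h1
      · exact absurd hzc (h.valid.avoids z h1)
      · -- `𝒫` is exterior, so its closure does not meet the open interior
        exfalso
        obtain ⟨y, hy1, hy2⟩ := mem_closure_iff.1 hzc _ hγ.isOpen_interior h1
        have hy3 : -y ∈ interiorRegion D.γ := h.valid.pstar_inside (by
          rwa [← neg_mem_regionP, neg_neg])
        have := h.valid.reflected_outside (-y) (Or.inr hy3)
        rw [neg_neg] at this
        exact disjoint_interior_exterior hy1 this
      · exact h1
  have hGint := hγ.cauchy_interior hUo h.contour_subset hext hG hw.1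
  rw [hw.2, mul_zero, zero_mul] at hGint
  have hwL : ∀ σ ∈ contourImage D.γ, σ - w ≠ 0 := fun σ hσ h' =>
    hw.1 (by rwa [← sub_eq_zero.1 h'])
  have hzL : ∀ z ∈ Z, ∀ σ ∈ contourImage D.γ, σ - z ≠ 0 := fun z hz σ hσ h' =>
    hZL z hz (by rwa [← sub_eq_zero.1 h'])
  have hzw : ∀ z ∈ Z, z - w ≠ 0 := fun z hz h' =>
    disjoint_interior_exterior (h.valid.zeros_inside (hmemZ.1 hz)) (sub_eq_zero.1 h' ▸ hw)
  have hcz : ∀ {z : ℂ}, z ∉ contourImage D.γ →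
      ContinuousOn (fun σ => 1 / (σ - z)) (contourImage D.γ) := fun hz =>
    IsPositiveContour.continuousOn_div_sub (φ := fun _ => (1 : ℂ)) continuousOn_const hz
  set r : ℂ → ℂ := fun z => jostUps D.q D.υ i z / deriv (specA D.q D.υ D.i₀) z with hr
  have e1 : contourIntegral D.γ
        (fun σ => jostUps D.q D.υ i σ / specA D.q D.υ D.i₀ σ / (σ - w))
      = contourIntegral D.γ (fun σ => G σ / (σ - w)
        + ∑ z ∈ Z, r z / (z - w) * (1 / (σ - z) - 1 / (σ - w))) := by
    refine contourIntegral_congr fun σ hσ => ?_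
    rw [hdec σ (h.contour_subset hσ) fun hσZ => hZL σ hσZ hσ, add_div, Finset.sum_div]
    congr 1
    refine Finset.sum_congr rfl fun z hz => ?_
    have n1 := hwL σ hσ
    have n2 := hzL z hz σ hσ
    have n3 := hzw z hz
    simp only [hr]
    field_simp
    ring
  have hcd : ∀ z ∈ Z, ContinuousOn (fun σ => r z / (z - w) * (1 / (σ - z) - 1 / (σ - w)))
      (contourImage D.γ) := fun z hz =>
    continuousOn_const.fun_mul ((hcz (hZL z hz)).fun_sub (hcz hw.1))
  rw [e1, hγ.integral_add
    (IsPositiveContour.continuousOn_div_sub (hG.continuousOn.mono h.contour_subset) hw.1)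
    (continuousOn_finsetSum _ hcd), hGint, hγ.integral_finset_sum Z hcd, zero_add, Finset.mul_sum]
  refine Finset.sum_congr rfl fun z hz => ?_
  rw [contourIntegral_const_mul, hγ.integral_sub (hcz (hZL z hz)) (hcz hw.1)]
  have w1 : contourIntegral D.γ (fun σ => 1 / (σ - z)) = 2 * (Real.pi : ℂ) * Complex.I := by
    have := (h.valid.zeros_inside (hmemZ.1 hz)).2
    unfold winding at this
    rw [inv_mul_eq_div, div_eq_one_iff_eq Complex.two_pi_I_ne_zero] at this
    exact this
  have w0 : contourIntegral D.γ (fun σ => 1 / (σ - w)) = 0 := by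
    have := hw.2
    unfold winding at this
    rcases mul_eq_zero.1 this with h' | h'
    · exact absurd h' (inv_ne_zero Complex.two_pi_I_ne_zero)
    · exact h'
  rw [w1, w0]
  ring

/-- The Jost solution along the staircase solves the singular integral equation there. -/
theorem solvesAffine_jostLam (h : D.ScatteringProblem) (i : ℤ) :
    D.SolvesAffine (D.Γ i) 0 1 (jostLam D.q D.υ i) := by
  refine ⟨h.continuousOn_jostLam i, fun ζ hζ => ?_⟩
  have hγ := h.valid.contour
  have hw : -ζ ∈ exteriorRegion D.γ := hζ
  have c1 := h.cauchy_jostLam i hw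
  have c2 := h.cauchy_jostUps_div i hw
  rw [neg_neg] at c1
  have e1 : contourIntegral D.γ (fun σ => D.R σ * D.ρ (D.Γ i) σ * (jostLam D.q D.υ i σ / (σ + ζ)))
      = contourIntegral D.γ (fun σ => jostUps D.q D.υ i σ / specA D.q D.υ D.i₀ σ / (σ - -ζ))
        - contourIntegral D.γ (fun σ => jostLam D.q D.υ i (-σ) / (σ - -ζ)) := by
    rw [← hγ.integral_sub
      (IsPositiveContour.continuousOn_div_sub
        (φ := fun σ => jostUps D.q D.υ i σ / specA D.q D.υ D.i₀ σ)
        ((h.continuousOn_jostUps i).div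
        (h.differentiableOn_specA.continuousOn.mono h.contour_subset)
        fun σ hσ => h.specA_ne_zero hσ) hw.1)
      (IsPositiveContour.continuousOn_div_sub (h.continuousOn_jostLam_neg i) hw.1)]
    refine contourIntegral_congr fun σ hσ => ?_
    have hs := h.scattering_relation (h.ne_zero_of_mem hσ) (h.notMem_regionP hσ)
      (h.neg_notMem_regionP hσ) i
    have hA := h.specA_ne_zero hσ
    have hne := h.inverseData.add_ne_zero (Or.inl hσ) hζ
    rw [sub_neg_eq_add, hs, R]
    field_simp
    ring
  rw [h.inverseData.pairing_eq_sum, e1, c1, c2]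
  have e2 : ∑ z ∈ h.inverseData.finite_zeros.toFinset,
        D.resC z * D.ρ (D.Γ i) z * (jostLam D.q D.υ i z / (z + ζ))
      = ∑ z ∈ h.adm.finite_zeros.toFinset,
        jostUps D.q D.υ i z / deriv (specA D.q D.υ D.i₀) z / (z - -ζ) := by
    refine Finset.sum_congr rfl fun z hz => ?_
    rw [h.jostUps_eq_at_zero (h.adm.finite_zeros.mem_toFinset.1 hz) i]
    ring
  rw [e2]
  have := Complex.two_pi_I_ne_zero
  field_simp
  ring

theorem regular_staircase (h : D.ScatteringProblem) (i : ℤ) : D.Regular (D.Γ i) := by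
  have h1 := h.solvesAffine_jostLam (i + 1)
  rw [h.stair.succ] at h1
  exact h.inverseData.regular_of_solvable (h.solvesAffine_jostLam i) h1

theorem eqOn_lam_jostLam (h : D.ScatteringProblem) (i : ℤ) :
    Set.EqOn (D.Lam (D.Γ i)) (jostLam D.q D.υ i) D.jostDomain :=
  (InverseData.eqOn_lam (h.regular_staircase i) (h.solvesAffine_jostLam i)).symm

end ScatteringProblem
end Setup

/-! ### Relations between the Jost functions at neighbouring lattice points -/

namespace Setup

variable {N : ℕ} {D : Setup N}

/-- The points `±a, ±b` at which the solution formula evaluates the Jost functions. -/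
def nodes (D : Setup N) : Set ℂ := {D.a, -D.a, D.b, -D.b}

theorem a_mem_nodes : D.a ∈ D.nodes := by simp [nodes]
theorem neg_a_mem_nodes : -D.a ∈ D.nodes := by simp [nodes]
theorem b_mem_nodes : D.b ∈ D.nodes := by simp [nodes]
theorem neg_b_mem_nodes : -D.b ∈ D.nodes := by simp [nodes]

theorem ValidParameters.P_ne_zero (h : D.ValidParameters) (k : Fin N) : D.P k ≠ 0 := by
  intro h0
  have hc := h.curve k
  rw [h0, zero_pow two_ne_zero] at hc
  rcases mul_eq_zero.1 hc.symm with h1 | h1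
  exacts [h.p_ne_a k (sub_eq_zero.1 h1), h.p_ne_b k (sub_eq_zero.1 h1)]

theorem ValidParameters.a_sub_b_ne_zero (h : D.ValidParameters) : D.a - D.b ≠ 0 := fun h' =>
  h.a_ne_b (by linear_combination (D.a + D.b) * h')

theorem ValidParameters.a_add_b_ne_zero (h : D.ValidParameters) : D.a + D.b ≠ 0 := fun h' =>
  h.a_ne_b (by linear_combination (D.a - D.b) * h')

theorem ValidParameters.add_node_ne_zero (h : D.ValidParameters) (k : Fin N) {x : ℂ}
    (hx : x ∈ D.nodes) : D.p k + x ≠ 0 := by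
  intro h0
  rcases hx with rfl | rfl | rfl | rfl
  · exact h.p_ne_a k (by linear_combination (D.p k - D.a) * h0)
  · exact h.p_ne_a k (by linear_combination (D.p k + D.a) * h0)
  · exact h.p_ne_b k (by linear_combination (D.p k - D.b) * h0)
  · exact h.p_ne_b k (by linear_combination (D.p k + D.b) * h0)

namespace ScatteringProblem

variable {n : Fin N → ℤ} {k l : Fin N}

theorem mem_domain_of_mem_nodes (h : D.ScatteringProblem) {x : ℂ} (hx : x ∈ D.nodes) :
    x ∈ D.jostDomain := by
  refine h.valid.points_outside (-x) ?_
  rcases hx with rfl | rfl | rfl | rfl <;> simp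

/-- Three regular points `n`, `n + e_k`, `n + e_l`: the difference of the shifted Jost functions is
a multiple of `Λ(n)`, with a factor independent of `ζ`. -/
theorem exists_shift_sub_shift (h : D.ScatteringProblem) (hn : D.Regular n)
    (hk : D.Regular (n + e k)) (hl : D.Regular (n + e l)) :
    ∃ t, ∀ ζ ∈ D.jostDomain, (D.p k + ζ) * D.Lam (n + e k) ζ - (D.p l + ζ) * D.Lam (n + e l) ζ
      = t * D.Lam n ζ := by
  have hi := h.inverseData
  obtain ⟨c, hc⟩ := hi.shift_forward k (InverseData.solvesAffine_lam hk)
  obtain ⟨c', hc'⟩ := hi.shift_forward l (InverseData.solvesAffine_lam hl)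
  have hd := hi.solvesAffine_sub hc hc'
  rw [sub_self] at hd
  exact ⟨c - c', fun ζ hζ => hi.eq_const_mul_lam hn hd hζ⟩

/-- The three-point relation along a path `n → n + e_k → n + e_k + e_l` of regular points. -/
theorem exists_three_point (h : D.ScatteringProblem) (hn : D.Regular n)
    (hk : D.Regular (n + e k)) (hl : D.Regular (n + e k + e l)) :
    ∃ s, ∀ ζ ∈ D.jostDomain, (D.p l + ζ) * D.Lam (n + e k + e l) ζ
      = s * D.Lam (n + e k) ζ - (D.p k - ζ) * D.Lam n ζ := by
  have hi := h.inverseData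
  obtain ⟨c, hc⟩ := hi.shift_forward l (InverseData.solvesAffine_lam hl)
  obtain ⟨c', hc'⟩ := hi.shift_backward k (InverseData.solvesAffine_lam hn)
  have hd := hi.solvesAffine_add hc hc'
  rw [add_neg_cancel] at hd
  refine ⟨c + c', fun ζ hζ => ?_⟩
  have := hi.eq_const_mul_lam hk hd hζ
  linear_combination this

theorem wronskian_lam (h : D.ScatteringProblem) (hn : D.Regular n) (hk : D.Regular (n + e k))
    {x : ℂ} (hx : x ∈ D.jostDomain) (hx' : -x ∈ D.jostDomain) :
    (D.p k + x) * D.Lam (n + e k) x * D.Lam n (-x)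
      - (D.p k - x) * D.Lam (n + e k) (-x) * D.Lam n x = 2 * x := by
  have hi := h.inverseData
  obtain ⟨c, hc⟩ := hi.shift_forward k (InverseData.solvesAffine_lam hk)
  have := hi.wronskian_symm (InverseData.solvesAffine_lam hn) hc hx hx'
  linear_combination this

theorem wronskian_lam_a (h : D.ScatteringProblem) (hn : D.Regular n) (hk : D.Regular (n + e k)) :
    (D.p k + D.a) * D.Lam (n + e k) D.a * D.Lam n (-D.a)
      - (D.p k - D.a) * D.Lam (n + e k) (-D.a) * D.Lam n D.a = 2 * D.a :=
  h.wronskian_lam hn hk (h.mem_domain_of_mem_nodes a_mem_nodes)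
    (h.mem_domain_of_mem_nodes neg_a_mem_nodes)

theorem wronskian_lam_b (h : D.ScatteringProblem) (hn : D.Regular n) (hk : D.Regular (n + e k)) :
    (D.p k + D.b) * D.Lam (n + e k) D.b * D.Lam n (-D.b)
      - (D.p k - D.b) * D.Lam (n + e k) (-D.b) * D.Lam n D.b = 2 * D.b :=
  h.wronskian_lam hn hk (h.mem_domain_of_mem_nodes b_mem_nodes)
    (h.mem_domain_of_mem_nodes neg_b_mem_nodes)

/-- On a quadrilateral, the factor `s` of the three-point relation is the same along both paths, and
its product with the factor `t` of `exists_shift_sub_shift` is `p_k² - p_l²`. -/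
theorem exists_quadrilateral (h : D.ScatteringProblem) (hn : D.Regular n)
    (hk : D.Regular (n + e k)) (hl : D.Regular (n + e l)) (hkl : D.Regular (n + e k + e l)) :
    ∃ s t, s * t = D.p k ^ 2 - D.p l ^ 2 ∧
      (∀ ζ ∈ D.jostDomain, (D.p k + ζ) * D.Lam (n + e k) ζ - (D.p l + ζ) * D.Lam (n + e l) ζ
        = t * D.Lam n ζ) ∧
      ∀ ζ ∈ D.jostDomain, (D.p l + ζ) * D.Lam (n + e k + e l) ζ
        = s * D.Lam (n + e k) ζ - (D.p k - ζ) * D.Lam n ζ := by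
  obtain ⟨t, ht⟩ := h.exists_shift_sub_shift hn hk hl
  obtain ⟨s, hs⟩ := h.exists_three_point hn hk hkl
  have hlk := hkl
  rw [add_right_comm] at hlk
  obtain ⟨s', hs'⟩ := h.exists_three_point hn hl hlk
  refine ⟨s, t, ?_, ht, hs⟩
  have key : ∀ ζ ∈ D.jostDomain, (s - s') * ((D.p k + ζ) * D.Lam (n + e k) ζ)
      + (s' * t - (D.p k ^ 2 - D.p l ^ 2)) * D.Lam n ζ = 0 := by
    intro ζ hζ
    have e1 := hs ζ hζ
    have e2 := hs' ζ hζ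
    have e3 := ht ζ hζ
    rw [add_right_comm] at e2
    linear_combination (-(D.p k + ζ)) * e1 + (D.p l + ζ) * e2 - s' * e3
  -- `Λ(n)` and `(p_k + ζ) Λ(n + e_k)` are independent as functions of `ζ = ±a`
  have k1 := key _ (h.mem_domain_of_mem_nodes a_mem_nodes)
  have k2 := key _ (h.mem_domain_of_mem_nodes neg_a_mem_nodes)
  have w := h.wronskian_lam_a hn hk
  have ha := h.param.a_ne_zero
  have hss : s = s' := by
    have : 2 * D.a * (s - s') = 0 := by
      linear_combination D.Lam n (-D.a) * k1 - D.Lam n D.a * k2 - (s - s') * w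
    simpa [ha, sub_eq_zero] using this
  have : 2 * D.a * (s' * t - (D.p k ^ 2 - D.p l ^ 2)) = 0 := by
    linear_combination (D.p k + D.a) * D.Lam (n + e k) D.a * k2
      - (D.p k - D.a) * D.Lam (n + e k) (-D.a) * k1 - (s' * t - (D.p k ^ 2 - D.p l ^ 2)) * w
  rw [hss]
  simpa [ha, sub_eq_zero] using this

end ScatteringProblem

/-! ### The solution formula -/

open Classical in
/-- The function `S(x,y)`, computed with any direction in which the neighbour is regular. -/
def solS (D : Setup N) (x y : ℂ) (n : Fin N → ℤ) : ℂ :=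
  if h : ∃ k, D.Regular n ∧ D.Regular (n + e k) then D.shiftS n h.choose x y else 0

/-- The bilinear form `∑ c F(x,y)(n) f(x) g(y) / (x - y)`, summed over `x = ±a`, `y = ±b` with the
respective constant `c`. The solution and the factor `U` of its biquadratic are values of it on
Jost functions. -/
def form (D : Setup N) (cA cB cC cD : ℂ) (n : Fin N → ℤ) (f g : ℂ → ℂ) : ℂ :=
  cA * D.F D.a D.b n / (D.a - D.b) * (f D.a * g D.b)
    + cB * D.F D.a (-D.b) n / (D.a + D.b) * (f D.a * g (-D.b))
    - cC * D.F (-D.a) D.b n / (D.a + D.b) * (f (-D.a) * g D.b)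
    - cD * D.F (-D.a) (-D.b) n / (D.a - D.b) * (f (-D.a) * g (-D.b))

/-- The function `U` with `U(n) U(n + e_k) = H_k(u(n), u(n + e_k))`. -/
def factorU (D : Setup N) (cA cB cC cD : ℂ) (n : Fin N → ℤ) : ℂ :=
  (D.a ^ 2 - D.b ^ 2) * D.form cA cB cC cD n (D.Lam n) (D.Lam n)

variable {cA cB cC cD : ℂ} {n : Fin N → ℤ} {k l : Fin N}

theorem form_congr {f f' g g' : ℂ → ℂ} (hf : Set.EqOn f f' D.nodes) (hg : Set.EqOn g g' D.nodes) :
    D.form cA cB cC cD n f g = D.form cA cB cC cD n f' g' := by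
  unfold form
  rw [hf a_mem_nodes, hf neg_a_mem_nodes, hg b_mem_nodes, hg neg_b_mem_nodes]

theorem F_add_single (h : D.ValidParameters) {x y : ℂ} (hx : x ∈ D.nodes) (hy : y ∈ D.nodes) :
    D.F x y (n + e k) = D.F x y n * ((D.p k + x) * (D.p k + y) / D.P k) :=
  prod_zpow_add_single (x := fun r => (D.p r + x) * (D.p r + y) / D.P r)
    (div_ne_zero (mul_ne_zero (h.add_node_ne_zero k hx) (h.add_node_ne_zero k hy))
      (h.P_ne_zero k)) n

theorem F_mul_F_neg (h : D.ValidParameters) {x y : ℂ} (hx : x ^ 2 = D.a ^ 2)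
    (hy : y ^ 2 = D.b ^ 2) :
    D.F x y n * D.F (-x) (-y) n = 1 := by
  unfold F
  rw [← Finset.prod_mul_distrib]
  refine Finset.prod_eq_one fun r _ => ?_
  have hP := h.P_ne_zero r
  rw [← mul_zpow]
  have e1 : (D.p r + x) * (D.p r + y) / D.P r * ((D.p r + -x) * (D.p r + -y) / D.P r) = 1 := by
    field_simp
    rw [h.curve r, ← hx, ← hy]
    ring
  rw [e1, one_zpow]

theorem P_mul_form_add_single (h : D.ValidParameters) (f g : ℂ → ℂ) :
    D.P k * D.form cA cB cC cD (n + e k) f g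
      = D.form cA cB cC cD n (fun ζ => (D.p k + ζ) * f ζ) (fun ζ => (D.p k + ζ) * g ζ) := by
  have hP := h.P_ne_zero k
  unfold form
  rw [F_add_single h a_mem_nodes b_mem_nodes, F_add_single h a_mem_nodes neg_b_mem_nodes,
    F_add_single h neg_a_mem_nodes b_mem_nodes, F_add_single h neg_a_mem_nodes neg_b_mem_nodes]
  have h1 := h.a_sub_b_ne_zero
  have h2 := h.a_add_b_ne_zero
  field_simp

/-- The constraint on the constants, as a condition on the determinant of the form. -/
theorem constraint_iff (h : D.ValidParameters) :
    D.Constraint cA cB cC cD ↔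
      16 * D.a * D.b * (D.a ^ 2 - D.b ^ 2) ^ 2 *
        (-(cA * D.F D.a D.b n / (D.a - D.b) * (cD * D.F (-D.a) (-D.b) n / (D.a - D.b)))
          + cB * D.F D.a (-D.b) n / (D.a + D.b) * (cC * D.F (-D.a) D.b n / (D.a + D.b)))
        = D.δ ^ 2 := by
  have h1 := h.a_sub_b_ne_zero
  have h2 := h.a_add_b_ne_zero
  have ha := h.a_ne_zero
  have hb := h.b_ne_zero
  have f1 : D.F D.a D.b n * D.F (-D.a) (-D.b) n = 1 := F_mul_F_neg h rfl rfl
  have f2 : D.F D.a (-D.b) n * D.F (-D.a) D.b n = 1 := by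
    have := F_mul_F_neg (n := n) h (x := D.a) (y := -D.b) rfl (by ring)
    rwa [neg_neg] at this
  have e1 : -(cA * D.F D.a D.b n / (D.a - D.b) * (cD * D.F (-D.a) (-D.b) n / (D.a - D.b)))
      + cB * D.F D.a (-D.b) n / (D.a + D.b) * (cC * D.F (-D.a) D.b n / (D.a + D.b))
      = -(cA * cD * (D.a + D.b) ^ 2 - cB * cC * (D.a - D.b) ^ 2) / (D.a ^ 2 - D.b ^ 2) ^ 2 := by
    have e2 : D.a ^ 2 - D.b ^ 2 = (D.a - D.b) * (D.a + D.b) := by ring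
    rw [e2]
    field_simp
    linear_combination -cA * cD * (D.a + D.b) ^ 2 * f1 + cB * cC * (D.a - D.b) ^ 2 * f2
  have h3 : D.a ^ 2 - D.b ^ 2 ≠ 0 := sub_ne_zero.2 h.a_ne_b
  have h4 : 16 * D.a * D.b ≠ 0 := mul_ne_zero (mul_ne_zero (by norm_num) ha) hb
  have e3 : ∀ x, 16 * D.a * D.b * (D.a ^ 2 - D.b ^ 2) ^ 2 * (-x / (D.a ^ 2 - D.b ^ 2) ^ 2)
      = -x * (16 * D.a * D.b) := fun x => by field_simp
  rw [e1, e3, Constraint, ← neg_inj, neg_neg, eq_div_iff h4]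

namespace ScatteringProblem

theorem shiftS_eq (h : D.ScatteringProblem) (hn : D.Regular n) (hk : D.Regular (n + e k))
    (hl : D.Regular (n + e l)) {x y : ℂ} (hx : x ∈ D.nodes) (hy : y ∈ D.nodes) :
    D.shiftS n k x y = D.shiftS n l x y := by
  obtain ⟨t, ht⟩ := h.exists_shift_sub_shift hn hk hl
  unfold shiftS
  linear_combination 1 / (x - y) * (D.Lam n y * ht x (h.mem_domain_of_mem_nodes hx)
    - D.Lam n x * ht y (h.mem_domain_of_mem_nodes hy))

theorem solS_eq (h : D.ScatteringProblem) (hn : D.Regular n) (hk : D.Regular (n + e k)) {x y : ℂ}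
    (hx : x ∈ D.nodes) (hy : y ∈ D.nodes) : D.solS x y n = D.shiftS n k x y := by
  have hex : ∃ k, D.Regular n ∧ D.Regular (n + e k) := ⟨k, hn, hk⟩
  rw [solS, dif_pos hex]
  exact h.shiftS_eq hn hex.choose_spec.2 hk hx hy

theorem solution_eq_form (h : D.ScatteringProblem) (hn : D.Regular n) (hk : D.Regular (n + e k)) :
    D.solution D.solS cA cB cC cD n
      = D.form cA cB cC cD n (fun ζ => (D.p k + ζ) * D.Lam (n + e k) ζ) (D.Lam n)
        - D.form cA cB cC cD n (D.Lam n) (fun ζ => (D.p k + ζ) * D.Lam (n + e k) ζ) := by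
  unfold solution
  rw [h.solS_eq hn hk a_mem_nodes b_mem_nodes, h.solS_eq hn hk a_mem_nodes neg_b_mem_nodes,
    h.solS_eq hn hk neg_a_mem_nodes b_mem_nodes, h.solS_eq hn hk neg_a_mem_nodes neg_b_mem_nodes]
  have h1 := h.param.a_sub_b_ne_zero
  have h2 := h.param.a_add_b_ne_zero
  have e1 : -D.a - D.b = -(D.a + D.b) := by ring
  have e2 : -D.a - -D.b = -(D.a - D.b) := by ring
  unfold shiftS form
  rw [e1, e2, sub_neg_eq_add]
  simp only [one_div, inv_neg]
  ring

/-- The solution at `n + e_k`, in terms of the Jost functions at `n` and `n + e_k`. -/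
theorem P_mul_solution_add_single (h : D.ScatteringProblem) (hn : D.Regular n)
    (hk : D.Defined (n + e k)) :
    D.P k * D.solution D.solS cA cB cC cD (n + e k)
      = (D.p k ^ 2 - D.b ^ 2) *
          D.form cA cB cC cD n (fun ζ => (D.p k + ζ) * D.Lam (n + e k) ζ) (D.Lam n)
        - (D.p k ^ 2 - D.a ^ 2) *
          D.form cA cB cC cD n (D.Lam n) (fun ζ => (D.p k + ζ) * D.Lam (n + e k) ζ) := by
  obtain ⟨hk1, j, hj⟩ := hk
  obtain ⟨s, hs⟩ := h.exists_three_point hn hk1 hj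
  have hs' : Set.EqOn (fun ζ => (D.p j + ζ) * D.Lam (n + e k + e j) ζ)
      (fun ζ => s * D.Lam (n + e k) ζ - (D.p k - ζ) * D.Lam n ζ) D.nodes :=
    fun ζ hζ => hs ζ (h.mem_domain_of_mem_nodes hζ)
  rw [h.solution_eq_form hk1 hj, form_congr hs' fun _ _ => rfl, form_congr (fun _ _ => rfl) hs',
    mul_sub, P_mul_form_add_single h.param, P_mul_form_add_single h.param]
  unfold form
  ring

theorem P_mul_factorU_add_single (h : D.ScatteringProblem) :
    D.P k * D.factorU cA cB cC cD (n + e k)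
      = (D.a ^ 2 - D.b ^ 2) * D.form cA cB cC cD n (fun ζ => (D.p k + ζ) * D.Lam (n + e k) ζ)
          (fun ζ => (D.p k + ζ) * D.Lam (n + e k) ζ) := by
  rw [factorU, mul_left_comm, P_mul_form_add_single h.param]

/-- The determinant of the values of the form on the basis `Λ(n)`, `(p_k + ζ) Λ(n + e_k)`, by the
Cauchy-Binet formula and the Wronskian identity. -/
theorem form_det (h : D.ScatteringProblem) (hn : D.Regular n) (hk : D.Regular (n + e k)) :
    D.form cA cB cC cD n (fun ζ => (D.p k + ζ) * D.Lam (n + e k) ζ)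
          (fun ζ => (D.p k + ζ) * D.Lam (n + e k) ζ)
        * D.form cA cB cC cD n (D.Lam n) (D.Lam n)
      - D.form cA cB cC cD n (fun ζ => (D.p k + ζ) * D.Lam (n + e k) ζ) (D.Lam n)
        * D.form cA cB cC cD n (D.Lam n) (fun ζ => (D.p k + ζ) * D.Lam (n + e k) ζ)
      = 2 * D.a * (2 * D.b) *
        (-(cA * D.F D.a D.b n / (D.a - D.b) * (cD * D.F (-D.a) (-D.b) n / (D.a - D.b)))
          + cB * D.F D.a (-D.b) n / (D.a + D.b) * (cC * D.F (-D.a) D.b n / (D.a + D.b))) := by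
  rw [← h.wronskian_lam_a hn hk, ← h.wronskian_lam_b hn hk]
  unfold form
  ring

/-- The biquadratic of the solution factorizes. Let `α = Λ(n)` and `m = (p_k + ζ) Λ(n + e_k)`. Up to
the factor `(a² - b²)² / P_k`, the left-hand side is `form α α * form m m`, and the quadratic part of
the right-hand side is `form m α * form α m`; the constraint identifies their difference, the
determinant `form_det`, with the term containing `δ²`. -/
theorem factorU_mul_factorU (h : D.ScatteringProblem) (hc : D.Constraint cA cB cC cD)
    (hn : D.Regular n) (hk : D.Defined (n + e k)) :
    D.factorU cA cB cC cD n * D.factorU cA cB cC cD (n + e k)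
      = D.H k (D.solution D.solS cA cB cC cD n) (D.solution D.solS cA cB cC cD (n + e k)) := by
  have hP := h.param.P_ne_zero k
  have e0 := h.solution_eq_form (cA := cA) (cB := cB) (cC := cC) (cD := cD) hn hk.1
  have e1 := h.P_mul_solution_add_single (cA := cA) (cB := cB) (cC := cC) (cD := cD) hn hk
  have e2 := h.P_mul_factorU_add_single (cA := cA) (cB := cB) (cC := cC) (cD := cD)
    (n := n) (k := k)
  have hcu := h.param.curve k
  have hdet := (constraint_iff (n := n) h.param).1 hc
  have cb := h.form_det (cA := cA) (cB := cB) (cC := cC) (cD := cD) hn hk.1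
  have hH : D.P k * D.H k (D.solution D.solS cA cB cC cD n)
      (D.solution D.solS cA cB cC cD (n + e k))
      = D.P k ^ 2 * D.solution D.solS cA cB cC cD n ^ 2
        + (D.P k * D.solution D.solS cA cB cC cD (n + e k)) ^ 2
        - (2 * D.p k ^ 2 - D.a ^ 2 - D.b ^ 2) * D.solution D.solS cA cB cC cD n
          * (D.P k * D.solution D.solS cA cB cC cD (n + e k)) + D.δ ^ 2 / 4 := by
    unfold H
    field_simp
  refine mul_left_cancel₀ hP ?_
  rw [hH, e1, e0, hcu, mul_left_comm, e2, factorU]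
  linear_combination (D.a ^ 2 - D.b ^ 2) ^ 2 * cb + hdet / 4

/-- The second-order relation for the solution along a path `n → n + e_k → n + e_k + e_l`. -/
theorem solution_three_point (h : D.ScatteringProblem) (hn : D.Regular n)
    (hk : D.Regular (n + e k)) (hl : D.Defined (n + e k + e l)) {s : ℂ}
    (hs : ∀ ζ ∈ D.nodes, (D.p l + ζ) * D.Lam (n + e k + e l) ζ
      = s * D.Lam (n + e k) ζ - (D.p k - ζ) * D.Lam n ζ) :
    D.P l * D.solution D.solS cA cB cC cD (n + e k + e l)
      - (D.p l ^ 2 - D.p k ^ 2) * D.solution D.solS cA cB cC cD (n + e k)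
      - D.P k * D.solution D.solS cA cB cC cD n = s * D.factorU cA cB cC cD (n + e k) := by
  have hP := h.param.P_ne_zero k
  have hs' : Set.EqOn (fun ζ => (D.p l + ζ) * D.Lam (n + e k + e l) ζ)
      (fun ζ => s * D.Lam (n + e k) ζ - (D.p k - ζ) * D.Lam n ζ) D.nodes := hs
  have e2 := h.P_mul_solution_add_single (cA := cA) (cB := cB) (cC := cC) (cD := cD) hk hl
  have e1 := h.P_mul_solution_add_single (cA := cA) (cB := cB) (cC := cC) (cD := cD) hn
    ⟨hk, l, hl.1⟩
  have e0 := h.solution_eq_form (cA := cA) (cB := cB) (cC := cC) (cD := cD) hn hk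
  have eU := h.P_mul_factorU_add_single (cA := cA) (cB := cB) (cC := cC) (cD := cD)
    (n := n) (k := k)
  rw [form_congr hs' fun _ _ => rfl, form_congr (fun _ _ => rfl) hs'] at e2
  have e3 : D.P k * (D.P l * D.solution D.solS cA cB cC cD (n + e k + e l)) = _ :=
    congrArg (D.P k * ·) e2
  rw [mul_sub, mul_left_comm (D.P k), mul_left_comm (D.P k), mul_left_comm (D.P k),
    P_mul_form_add_single h.param, P_mul_form_add_single h.param, mul_left_comm (D.P l)] at e3
  refine mul_left_cancel₀ hP ?_
  have hcu := h.param.curve k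
  rw [mul_left_comm (D.P k) s, eU]
  have e4 : D.P k * (D.P k * D.solution D.solS cA cB cC cD n)
    = (D.p k ^ 2 - D.a ^ 2) * (D.p k ^ 2 - D.b ^ 2) * D.solution D.solS cA cB cC cD n := by
    rw [← hcu]; ring
  rw [mul_sub, mul_sub, e3, e4, mul_left_comm (D.P k), e1, e0]
  unfold form
  ring

/-- The relation for the solution at the three points `n`, `n + e_k`, `n + e_l`. -/
theorem solution_shift_sub_shift (h : D.ScatteringProblem) (hn : D.Regular n)
    (hk : D.Defined (n + e k)) (hl : D.Defined (n + e l)) {t : ℂ}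
    (ht : ∀ ζ ∈ D.nodes, (D.p k + ζ) * D.Lam (n + e k) ζ - (D.p l + ζ) * D.Lam (n + e l) ζ
      = t * D.Lam n ζ) :
    D.P k * D.solution D.solS cA cB cC cD (n + e k)
      - D.P l * D.solution D.solS cA cB cC cD (n + e l)
      - (D.p k ^ 2 - D.p l ^ 2) * D.solution D.solS cA cB cC cD n
      = t * D.factorU cA cB cC cD n := by
  have ht' : Set.EqOn (fun ζ => (D.p k + ζ) * D.Lam (n + e k) ζ)
      (fun ζ => (D.p l + ζ) * D.Lam (n + e l) ζ + t * D.Lam n ζ) D.nodes :=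
    fun ζ hζ => by
      beta_reduce
      linear_combination ht ζ hζ
  rw [h.P_mul_solution_add_single hn hk, h.P_mul_solution_add_single hn hl,
    h.solution_eq_form hn hk.1, form_congr ht' fun _ _ => rfl, form_congr (fun _ _ => rfl) ht',
    factorU]
  unfold form
  ring

theorem solution_Q3 (h : D.ScatteringProblem) (hc : D.Constraint cA cB cC cD)
    (hn : D.Defined n) (hk : D.Defined (n + e k)) (hl : D.Defined (n + e l))
    (hkl : D.Defined (n + e k + e l)) :
    D.Q3 k l (D.solution D.solS cA cB cC cD n) (D.solution D.solS cA cB cC cD (n + e k))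
      (D.solution D.solS cA cB cC cD (n + e l))
      (D.solution D.solS cA cB cC cD (n + e k + e l)) := by
  obtain ⟨s, t, hst, ht, hs⟩ := h.exists_quadrilateral hn.1 hk.1 hl.1 hkl.1
  have e1 := h.solution_three_point (cA := cA) (cB := cB) (cC := cC) (cD := cD) hn.1 hk.1 hkl
    fun ζ hζ => hs ζ (h.mem_domain_of_mem_nodes hζ)
  have e2 := h.solution_shift_sub_shift (cA := cA) (cB := cB) (cC := cC) (cD := cD) hn.1 hk hl
    fun ζ hζ => ht ζ (h.mem_domain_of_mem_nodes hζ)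
  have e3 := h.factorU_mul_factorU hc hn.1 hk
  have hPk := h.param.P_ne_zero k
  have hPl := h.param.P_ne_zero l
  have ck := h.param.curve k
  have cl := h.param.curve l
  unfold Q3
  unfold H at e3
  generalize D.solution D.solS cA cB cC cD n = u at *
  generalize D.solution D.solS cA cB cC cD (n + e k) = uk at *
  generalize D.solution D.solS cA cB cC cD (n + e l) = ul at *
  generalize D.solution D.solS cA cB cC cD (n + e k + e l) = ukl at *
  generalize D.factorU cA cB cC cD n = U at *
  generalize D.factorU cA cB cC cD (n + e k) = Uk at *
  refine mul_left_cancel₀ hPl ?_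
  have e4 : D.P l * (D.δ ^ 2 / (4 * D.P k * D.P l)) = D.δ ^ 2 / (4 * D.P k) := by field_simp
  linear_combination
    (D.P l * ukl - D.P k * u + (D.p k ^ 2 - D.p l ^ 2) * uk) * e2 + t * U * e1 + U * Uk * hst
    + (D.p k ^ 2 - D.p l ^ 2) * e3 - (D.p k ^ 2 - D.p l ^ 2) * e4 + u * uk * (ck - cl)

/-! ### The staircase -/

theorem defined_staircase (h : D.ScatteringProblem) (i : ℤ) : D.Defined (D.Γ i) := by
  have h1 := h.regular_staircase (i + 1)
  rw [h.stair.succ] at h1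
  exact ⟨h.regular_staircase i, _, h1⟩

/-- The solution has the potential `υ` on the staircase. -/
theorem potNumerator_solution (h : D.ScatteringProblem) (cA cB cC cD : ℂ) (i : ℤ) :
    D.potNumerator (fun j => D.solution D.solS cA cB cC cD (D.Γ j)) i
      = (D.q i + D.q (i + 1) + D.υ (i + 1)) * D.factorU cA cB cC cD (D.Γ (i + 1)) := by
  have e1 : D.Γ (i + 1) = D.Γ i + e (D.step i) := h.stair.succ i
  have e2 : D.Γ (i + 2) = D.Γ i + e (D.step i) + e (D.step (i + 1)) := by
    rw [← e1, ← h.stair.succ]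
    congr 1
    ring
  have r1 := h.regular_staircase (i + 1)
  have r2 := h.defined_staircase (i + 2)
  have hs : ∀ ζ ∈ D.nodes,
      (D.p (D.step (i + 1)) + ζ) * D.Lam (D.Γ i + e (D.step i) + e (D.step (i + 1))) ζ
        = (D.q i + D.q (i + 1) + D.υ (i + 1)) * D.Lam (D.Γ i + e (D.step i)) ζ
          - (D.p (D.step i) - ζ) * D.Lam (D.Γ i) ζ := by
    intro ζ hζ
    have hd := h.mem_domain_of_mem_nodes hζ
    rw [← e2, ← e1, h.eqOn_lam_jostLam _ hd, h.eqOn_lam_jostLam _ hd, h.eqOn_lam_jostLam _ hd]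
    have := jostLam_recurrence h.steps h.one_lt_K h.summable (h.notMem_regionP_of_domain hd) i
    simp only [q] at this ⊢
    linear_combination this
  rw [e1] at r1
  rw [e2] at r2
  have := h.solution_three_point (cA := cA) (cB := cB) (cC := cC) (cD := cD)
    (h.regular_staircase i) r1 r2 hs
  unfold potNumerator
  beta_reduce
  rw [e1, e2]
  exact this

theorem tendsto_solS (h : D.ScatteringProblem) {x y : ℂ} (hx : x ∈ D.nodes) (hy : y ∈ D.nodes)
    (hxy : x - y ≠ 0) : Tendsto (fun i => D.solS x y (D.Γ i)) atBot (𝓝 1) := by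
  have hdx := h.mem_domain_of_mem_nodes hx
  have hdy := h.mem_domain_of_mem_nodes hy
  have lx := tendsto_jostLam_atBot h.steps h.one_lt_K h.summable (h.notMem_regionP_of_domain hdx)
  have ly := tendsto_jostLam_atBot h.steps h.one_lt_K h.summable (h.notMem_regionP_of_domain hdy)
  have hsh : Tendsto (fun i : ℤ => i + 1) atBot atBot :=
    tendsto_atBot_add_const_right _ 1 tendsto_id
  have lx' := lx.comp hsh
  have ly' := ly.comp hsh
  obtain ⟨C, hC⟩ := h.steps.finite_range.isBounded.exists_norm_le
  have hd : Tendsto (fun i => D.q i * (jostLam D.q D.υ (i + 1) x * jostLam D.q D.υ i y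
      - jostLam D.q D.υ i x * jostLam D.q D.υ (i + 1) y)) atBot (𝓝 0) := by
    have hz := (lx'.mul ly).sub (lx.mul ly')
    rw [sub_self] at hz
    exact isBoundedUnder_le_mul_tendsto_zero
      (isBoundedUnder_of ⟨C, fun i => hC _ ⟨i, rfl⟩⟩) hz
  have hl := (hd.add (((lx'.mul ly).const_mul x).sub ((lx.mul ly').const_mul y))).const_mul
    (1 / (x - y))
  have e1 : 1 / (x - y) * (0 + (x * (1 * 1) - y * (1 * 1))) = 1 := by field_simp; ring
  rw [e1] at hl
  refine hl.congr fun i => ?_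
  have hk := h.regular_staircase (i + 1)
  rw [h.stair.succ] at hk
  rw [h.solS_eq (h.regular_staircase i) hk hx hy, shiftS, ← h.stair.succ,
    h.eqOn_lam_jostLam _ hdx, h.eqOn_lam_jostLam _ hdy, h.eqOn_lam_jostLam _ hdx,
    h.eqOn_lam_jostLam _ hdy]
  simp only [Function.comp_apply, q]
  ring

/-- The form takes arbitrary values on the bases `Λ(n)`, `(p_k + ζ) Λ(n + e_k)` of the functions on
`{a, -a}` and on `{b, -b}`. The bases are independent by the Wronskian identity. -/
theorem exists_form_eq (h : D.ScatteringProblem) (hn : D.Regular n) (hk : D.Regular (n + e k))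
    (x₀ x₁ x₂ x₃ : ℂ) : ∃ cA cB cC cD : ℂ,
      D.form cA cB cC cD n (D.Lam n) (D.Lam n) = x₀ ∧
      D.form cA cB cC cD n (fun ζ => (D.p k + ζ) * D.Lam (n + e k) ζ) (D.Lam n) = x₁ ∧
      D.form cA cB cC cD n (D.Lam n) (fun ζ => (D.p k + ζ) * D.Lam (n + e k) ζ) = x₂ ∧
      D.form cA cB cC cD n (fun ζ => (D.p k + ζ) * D.Lam (n + e k) ζ)
        (fun ζ => (D.p k + ζ) * D.Lam (n + e k) ζ) = x₃ := by
  have wa := h.wronskian_lam_a hn hk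
  have wb := h.wronskian_lam_b hn hk
  have h1 := h.param.a_sub_b_ne_zero
  have h2 := h.param.a_add_b_ne_zero
  have ha := h.param.a_ne_zero
  have hb := h.param.b_ne_zero
  have f1 : D.F D.a D.b n * D.F (-D.a) (-D.b) n = 1 := F_mul_F_neg h.param rfl rfl
  have f2 : D.F D.a (-D.b) n * D.F (-D.a) D.b n = 1 := by
    have := F_mul_F_neg (n := n) h.param (x := D.a) (y := -D.b) rfl (by ring)
    rwa [neg_neg] at this
  have g1 := left_ne_zero_of_mul_eq_one f1
  have g2 := right_ne_zero_of_mul_eq_one f1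
  have g3 := left_ne_zero_of_mul_eq_one f2
  have g4 := right_ne_zero_of_mul_eq_one f2
  unfold form
  generalize D.F D.a D.b n = F₁ at *
  generalize D.F D.a (-D.b) n = F₂ at *
  generalize D.F (-D.a) D.b n = F₃ at *
  generalize D.F (-D.a) (-D.b) n = F₄ at *
  generalize D.Lam n D.a = α₁ at *
  generalize D.Lam n (-D.a) = α₂ at *
  generalize D.Lam n D.b = α₃ at *
  generalize D.Lam n (-D.b) = α₄ at *
  have em : ∀ x, D.p k + -x = D.p k - x := fun x => (sub_eq_add_neg _ _).symm
  beta_reduce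
  rw [em, em]
  generalize (D.p k + D.a) * D.Lam (n + e k) D.a = m₁ at *
  generalize (D.p k - D.a) * D.Lam (n + e k) (-D.a) = m₂ at *
  generalize (D.p k + D.b) * D.Lam (n + e k) D.b = m₃ at *
  generalize (D.p k - D.b) * D.Lam (n + e k) (-D.b) = m₄ at *
  -- the matrix of the form, from the dual basis `(-m₂, m₁)/(2a)`, `(α₂, -α₁)/(2a)` of the basis
  -- `(α₁, α₂)`, `(m₁, m₂)`, and likewise for `b`
  obtain ⟨w, hw⟩ : ∃ w, w = 2 * D.a * (2 * D.b) := ⟨_, rfl⟩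
  have hw0 : w ≠ 0 := by
    rw [hw]
    exact mul_ne_zero (mul_ne_zero two_ne_zero ha) (mul_ne_zero two_ne_zero hb)
  rw [← wa, ← wb] at hw
  have c1 : ∀ {x F : ℂ} (z : ℂ), x ≠ 0 → F ≠ 0 → x / F * z * F / x = z := fun z hx hF => by
    field_simp
  have c2 : ∀ {x : ℂ}, x * ((m₁ * α₂ - m₂ * α₁) * (m₃ * α₄ - m₄ * α₃)) / w = x := fun {x} => by
    rw [← hw, mul_div_cancel_right₀ _ hw0]
  refine ⟨(D.a - D.b) / F₁ * ((x₃ * α₂ * α₄ - x₁ * α₂ * m₄ - x₂ * m₂ * α₄ + x₀ * m₂ * m₄) / w),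
    (D.a + D.b) / F₂ * ((-x₃ * α₂ * α₃ + x₁ * α₂ * m₃ + x₂ * m₂ * α₃ - x₀ * m₂ * m₃) / w),
    (D.a + D.b) / F₃ * -((-x₃ * α₁ * α₄ + x₁ * α₁ * m₄ + x₂ * m₁ * α₄ - x₀ * m₁ * m₄) / w),
    (D.a - D.b) / F₄ * -((x₃ * α₁ * α₃ - x₁ * α₁ * m₃ - x₂ * m₁ * α₃ + x₀ * m₁ * m₃) / w),
    ?_, ?_, ?_, ?_⟩
  all_goals
    rw [c1 _ h1 g1, c1 _ h2 g3, c1 _ h2 g4, c1 _ h1 g2]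
    refine Eq.trans ?_ c2
    ring

/-- Every solution of the initial value relations with potential `υ` is given by the solution
formula: the constants are determined by the data at the base point. -/
theorem exists_solution_eq (h : D.ScatteringProblem) {v V : ℤ → ℂ} (hV : ∀ i, V i ≠ 0)
    (hH : ∀ i, V i * V (i + 1) = D.H (D.step i) (v i) (v (i + 1)))
    (hυ : ∀ i, D.υ (i + 1) = D.potNumerator v i / V (i + 1) - D.q i - D.q (i + 1)) :
    ∃ cA cB cC cD : ℂ, D.Constraint cA cB cC cD ∧
      ∀ i, v i = D.solution D.solS cA cB cC cD (D.Γ i) := by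
  have hrec : ∀ i, D.potNumerator v i = (D.q i + D.q (i + 1) + D.υ (i + 1)) * V (i + 1) := by
    intro i
    have := hV (i + 1)
    rw [hυ i]
    field_simp
    ring
  have hab : D.a ^ 2 - D.b ^ 2 ≠ 0 := sub_ne_zero.2 h.param.a_ne_b
  have hP := h.param.P_ne_zero
  have hn := h.regular_staircase D.i₀
  have hk := h.defined_staircase (D.i₀ + 1)
  have es := h.stair.succ D.i₀
  rw [es] at hk
  set k := D.step D.i₀ with hkdef
  obtain ⟨cA, cB, cC, cD, x0, x1, x2, x3⟩ := h.exists_form_eq hn hk.1 (V D.i₀ / (D.a ^ 2 - D.b ^ 2))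
    ((D.P k * v (D.i₀ + 1) - (D.p k ^ 2 - D.a ^ 2) * v D.i₀) / (D.a ^ 2 - D.b ^ 2))
    ((D.P k * v (D.i₀ + 1) - (D.p k ^ 2 - D.b ^ 2) * v D.i₀) / (D.a ^ 2 - D.b ^ 2))
    (D.P k * V (D.i₀ + 1) / (D.a ^ 2 - D.b ^ 2))
  have hu0 : v D.i₀ = D.solution D.solS cA cB cC cD (D.Γ D.i₀) := by
    rw [h.solution_eq_form hn hk.1, x1, x2]
    field_simp
    ring
  have hu1 : v (D.i₀ + 1) = D.solution D.solS cA cB cC cD (D.Γ (D.i₀ + 1)) := by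
    refine mul_left_cancel₀ (hP k) ?_
    rw [es, h.P_mul_solution_add_single hn hk, x1, x2]
    field_simp
    ring
  have hU0 : V D.i₀ = D.factorU cA cB cC cD (D.Γ D.i₀) := by
    rw [factorU, x0]
    field_simp
  have hU1 : V (D.i₀ + 1) = D.factorU cA cB cC cD (D.Γ (D.i₀ + 1)) := by
    refine mul_left_cancel₀ (hP k) ?_
    rw [es, h.P_mul_factorU_add_single, x3]
    field_simp
  have hc : D.Constraint cA cB cC cD := by
    refine (constraint_iff (n := D.Γ D.i₀) h.param).2 ?_
    have cb := h.form_det (cA := cA) (cB := cB) (cC := cC) (cD := cD) hn hk.1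
    have hh := hH D.i₀
    have hcu := h.param.curve k
    have hPk := hP k
    rw [← hkdef, H] at hh
    rw [x0, x1, x2, x3] at cb
    have hh' : D.P k * (V D.i₀ * V (D.i₀ + 1)) = D.P k ^ 2 * (v D.i₀ ^ 2 + v (D.i₀ + 1) ^ 2)
        - (2 * D.p k ^ 2 - D.a ^ 2 - D.b ^ 2) * v D.i₀ * (D.P k * v (D.i₀ + 1))
        + D.δ ^ 2 / 4 := by
      rw [hh]
      field_simp
    rw [div_mul_div_comm, div_mul_div_comm, ← sub_div, div_eq_iff (mul_ne_zero hab hab)] at cb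
    linear_combination -4 * cb + 4 * hh' + 4 * v D.i₀ ^ 2 * hcu
  refine ⟨cA, cB, cC, cD, hc, ?_⟩
  have hrecU := h.potNumerator_solution cA cB cC cD
  have hHU : ∀ i, D.factorU cA cB cC cD (D.Γ i) * D.factorU cA cB cC cD (D.Γ (i + 1))
      = D.H (D.step i) (D.solution D.solS cA cB cC cD (D.Γ i))
        (D.solution D.solS cA cB cC cD (D.Γ (i + 1))) := by
    intro i
    have hd := h.defined_staircase (i + 1)
    rw [h.stair.succ] at hd ⊢
    exact h.factorU_mul_factorU hc (h.regular_staircase i) hd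
  generalize hu : (fun j => D.solution D.solS cA cB cC cD (D.Γ j)) = u at *
  have hu' : ∀ j, D.solution D.solS cA cB cC cD (D.Γ j) = u j := fun j => congrFun hu j
  simp only [hu'] at *
  generalize hUU : (fun j => D.factorU cA cB cC cD (D.Γ j)) = U at *
  have hUU' : ∀ j, D.factorU cA cB cC cD (D.Γ j) = U j := fun j => congrFun hUU j
  simp only [hUU'] at *
  unfold potNumerator at hrec hrecU
  have key : ∀ i, (v i = u i ∧ V i = U i) ∧ v (i + 1) = u (i + 1) ∧ V (i + 1) = U (i + 1) := by
    intro i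
    induction i using Int.inductionOn' (b := D.i₀) with
    | zero => exact ⟨⟨hu0, hU0⟩, hu1, hU1⟩
    | succ i _ ih =>
      obtain ⟨⟨i1, i2⟩, i3, i4⟩ := ih
      have e1 : i + 1 + 1 = i + 2 := by ring
      have hv : v (i + 1 + 1) = u (i + 1 + 1) := by
        refine mul_left_cancel₀ (hP (D.step (i + 1))) ?_
        have a1 := hrec i
        have a2 := hrecU i
        rw [i1, i3, i4] at a1
        rw [e1]
        linear_combination a1 - a2
      refine ⟨⟨i3, i4⟩, hv, mul_left_cancel₀ (hV (i + 1)) ?_⟩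
      have b1 := hH (i + 1)
      have b2 := hHU (i + 1)
      rw [i3, hv, ← b2, i4] at b1
      rw [i4]
      exact b1
    | pred i _ ih =>
      obtain ⟨⟨i1, i2⟩, i3, i4⟩ := ih
      have e1 : i - 1 + 1 = i := by ring
      have e2 : i - 1 + 2 = i + 1 := by ring
      have hv : v (i - 1) = u (i - 1) := by
        refine mul_left_cancel₀ (hP (D.step (i - 1))) ?_
        have a1 := hrec (i - 1)
        have a2 := hrecU (i - 1)
        rw [e1, e2] at a1 a2
        rw [i1, i3, i2] at a1
        linear_combination a2 - a1
      rw [e1]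
      refine ⟨⟨hv, mul_right_cancel₀ (hV i) ?_⟩, i1, i2⟩
      have b1 := hH (i - 1)
      have b2 := hHU (i - 1)
      rw [e1] at b1 b2
      rw [b1, hv, i1, ← b2, i2]
  exact fun i => (key i).1.1

end ScatteringProblem

end Setup

end Q3IST

end

open Q3IST in
theorem theorem2p2 {N : ℕ} (D : Setup N)
    (hparam : D.ValidParameters) (hstair : D.IsStaircase) (hweight : D.ValidWeight)
    (hadm : Admissible D.q D.υ D.i₀ D.K)
    (hsymm : D.pot D.a D.b = D.pot D.b D.a)
    (hcontour : D.ValidContour) :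
    -- the `N`-dimensional Jost function exists along the staircase and extends the Jost solution
    (∀ i, D.Regular (D.Γ i) ∧ Set.EqOn (D.Lam (D.Γ i)) (jostLam D.q D.υ i) D.jostDomain) ∧
    -- the functions `S` do not depend on the direction of the shift
    ∃ S : ℂ → ℂ → (Fin N → ℤ) → ℂ,
      (∀ n k, D.Regular n → D.Regular (n + e k) →
        ∀ x ∈ ({D.a, -D.a} : Set ℂ), ∀ y ∈ ({D.b, -D.b} : Set ℂ), S x y n = D.shiftS n k x y) ∧
      (∀ x ∈ ({D.a, -D.a} : Set ℂ), ∀ y ∈ ({D.b, -D.b} : Set ℂ),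
        Tendsto (fun i => S x y (D.Γ i)) atBot (𝓝 1)) ∧
      (∀ cA cB cC cD : ℂ, D.Constraint cA cB cC cD →
        -- `u` solves `Q3_δ` on every elementary quadrilateral
        (∀ n k l, k ≠ l → D.Defined n → D.Defined (n + e k) → D.Defined (n + e l) →
          D.Defined (n + e k + e l) →
          D.Q3 k l (D.solution S cA cB cC cD n) (D.solution S cA cB cC cD (n + e k))
            (D.solution S cA cB cC cD (n + e l)) (D.solution S cA cB cC cD (n + e k + e l))) ∧
        -- `u` has the prescribed potential along the staircase
        ∃ U : (Fin N → ℤ) → ℂ,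
          (∀ n k, D.Defined n → D.Defined (n + e k) →
            U n * U (n + e k) =
              D.H k (D.solution S cA cB cC cD n) (D.solution S cA cB cC cD (n + e k))) ∧
          (∀ i, D.potNumerator (fun j => D.solution S cA cB cC cD (D.Γ j)) i =
            (D.q i + D.q (i + 1) + D.υ (i + 1)) * U (D.Γ (i + 1)))) ∧
      -- conversely, every solution of the initial value relations with this potential arises so
      (∀ v V : ℤ → ℂ, (∀ i, V i ≠ 0) → (∀ i, V i * V (i + 1) = D.H (D.step i) (v i) (v (i + 1))) →
        (∀ i, D.υ (i + 1) = D.potNumerator v i / V (i + 1) - D.q i - D.q (i + 1)) →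
        ∃ cA cB cC cD : ℂ, D.Constraint cA cB cC cD ∧
          ∀ i, v i = D.solution S cA cB cC cD (D.Γ i)) := by
  have h : D.ScatteringProblem := ⟨hparam, hstair, hweight, hadm, hcontour⟩
  have hx : ∀ x ∈ ({D.a, -D.a} : Set ℂ), x ∈ D.nodes := by
    rintro x (rfl | rfl)
    exacts [Setup.a_mem_nodes, Setup.neg_a_mem_nodes]
  have hy : ∀ y ∈ ({D.b, -D.b} : Set ℂ), y ∈ D.nodes := by
    rintro y (rfl | rfl)
    exacts [Setup.b_mem_nodes, Setup.neg_b_mem_nodes]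
  have hxy : ∀ x ∈ ({D.a, -D.a} : Set ℂ), ∀ y ∈ ({D.b, -D.b} : Set ℂ), x - y ≠ 0 := by
    rintro x (rfl | rfl) y (rfl | rfl) h0
    · exact hparam.a_ne_b (by linear_combination (D.a + D.b) * h0)
    · exact hparam.a_ne_b (by linear_combination (D.a - D.b) * h0)
    · exact hparam.a_ne_b (by linear_combination (D.b - D.a) * h0)
    · exact hparam.a_ne_b (by linear_combination (-D.a - D.b) * h0)
  refine ⟨fun i => ⟨h.regular_staircase i, h.eqOn_lam_jostLam i⟩, D.solS,
    fun n k hn hk x hx' y hy' => h.solS_eq hn hk (hx x hx') (hy y hy'),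
    fun x hx' y hy' => h.tendsto_solS (hx x hx') (hy y hy') (hxy x hx' y hy'),
    fun cA cB cC cD hc => ⟨fun n k l _ hn hk hl hkl => h.solution_Q3 hc hn hk hl hkl,
      D.factorU cA cB cC cD, fun n k hn hk => h.factorU_mul_factorU hc hn.1 hk,
      h.potNumerator_solution cA cB cC cD⟩,
    fun v V hV hH hυ => h.exists_solution_eq hV hH hυ⟩
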